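/- Let $\beta\in[0,1)$, $l\in\mathbb{R}\setminus\{0\}$ and let $N\ge 2$ be an integer. Consider, on $[0,\infty)\times\mathbb{R}^2$ with $\mathbb{R}^2\cong\mathbb{C}$, the generalized surface quasi-geostrophic equation $$\partial_t\theta+v\cdot\nabla\theta=0,\qquad v=-\nabla^\perp(-\Delta)^{-1+\beta/2}\theta,\qquad \nabla^\perp=(-\partial_2,\partial_1),$$ where $(-\Delta)^{-1+\beta/2}\theta=K_\beta*\theta$ with $K_0(x)=-\frac1{2\pi}\log|x|$ and, for $\beta>0$, $K_\beta(x)=\frac{C_\beta}{2\pi}|x|^{-\beta}$, $C_\beta=\frac{\Gamma(\beta/2)}{2^{1-\beta}\Gamma\left(\frac{2-\beta}{2}\right)}$ (for $\beta=0$ these are the Euler equations in vorticity form). Then there exists $\varepsilon_0>0$ with the following property. For every $\varepsilon\in(0,\varepsilon_0)$ there are a simply connected bounded domain $D^\varepsilon\subset\mathbb{C}$ with boundary of class $C^1$ and a number $\Omega(\varepsilon)\in\mathbb{R}$ such that: 1. the centre of mass of $D^\varepsilon$ is $l$, i.e. $\frac{1}{|D^\varepsilon|}\int_{D^\varepsilon}z\,dA(z)=l$;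 2. $D^\varepsilon$ is a small perturbation of the disc of radius $\varepsilon$ centred at $l$: with $B(l,r)=\{z:|z-l|<r\}$, $B\big(l,\varepsilon(1-\varepsilon^{1+\beta})\big)\subset D^\varepsilon\subset B\big(l,\varepsilon(1+\varepsilon^{1+\beta})\big)$; 3. with $$\theta_0(x)=\frac{1}{\pi\varepsilon^2}\sum_{m=0}^{N-1}\mathbf 1_{e^{2\pi i m/N}D^\varepsilon}(x),$$ the rotating function $\theta(t,x)=\theta_0(e^{-i\Omega(\varepsilon)t}x)$ is a global weak solution, in the class of bounded integrable functions, of the equation above with initial datum $\theta_0$. (By 2, as $\varepsilon\to0$ the data $\theta_0$ converge weakly to $\sum_{m=0}^{N-1}\delta_{e^{2\pi i m/N}l}$, the Thomson $N$-gon of point vortices.) -/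

import Mathlib

open Set MeasureTheory
open scoped ContDiff

noncomputable section

namespace VortexPolygon

/-- The normalizing constant `C_β = Γ(β/2) / (2^(1-β) Γ((2-β)/2))` for which
`(C_β / 2π) |x|^(-β)` is the kernel of `(-Δ)^(-1+β/2)` in the plane, `0 < β < 2`. -/
def rieszConst (β : ℝ) : ℝ :=
  Real.Gamma (β / 2) / ((2 : ℝ) ^ (1 - β) * Real.Gamma ((2 - β) / 2))

/-- The kernel `K_β` of `(-Δ)^(-1+β/2)` in the plane: logarithmic for `β = 0` (Euler), a power
law for `β > 0`. -/
def kernel (β : ℝ) (x : ℂ) : ℝ :=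
  if β = 0 then -(1 / (2 * Real.pi)) * Real.log ‖x‖
  else rieszConst β / (2 * Real.pi) * (1 / ‖x‖ ^ β)

/-- `(-Δ)^(-1+β/2) θ = K_β * θ`. -/
def potential (β : ℝ) (θ : ℂ → ℝ) (x : ℂ) : ℝ :=
  ∫ y, kernel β (x - y) * θ y

/-- The velocity `v = -∇^⊥ (-Δ)^(-1+β/2) θ`, where `∇^⊥ = (-∂₂, ∂₁)`; the plane is `ℂ`. -/
def velocity (β : ℝ) (θ : ℂ → ℝ) (x : ℂ) : ℂ :=
  ⟨fderiv ℝ (potential β θ) x Complex.I, -fderiv ℝ (potential β θ) x 1⟩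

/-- `θ` is a global weak solution, in the class of bounded integrable functions, of
`θ_t + v · ∇θ = 0`, `v = -∇^⊥ (-Δ)^(-1+β/2) θ` on `[0,∞) × ℝ²` with `θ(0,·) = θ₀`.
As `v` is divergence free, the transport term is tested in the form `θ v · ∇φ`.  The conditions
`potential_integrable`, `potential_contDiff`, `integrable_test` say that the convolution, the
velocity and the weak formulation are all meaningful. -/
structure IsWeakSolution (β : ℝ) (θ₀ : ℂ → ℝ) (θ : ℝ → ℂ → ℝ) : Prop where
  aestronglyMeasurable :
    AEStronglyMeasurable (fun p : ℝ × ℂ => θ p.1 p.2) (volume.restrict (Ici 0 ×ˢ univ))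
  bounded : ∃ M : ℝ, ∀ t : ℝ, 0 ≤ t → ∀ x : ℂ, |θ t x| ≤ M
  integrable : ∀ t : ℝ, 0 ≤ t → Integrable (θ t)
  initial : θ 0 = θ₀
  potential_integrable : ∀ t : ℝ, 0 ≤ t → ∀ x : ℂ, Integrable (fun y => kernel β (x - y) * θ t y)
  potential_contDiff : ∀ t : ℝ, 0 ≤ t → ContDiff ℝ 1 (potential β (θ t))
  integrable_test : ∀ φ : ℝ × ℂ → ℝ, ContDiff ℝ ∞ φ → HasCompactSupport φ →
    Integrable
      (fun p : ℝ × ℂ => θ p.1 p.2 *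
        (fderiv ℝ φ p (1, 0) + fderiv ℝ φ p (0, velocity β (θ p.1) p.2)))
      (volume.restrict (Ici 0 ×ˢ univ))
  weak : ∀ φ : ℝ × ℂ → ℝ, ContDiff ℝ ∞ φ → HasCompactSupport φ →
    (∫ p in (Ici (0 : ℝ) ×ˢ (univ : Set ℂ)), θ p.1 p.2 *
        (fderiv ℝ φ p (1, 0) + fderiv ℝ φ p (0, velocity β (θ p.1) p.2)))
      + ∫ x, θ₀ x * φ (0, x) = 0

/-- `θ₀` evolves by rotation about the origin with constant angular velocity `ω`:
`θ(t,x) = θ₀(e^(-iΩt) x)` solves the equation with initial datum `θ₀`. -/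
def IsRotatingSolution (β : ℝ) (θ₀ : ℂ → ℝ) (Ω : ℝ) : Prop :=
  IsWeakSolution β θ₀ (fun t x => θ₀ (Complex.exp (-(Complex.I * Ω * t)) * x))

/-- The boundary of `D` is of class `C¹`: near each boundary point, `D` is the set where some `C¹`
function with nonvanishing differential is negative. -/
def HasC1Boundary (D : Set ℂ) : Prop :=
  ∀ p ∈ frontier D, ∃ (U : Set ℂ) (ρ : ℂ → ℝ), IsOpen U ∧ p ∈ U ∧ ContDiffOn ℝ 1 ρ U ∧
    (∀ x ∈ U, fderiv ℝ ρ x ≠ 0) ∧ D ∩ U = {x ∈ U | ρ x < 0}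

/-- A simply connected bounded domain of class `C¹` in the plane. -/
structure IsSimplyConnectedC1Domain (D : Set ℂ) : Prop where
  isOpen : IsOpen D
  simplyConnected : IsSimplyConnected D
  isBounded : Bornology.IsBounded D
  c1 : HasC1Boundary D

/-- The datum `(1 / (π ε²)) ∑_{m=0}^{N-1} 1_{e^(2πim/N) D}`. -/
def polygonPatch (N : ℕ) (ε : ℝ) (D : Set ℂ) (x : ℂ) : ℝ :=
  1 / (Real.pi * ε ^ 2) * ∑ m ∈ Finset.range N,
    ((fun z : ℂ => Complex.exp (2 * Real.pi * Complex.I * m / N) * z) '' D).indicator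
      (fun _ => (1 : ℝ)) x

end VortexPolygon

end

noncomputable section

namespace VortexPolygon

open Filter Topology

/-! ### The radial profile of the kernel -/

/-! Look for D = l + εP, where P = {r < 1 + u(α)} is a small even perturbation of the unit disc, and
put L = l/ε. A bounded density that is stationary in the rotating frame gives a rotating solution.
For the sum of the rotated copies of D, stationarity follows once the effective potential (the
potential plus Ω|x|²/2) is constant on the frontier of D (`isRotatingSolution_polygonPatch`). No
regularity of the boundary enters this criterion: the weak formulation is the integral over D of a
Jacobian, and it vanishes when a C¹ stream function is constant on the frontier
(`integral_jacobian_level_set`). What remains is one equation for a function on the circle, "the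
effective potential along the boundary is constant", together with the centroid condition.

This equation can be solved in the supremum norm. Since β < 1, potentials of bounded densities are
C¹ (`contDiff_pot`), and the potential of a nearly circular patch on its own boundary is strictly
differentiable in u, with derivative −a u + S u at the disc (`exists_patchPot_boundary`). Here S is
convolution with k(η) = profile(|1 − e^(iη)|) and −a is the radial slope of the potential of the
disc at the unit circle. Translating the disc shows that a is the multiplier of S on the first
Fourier mode (`hasDerivAt_patchPot_zero`), so cos is annihilated by −a + S. Constants are harmless
because the level is free. On the remaining even functions −a + S is invertible because S has norm
less than a there. Indeed, as a function of τ = |1 − e^(iη)|²/2 = 1 − cos η the profile is convex,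
so k minus its tangent at τ = 1 is nonnegative. The tangent is a combination of 1 and cos η and does
not act on functions without these modes, so S has norm at most g = ∫ k − 2π profile(√2)
(`abs_layerPot_le_layerGap`). Moreover a − g = ∫ (profile(√2) − τk) is positive by Jensen's
inequality, −τ·profile being strictly convex and τ having mean 1 (`layerGap_lt_layerEig`).

The first mode of the equation is solved by adjusting the angular velocity, and the first mode of u
is fixed by the centroid condition. A contraction argument for these unknowns together is
`exists_reduced_solution`. The other patches lie at distance of order R ~ 1/ε. Their leading effect
is a uniform force, cancelled by the centrifugal term with coefficient `farDrift`; what is left is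
O(R^(-2-β)) = O(ε^(2+β)) (`farPot_zero_le`), which beats the required ε^(1+β) by one factor ε
(`exists_equilibrium`). Finally, the effective potential is C¹ with nonzero radial slope near the
circle, so the level curve that has been found is automatically C¹ (`hasC1Boundary_of_radial`). -/

/-- The radial profile of the kernel, normalized so that its derivative is `-t^(-1-β)`. -/
def profile (β t : ℝ) : ℝ := if β = 0 then -Real.log t else t ^ (-β) / β

/-- The factor between `kernel` and `profile`. -/
def kernelFactor (β : ℝ) : ℝ :=
  if β = 0 then 1 / (2 * Real.pi) else β * rieszConst β / (2 * Real.pi)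

theorem kernel_eq {β : ℝ} (x : ℂ) : kernel β x = kernelFactor β * profile β ‖x‖ := by
  unfold kernel kernelFactor profile
  split_ifs with h
  · ring
  · rw [Real.rpow_neg (norm_nonneg x)]
    field_simp

theorem measurable_profile (β : ℝ) : Measurable (profile β) := by
  unfold profile
  split_ifs
  · exact Real.measurable_log.neg
  · fun_prop

theorem hasDerivAt_profile (β : ℝ) {t : ℝ} (ht : 0 < t) :
    HasDerivAt (profile β) (-t ^ (-1 - β)) t := by
  unfold profile
  by_cases h : β = 0
  · subst h
    simp only [if_true, sub_zero, Real.rpow_neg_one]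
    exact (Real.hasDerivAt_log ht.ne').neg
  · simp only [h, if_false]
    have := (Real.hasDerivAt_rpow_const (x := t) (p := -β) (Or.inl ht.ne')).div_const β
    convert! this using 1
    field_simp
    ring_nf

/-- The logarithm is homogeneous only up to an additive constant. The constant can stay existential
because only level sets of potentials matter. -/
theorem profile_scale (β : ℝ) {ε : ℝ} (hε : 0 < ε) :
    ∃ c : ℝ, ∀ t, 0 < t → profile β (ε * t) = ε ^ (-β) * profile β t + c := by
  unfold profile
  by_cases h : β = 0
  · refine ⟨-Real.log ε, fun t ht => ?_⟩
    simp only [h, if_true, neg_zero, Real.rpow_zero]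
    rw [Real.log_mul hε.ne' ht.ne']; ring
  · refine ⟨0, fun t ht => ?_⟩
    simp only [h, if_false]
    rw [Real.mul_rpow hε.le ht.le]; ring

theorem one_sub_rpow_le {v p : ℝ} (hv : 0 < v) : 1 - v ^ p ≤ -(p * Real.log v) := by
  rw [Real.rpow_def_of_pos hv]
  have := Real.add_one_le_exp (Real.log v * p)
  linarith

/-- Subadditivity of t^γ gives (1 + t)^γ ≤ 1 + t^γ; then log s ≤ s − 1 is used at s = (1 + t)^γ. -/
theorem log_one_add_le_rpow {t γ : ℝ} (ht : 0 ≤ t) (hγ : 0 < γ) (hγ1 : γ ≤ 1) :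
    Real.log (1 + t) ≤ t ^ γ / γ := by
  rw [le_div_iff₀ hγ, mul_comm, ← Real.log_rpow (by linarith)]
  have h1 : (1 + t) ^ γ ≤ 1 + t ^ γ := by
    simpa using Real.rpow_add_le_add_rpow (zero_le_one) ht hγ.le hγ1
  have h2 : 0 < (1 + t) ^ γ := by positivity
  linarith [Real.log_le_sub_one_of_pos h2]

/-- A single bound for the logarithm and the powers: the power case reduces to 1 − v^β ≤ −β log v at
v = x/y, and β cancels against the denominator of the profile. The Lipschitz and Hölder bounds below
come from estimating log(y/x) by y/x − 1 or by a power. -/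
theorem profile_sub_le_log {β x y : ℝ} (hβ : 0 ≤ β) (hx : 0 < x) (hxy : x ≤ y) :
    profile β x - profile β y ≤ x ^ (-β) * Real.log (y / x) := by
  have hy := hx.trans_le hxy
  unfold profile
  by_cases h : β = 0
  · simp only [h, if_true, neg_zero, Real.rpow_zero]
    rw [Real.log_div hy.ne' hx.ne']; linarith
  · simp only [h, if_false]
    have hβ : 0 < β := lt_of_le_of_ne hβ (Ne.symm h)
    have h1 := one_sub_rpow_le (v := x / y) (p := β) (by positivity)
    have h2 : y ^ (-β) = x ^ (-β) * (x / y) ^ β := by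
      rw [Real.div_rpow hx.le hy.le, Real.rpow_neg hx.le, Real.rpow_neg hy.le]
      have := Real.rpow_pos_of_pos hx β
      field_simp
    have h3 : Real.log (x / y) = -Real.log (y / x) := by rw [← Real.log_inv, inv_div]
    rw [h3] at h1
    rw [h2, ← sub_div, div_le_iff₀ hβ]
    have := mul_le_mul_of_nonneg_left h1 (Real.rpow_nonneg hx.le (-β))
    linarith

theorem profile_anti {β x y : ℝ} (hβ : 0 ≤ β) (hx : 0 < x) (hxy : x ≤ y) :
    profile β y ≤ profile β x := by
  unfold profile
  split_ifs with h
  · exact neg_le_neg (Real.log_le_log hx hxy)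
  · exact div_le_div_of_nonneg_right (Real.rpow_le_rpow_of_nonpos hx hxy (by linarith)) hβ

theorem profile_sub_le {β x y : ℝ} (hβ : 0 ≤ β) (hx : 0 < x) (hxy : x ≤ y) :
    profile β x - profile β y ≤ x ^ (-1 - β) * (y - x) := by
  refine (profile_sub_le_log hβ hx hxy).trans ?_
  have h1 := Real.log_le_sub_one_of_pos (div_pos (hx.trans_le hxy) hx)
  have h2 : x ^ (-1 - β) * (y - x) = x ^ (-β) * (y / x - 1) := by
    rw [show -1 - β = -β - 1 by ring, Real.rpow_sub_one hx.ne']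
    field_simp
  rw [h2]
  gcongr

theorem profile_sub_le_rpow {β γ x y : ℝ} (hβ : 0 ≤ β) (hγ : 0 < γ) (hγ1 : γ ≤ 1) (hx : 0 < x)
    (hxy : x ≤ y) : profile β x - profile β y ≤ x ^ (-β - γ) * (y - x) ^ γ / γ := by
  refine (profile_sub_le_log hβ hx hxy).trans ?_
  have h1 := log_one_add_le_rpow (t := (y - x) / x) (div_nonneg (by linarith) hx.le) hγ hγ1
  have h3 : 1 + (y - x) / x = y / x := by field_simp; ring
  rw [h3] at h1
  have h2 : x ^ (-β - γ) * (y - x) ^ γ / γ = x ^ (-β) * (((y - x) / x) ^ γ / γ) := by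
    rw [Real.div_rpow (by linarith) hx.le, Real.rpow_sub hx]
    field_simp
  rw [h2]
  gcongr

theorem abs_profile_sub_le {β x y : ℝ} (hβ : 0 ≤ β) (hx : 0 < x) (hy : 0 < y) :
    |profile β x - profile β y| ≤ (min x y) ^ (-1 - β) * |x - y| := by
  rcases le_total x y with h | h
  · rw [abs_of_nonneg (sub_nonneg.2 (profile_anti hβ hx h)), min_eq_left h, abs_sub_comm,
      abs_of_nonneg (sub_nonneg.2 h)]
    exact profile_sub_le hβ hx h
  · rw [abs_sub_comm, abs_of_nonneg (sub_nonneg.2 (profile_anti hβ hy h)), min_eq_right h,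
      abs_of_nonneg (sub_nonneg.2 h)]
    exact profile_sub_le hβ hy h

theorem abs_profile_sub_le_add {β x y : ℝ} (hβ : 0 ≤ β) (hx : 0 < x) (hy : 0 < y) :
    |profile β x - profile β y| ≤ (x ^ (-1 - β) + y ^ (-1 - β)) * |x - y| := by
  refine (abs_profile_sub_le hβ hx hy).trans ?_
  gcongr
  have h1 := Real.rpow_nonneg hx.le (-1 - β)
  have h2 := Real.rpow_nonneg hy.le (-1 - β)
  rcases min_choice x y with h | h <;> rw [h] <;> linarith

theorem abs_profile_sub_le_rpow {β γ x y : ℝ} (hβ : 0 ≤ β) (hγ : 0 < γ) (hγ1 : γ ≤ 1)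
    (hx : 0 < x) (hy : 0 < y) :
    |profile β x - profile β y| ≤ (min x y) ^ (-β - γ) * |x - y| ^ γ / γ := by
  rcases le_total x y with h | h
  · rw [abs_of_nonneg (sub_nonneg.2 (profile_anti hβ hx h)), min_eq_left h, abs_sub_comm,
      abs_of_nonneg (sub_nonneg.2 h)]
    exact profile_sub_le_rpow hβ hγ hγ1 hx h
  · rw [abs_sub_comm, abs_of_nonneg (sub_nonneg.2 (profile_anti hβ hy h)), min_eq_right h,
      abs_of_nonneg (sub_nonneg.2 h)]
    exact profile_sub_le_rpow hβ hγ hγ1 hy h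

theorem abs_profile_le {β γ t : ℝ} (hβ : 0 ≤ β) (hγ : 0 < γ) (hγ1 : γ ≤ 1) (ht : 0 < t) :
    |profile β t| ≤ |profile β 1| + (t ^ (-β - γ) + t ^ γ) / γ := by
  have h := abs_profile_sub_le_rpow hβ hγ hγ1 ht one_pos
  have h2 : |profile β t| ≤ |profile β 1| + |profile β t - profile β 1| := by
    have := abs_add_le (profile β 1) (profile β t - profile β 1)
    simpa using this
  refine h2.trans (add_le_add_right (h.trans ?_) _)
  gcongr
  have h3 := Real.rpow_nonneg ht.le (-β - γ)
  have h4 := Real.rpow_nonneg ht.le γ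
  rcases le_total t 1 with h5 | h5
  · rw [min_eq_left h5, abs_sub_comm, abs_of_nonneg (by linarith)]
    have : (1 - t) ^ γ ≤ 1 := Real.rpow_le_one (by linarith) (by linarith) hγ.le
    nlinarith
  · rw [min_eq_right h5, Real.one_rpow, abs_of_nonneg (by linarith), one_mul]
    have : (t - 1) ^ γ ≤ t ^ γ := Real.rpow_le_rpow (by linarith) (by linarith) hγ.le
    linarith

/-- Second order expansion of the profile at `y`. -/
theorem abs_profile_sub_taylor_le {β x y : ℝ} (hβ : 0 ≤ β) (hy : 0 < y)
    (hxy : y / 2 ≤ x) :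
    |profile β x - profile β y + y ^ (-1 - β) * (x - y)| ≤
      (1 + β) * (y / 2) ^ (-2 - β) * (x - y) ^ 2 := by
  have hx : 0 < x := by linarith
  set s : Set ℝ := Icc (min x y) (max x y)
  have hs : ∀ t ∈ s, y / 2 ≤ t := fun t ht => le_trans (le_min hxy (by linarith)) ht.1
  -- The mean value inequality is used twice: here for the derivative of the profile between t and
  -- y, afterwards for the profile minus its tangent. The assumption y/2 ≤ x keeps all intermediate
  -- points above y/2.
  have key : ∀ t ∈ s, |(-t ^ (-1 - β)) + y ^ (-1 - β)| ≤
      (1 + β) * (y / 2) ^ (-2 - β) * |x - y| := by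
    intro t ht
    have ht0 : y / 2 ≤ t := hs t ht
    have ht0' : 0 < t := by linarith
    have hty : |t - y| ≤ |x - y| := by
      rcases le_total x y with h | h
      · have h1 : x ≤ t := by simpa [h] using ht.1
        have h2 : t ≤ y := by simpa [h] using ht.2
        rw [abs_of_nonpos (by linarith), abs_of_nonpos (by linarith)]; linarith
      · have h1 : y ≤ t := by simpa [h] using ht.1
        have h2 : t ≤ x := by simpa [h] using ht.2
        rw [abs_of_nonneg (by linarith), abs_of_nonneg (by linarith)]; linarith
    have h := (convex_Icc (y / 2) (max t y)).norm_image_sub_le_of_norm_hasDerivWithin_le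
      (f := fun r : ℝ => r ^ (-1 - β)) (f' := fun r => (-1 - β) * r ^ (-1 - β - 1))
      (C := (1 + β) * (y / 2) ^ (-2 - β)) (x := t) (y := y)
      (fun r hr => (Real.hasDerivAt_rpow_const (Or.inl (by linarith [hr.1]))).hasDerivWithinAt)
      (fun r hr => by
        rw [norm_mul, Real.norm_eq_abs, Real.norm_eq_abs, abs_of_nonpos (by linarith),
          abs_of_nonneg (Real.rpow_nonneg (by linarith [hr.1]) _),
          show -1 - β - 1 = -2 - β by ring, show -(-1 - β) = 1 + β by ring]
        gcongr ?_ * ?_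
        exact Real.rpow_le_rpow_of_nonpos (by linarith) hr.1 (by linarith))
      ⟨ht0, le_max_left _ _⟩ ⟨by linarith, le_max_right _ _⟩
    rw [Real.norm_eq_abs, Real.norm_eq_abs, abs_sub_comm y t] at h
    rw [neg_add_eq_sub]
    refine h.trans ?_
    have : 0 ≤ (y / 2) ^ (-2 - β) := by positivity
    gcongr
  have h := (convex_Icc (min x y) (max x y)).norm_image_sub_le_of_norm_hasDerivWithin_le
    (f := fun r : ℝ => profile β r + y ^ (-1 - β) * r)
    (f' := fun r => -r ^ (-1 - β) + y ^ (-1 - β))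
    (C := (1 + β) * (y / 2) ^ (-2 - β) * |x - y|) (x := y) (y := x)
    (fun r hr => ((hasDerivAt_profile β (by linarith [hs r hr])).add
      (by simpa using (hasDerivAt_id r).const_mul (y ^ (-1 - β)))).hasDerivWithinAt)
    (fun r hr => key r hr) ⟨min_le_right _ _, le_max_right _ _⟩ ⟨min_le_left _ _, le_max_left _ _⟩
  have h3 : |x - y| * |x - y| = (x - y) ^ 2 := by rw [← sq, sq_abs]
  rw [Real.norm_eq_abs, Real.norm_eq_abs, mul_assoc, h3] at h
  convert h using 2
  ring

/-! ### Riesz potentials of bounded densities -/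

theorem integrableOn_ball_norm_rpow {s : ℝ} (hs : s < 2) (r : ℝ) :
    IntegrableOn (fun y : ℂ => ‖y‖ ^ (-s)) (Metric.ball 0 r) := by
  rw [integrableOn_fun_norm_addHaar (E := ℂ) volume (f := fun t : ℝ => t ^ (-s)),
    Complex.finrank_real_complex]
  rcases le_or_gt r 0 with hr | hr
  · simp [Ioo_eq_empty_of_le hr]
  have h := (intervalIntegral.integrableOn_Ioo_rpow_iff (s := 1 - s) hr).2 (by linarith)
  refine h.congr_fun (fun t ht => ?_) measurableSet_Ioo
  simp only [smul_eq_mul]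
  rw [sub_eq_add_neg, Real.rpow_add ht.1]
  norm_num

/-- The integral of `‖y‖ ^ (-s)` over the unit disc. -/
def rieszMass (s : ℝ) : ℝ := ∫ y in Metric.ball (0 : ℂ) 1, ‖y‖ ^ (-s)

theorem rieszMass_nonneg (s : ℝ) : 0 ≤ rieszMass s :=
  integral_nonneg fun _ => Real.rpow_nonneg (norm_nonneg _) _

theorem integral_ball_norm_rpow {s R : ℝ} (hR : 0 < R) :
    ∫ y in Metric.ball (0 : ℂ) R, ‖y‖ ^ (-s) = rieszMass s * R ^ (2 - s) := by
  have h := Measure.setIntegral_comp_smul_of_pos (volume : Measure ℂ)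
    (fun y : ℂ => ‖y‖ ^ (-s)) (Metric.ball 0 1) hR
  rw [smul_unitBall_of_pos hR, Complex.finrank_real_complex] at h
  have h2 : ∀ x : ℂ, ‖R • x‖ ^ (-s) = R ^ (-s) * ‖x‖ ^ (-s) := fun x => by
    rw [norm_smul, Real.norm_of_nonneg hR.le, Real.mul_rpow hR.le (norm_nonneg _)]
  simp only [h2, integral_const_mul] at h
  rw [rieszMass, Real.rpow_sub hR]
  rw [Real.rpow_neg hR.le, smul_eq_mul] at h
  have := Real.rpow_pos_of_pos hR s
  rw [Real.rpow_two]
  field_simp at h ⊢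
  linarith

theorem preimage_sub_ball (x : ℂ) (R : ℝ) :
    (fun y : ℂ => x - y) ⁻¹' Metric.ball 0 R = Metric.ball x R := by
  ext y; simp [dist_comm y x, dist_eq_norm]

theorem integrableOn_ball_norm_sub_rpow {s : ℝ} (hs : s < 2) (x : ℂ) (R : ℝ) :
    IntegrableOn (fun y : ℂ => ‖x - y‖ ^ (-s)) (Metric.ball x R) := by
  have h := (Measure.measurePreserving_sub_left (volume : Measure ℂ) x).integrableOn_comp_preimage
    (measurableEmbedding_subLeft x) (f := fun y : ℂ => ‖y‖ ^ (-s)) (s := Metric.ball 0 R)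
  rw [preimage_sub_ball] at h
  exact h.2 (integrableOn_ball_norm_rpow hs R)

theorem integral_ball_norm_sub_rpow {s R : ℝ} (x : ℂ) (hR : 0 < R) :
    ∫ y in Metric.ball x R, ‖x - y‖ ^ (-s) = rieszMass s * R ^ (2 - s) := by
  have h := (Measure.measurePreserving_sub_left (volume : Measure ℂ) x).setIntegral_preimage_emb
    (measurableEmbedding_subLeft x) (fun y : ℂ => ‖y‖ ^ (-s)) (Metric.ball 0 R)
  rw [preimage_sub_ball] at h
  rw [h, integral_ball_norm_rpow hR]

theorem measurable_norm_sub_rpow (s : ℝ) (x : ℂ) : Measurable fun y : ℂ => ‖x - y‖ ^ (-s) := by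
  fun_prop

theorem integrableOn_norm_sub_rpow {s : ℝ} (hs0 : 0 ≤ s) (hs : s < 2) (x : ℂ) {A : Set ℂ}
    (hA : MeasurableSet A) (hfin : volume A ≠ ⊤) :
    IntegrableOn (fun y : ℂ => ‖x - y‖ ^ (-s)) A := by
  have h1 := (integrableOn_ball_norm_sub_rpow hs x 1).mono_set
    (inter_subset_right : A ∩ Metric.ball x 1 ⊆ _)
  have h2 : IntegrableOn (fun y : ℂ => ‖x - y‖ ^ (-s)) (A \ Metric.ball x 1) := by
    refine Measure.integrableOn_of_bounded (M := 1)
      ((measure_mono sdiff_subset).trans_lt (lt_top_iff_ne_top.2 hfin)).ne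
      (measurable_norm_sub_rpow s x).aestronglyMeasurable ?_
    filter_upwards [ae_restrict_mem (hA.diff measurableSet_ball)] with y hy
    rw [Real.norm_of_nonneg (Real.rpow_nonneg (norm_nonneg _) _)]
    have : 1 ≤ ‖x - y‖ := by
      have := hy.2; rw [Metric.mem_ball, dist_comm, dist_eq_norm] at this; linarith
    exact Real.rpow_le_one_of_one_le_of_nonpos this (by linarith)
  have := h1.union h2
  rwa [inter_union_sdiff] at this

theorem integral_norm_sub_rpow_le {s : ℝ} (hs0 : 0 ≤ s) (hs : s < 2) (x : ℂ) {A : Set ℂ}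
    (hA : MeasurableSet A) (hfin : volume A ≠ ⊤) {R : ℝ} (hR : 0 < R) :
    ∫ y in A, ‖x - y‖ ^ (-s) ≤ rieszMass s * R ^ (2 - s) + R ^ (-s) * volume.real A := by
  rw [← integral_inter_add_sdiff (measurableSet_ball : MeasurableSet (Metric.ball x R))
    (integrableOn_norm_sub_rpow hs0 hs x hA hfin), ← integral_ball_norm_sub_rpow x hR]
  refine add_le_add ?_ ?_
  · exact setIntegral_mono_set (integrableOn_ball_norm_sub_rpow hs x R)
      (Eventually.of_forall fun _ => Real.rpow_nonneg (norm_nonneg _) _)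
      (Eventually.of_forall inter_subset_right)
  · have hfin' : volume (A \ Metric.ball x R) < ⊤ :=
      (measure_mono sdiff_subset).trans_lt (lt_top_iff_ne_top.2 hfin)
    have h := norm_setIntegral_le_of_norm_le_const (μ := volume) (C := R ^ (-s))
      (f := fun y : ℂ => ‖x - y‖ ^ (-s)) hfin' (fun y hy => by
        rw [Real.norm_of_nonneg (Real.rpow_nonneg (norm_nonneg _) _)]
        have : R ≤ ‖x - y‖ := by
          have := hy.2; rw [Metric.mem_ball, dist_comm, dist_eq_norm] at this; linarith
        exact Real.rpow_le_rpow_of_nonpos hR this (by linarith))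
    refine (le_abs_self _).trans (h.trans ?_)
    gcongr
    exact sdiff_subset

/-- The radius R = |A|^(1/2) makes the two terms of `integral_norm_sub_rpow_le` the same power of
the volume. -/
theorem integral_norm_sub_rpow_le_volume {s : ℝ} (hs0 : 0 ≤ s) (hs : s < 2) (x : ℂ) {A : Set ℂ}
    (hA : MeasurableSet A) (hfin : volume A ≠ ⊤) :
    ∫ y in A, ‖x - y‖ ^ (-s) ≤ (rieszMass s + 1) * volume.real A ^ ((2 - s) / 2) := by
  rcases (measureReal_nonneg (μ := volume) (s := A)).eq_or_lt with h0 | h0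
  · have : volume A = 0 := by
      rw [measureReal_def, eq_comm, ENNReal.toReal_eq_zero_iff] at h0
      exact h0.resolve_right hfin
    rw [setIntegral_measure_zero _ this]
    have := rieszMass_nonneg s
    positivity
  · refine (integral_norm_sub_rpow_le hs0 hs x hA hfin
      (Real.rpow_pos_of_pos h0 (1 / 2))).trans_eq ?_
    rw [← Real.rpow_mul h0.le, ← Real.rpow_mul h0.le, add_mul]
    congr 1
    · congr 2; ring
    · nth_rewrite 2 [← Real.rpow_one (volume.real A)]
      rw [← Real.rpow_add h0, one_mul]; congr 1; ring

/-- Bounded measurable densities with bounded support. -/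
structure IsBddDensity (θ : ℂ → ℝ) : Prop where
  measurable : Measurable θ
  bounded : ∃ M, ∀ x, |θ x| ≤ M
  support : ∃ R, ∀ x, R ≤ ‖x‖ → θ x = 0

theorem IsBddDensity.exists_bound {θ : ℂ → ℝ} (h : IsBddDensity θ) :
    ∃ M R : ℝ, 0 ≤ M ∧ 0 < R ∧ ∀ x, |θ x| ≤ (Metric.ball (0 : ℂ) R).indicator (fun _ => M) x := by
  obtain ⟨M, hM⟩ := h.bounded
  obtain ⟨R, hR⟩ := h.support
  refine ⟨M, max R 1, (abs_nonneg _).trans (hM 0), by positivity, fun x => ?_⟩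
  by_cases hx : x ∈ Metric.ball (0 : ℂ) (max R 1)
  · rw [indicator_of_mem hx]; exact hM x
  · rw [indicator_of_notMem hx, hR x, abs_zero]
    rw [mem_ball_zero_iff, not_lt] at hx
    exact (le_max_left _ _).trans hx

theorem IsBddDensity.integrable {θ : ℂ → ℝ} (h : IsBddDensity θ) : Integrable θ := by
  obtain ⟨M, R, -, -, hb⟩ := h.exists_bound
  refine Integrable.mono' (g := (Metric.ball (0 : ℂ) R).indicator fun _ => M) ?_
    h.measurable.aestronglyMeasurable (Eventually.of_forall hb)
  exact (integrableOn_const measure_ball_lt_top.ne).integrable_indicator measurableSet_ball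

theorem isBddDensity_indicator {A : Set ℂ} (hA : MeasurableSet A) (hb : Bornology.IsBounded A) :
    IsBddDensity (A.indicator fun _ => (1 : ℝ)) where
  measurable := measurable_const.indicator hA
  bounded := ⟨1, fun x => by by_cases hx : x ∈ A <;> simp [hx]⟩
  support := by
    obtain ⟨R, hR⟩ := hb.subset_ball 0
    refine ⟨R, fun x hx => indicator_of_notMem (fun h => ?_) _⟩
    have := hR h
    rw [mem_ball_zero_iff] at this
    linarith

theorem IsBddDensity.rpow_mul {θ : ℂ → ℝ} (h : IsBddDensity θ) {s : ℝ} (hs0 : 0 ≤ s)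
    (hs : s < 2) : ∃ C, 0 ≤ C ∧ ∀ x, Integrable (fun y => ‖x - y‖ ^ (-s) * |θ y|) ∧
      ∫ y, ‖x - y‖ ^ (-s) * |θ y| ≤ C := by
  obtain ⟨M, R, hM, -, hb⟩ := h.exists_bound
  have hint : ∀ x : ℂ, Integrable ((Metric.ball (0 : ℂ) R).indicator
      fun y => ‖x - y‖ ^ (-s) * M) := fun x =>
    IntegrableOn.integrable_indicator ((integrableOn_norm_sub_rpow hs0 hs x measurableSet_ball
      measure_ball_lt_top.ne).mul_const M) measurableSet_ball
  have hle : ∀ x y : ℂ, ‖x - y‖ ^ (-s) * |θ y| ≤ (Metric.ball (0 : ℂ) R).indicator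
      (fun y => ‖x - y‖ ^ (-s) * M) y := fun x y => by
    have h1 := hb y
    have h2 := Real.rpow_nonneg (norm_nonneg (x - y)) (-s)
    by_cases hy : y ∈ Metric.ball (0 : ℂ) R
    · rw [indicator_of_mem hy] at h1 ⊢; gcongr
    · rw [indicator_of_notMem hy] at h1 ⊢
      rw [le_antisymm h1 (abs_nonneg _), mul_zero]
  have hi : ∀ x : ℂ, Integrable (fun y => ‖x - y‖ ^ (-s) * |θ y|) := fun x =>
    (hint x).mono' ((measurable_norm_sub_rpow s x).mul
      (continuous_abs.measurable.comp h.measurable)).aestronglyMeasurable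
      (Eventually.of_forall fun y => by
        rw [Real.norm_of_nonneg (mul_nonneg (Real.rpow_nonneg (norm_nonneg _) _) (abs_nonneg _))]
        exact hle x y)
  refine ⟨(rieszMass s + 1) * volume.real (Metric.ball (0 : ℂ) R) ^ ((2 - s) / 2) * M, ?_,
    fun x => ⟨hi x, ?_⟩⟩
  · have := rieszMass_nonneg s
    positivity
  · refine (integral_mono (hi x) (hint x) (hle x)).trans ?_
    rw [integral_indicator measurableSet_ball, integral_mul_const]
    gcongr
    exact integral_norm_sub_rpow_le_volume hs0 hs x measurableSet_ball measure_ball_lt_top.ne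

/-- The potential of a density for the kernel `profile β ‖x‖`. -/
def pot (β : ℝ) (θ : ℂ → ℝ) (x : ℂ) : ℝ := ∫ y, profile β ‖x - y‖ * θ y

theorem pot_integrable {β : ℝ} (h0 : 0 ≤ β) (h1 : β < 1) {θ : ℂ → ℝ} (h : IsBddDensity θ)
    (x : ℂ) : Integrable fun y => profile β ‖x - y‖ * θ y := by
  obtain ⟨M, R, hM, hR, hb⟩ := h.exists_bound
  -- The surplus γ = (1 − β)/2 over the exponent β absorbs the logarithm when β = 0, and the total
  -- stays below 2.
  obtain ⟨C, -, hC⟩ := h.rpow_mul (s := β + (1 - β) / 2) (by linarith) (by linarith)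
  set γ : ℝ := (1 - β) / 2 with hγ
  have hg : Integrable fun y => (|profile β 1| + (‖x‖ + R) ^ γ / γ) * |θ y| +
      1 / γ * (‖x - y‖ ^ (-(β + γ)) * |θ y|) :=
    (h.integrable.abs.const_mul _).add ((hC x).1.const_mul _)
  refine hg.mono' ((measurable_profile β).comp (by fun_prop) |>.mul
    h.measurable).aestronglyMeasurable ?_
  filter_upwards [compl_mem_ae_iff.2 (measure_singleton x)] with y hy
  have hxy : 0 < ‖x - y‖ := norm_pos_iff.2 (sub_ne_zero.2 (Ne.symm hy))
  have hγ0 : 0 < γ := by rw [hγ]; linarith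
  rw [norm_mul, Real.norm_eq_abs, Real.norm_eq_abs]
  by_cases hyR : y ∈ Metric.ball (0 : ℂ) R
  · have h3 := abs_profile_le h0 hγ0 (by rw [hγ]; linarith) hxy
    have h4 : ‖x - y‖ ^ γ ≤ (‖x‖ + R) ^ γ := by
      refine Real.rpow_le_rpow hxy.le ((norm_sub_le _ _).trans ?_) hγ0.le
      rw [mem_ball_zero_iff] at hyR; linarith
    have h5 : (‖x - y‖ ^ (-β - γ) + ‖x - y‖ ^ γ) / γ ≤
        (‖x - y‖ ^ (-β - γ) + (‖x‖ + R) ^ γ) / γ := by gcongr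
    have h6 := mul_le_mul_of_nonneg_right (h3.trans (add_le_add_right h5 _)) (abs_nonneg (θ y))
    refine h6.trans_eq ?_
    rw [show -(β + γ) = -β - γ by ring]; ring
  · have h1 := hb y
    rw [indicator_of_notMem hyR] at h1
    rw [le_antisymm h1 (abs_nonneg _)]; simp

/-! ### Potentials of bounded densities are continuously differentiable -/

theorem norm_le_sqrt_add (η : ℝ) (z : ℂ) : ‖z‖ ≤ √(‖z‖ ^ 2 + η ^ 2) :=
  Real.le_sqrt_of_sq_le (by nlinarith [sq_nonneg η])

theorem sqrt_add_le {η : ℝ} (hη : 0 ≤ η) (z : ℂ) : √(‖z‖ ^ 2 + η ^ 2) ≤ ‖z‖ + η := by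
  rw [Real.sqrt_le_left (by positivity)]; nlinarith [norm_nonneg z]

theorem le_sqrt_add {η : ℝ} (z : ℂ) : η ≤ √(‖z‖ ^ 2 + η ^ 2) :=
  Real.le_sqrt_of_sq_le (by nlinarith [sq_nonneg ‖z‖])

/-- The gradient kernel, regularized at scale `η`. -/
def gradKernel (β η : ℝ) (z : ℂ) : ℂ →L[ℝ] ℝ :=
  -(√(‖z‖ ^ 2 + η ^ 2)) ^ (-2 - β) • innerSL ℝ z

theorem hasFDerivAt_profile_sqrt (β : ℝ) {η : ℝ} (hη : 0 < η) (z : ℂ) :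
    HasFDerivAt (fun z : ℂ => profile β √(‖z‖ ^ 2 + η ^ 2)) (gradKernel β η z) z := by
  have hpos : 0 < ‖z‖ ^ 2 + η ^ 2 := by positivity
  have h1 : HasFDerivAt (fun z : ℂ => ‖z‖ ^ 2 + η ^ 2) (2 • innerSL ℝ z) z :=
    (hasStrictFDerivAt_norm_sq z).hasFDerivAt.add_const _
  have h2 := h1.sqrt hpos.ne'
  have h3 := (hasDerivAt_profile β (Real.sqrt_pos.2 hpos)).comp_hasFDerivAt z h2
  refine h3.congr_fderiv ?_
  ext v
  simp only [gradKernel, smul_apply, smul_eq_mul, nsmul_eq_mul]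
  have hs := Real.sqrt_pos.2 hpos
  rw [show -2 - β = -1 - β - 1 by ring, Real.rpow_sub_one hs.ne']
  field_simp
  simp

theorem norm_gradKernel_le {β η : ℝ} (h0 : 0 ≤ β) (hη : 0 < η) (z : ℂ) :
    ‖gradKernel β η z‖ ≤ η ^ (-1 - β) := by
  have hs : 0 < √(‖z‖ ^ 2 + η ^ 2) := by positivity
  rw [gradKernel, norm_smul, norm_neg, Real.norm_of_nonneg (by positivity), innerSL_apply_norm]
  calc _ ≤ √(‖z‖ ^ 2 + η ^ 2) ^ (-2 - β) * √(‖z‖ ^ 2 + η ^ 2) := by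
        gcongr; exact norm_le_sqrt_add η z
    _ = √(‖z‖ ^ 2 + η ^ 2) ^ (-1 - β) := by
        rw [← Real.rpow_add_one hs.ne']; ring_nf
    _ ≤ _ := Real.rpow_le_rpow_of_nonpos hη (le_sqrt_add z) (by linarith)

/-- The difference of powers is again bounded by a logarithm and log(1 + η/|z|) by a power: the rate
η^γ is paid for by γ additional orders of singularity at the origin. -/
theorem norm_gradKernel_sub_le {β γ η : ℝ} (h0 : 0 ≤ β) (hγ : 0 < γ) (hγ1 : γ ≤ 1) (hη : 0 < η)
    (z : ℂ) : ‖gradKernel β η z - gradKernel β 0 z‖ ≤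
      (2 + β) * (η ^ γ / γ) * ‖z‖ ^ (-(1 + β + γ)) := by
  rcases eq_or_ne z 0 with rfl | hz
  · simp only [gradKernel, map_zero, smul_zero, sub_zero, norm_zero]
    positivity
  have hr : 0 < ‖z‖ := norm_pos_iff.2 hz
  set ρ := √(‖z‖ ^ 2 + η ^ 2) with hρ
  have hrρ : ‖z‖ ≤ ρ := norm_le_sqrt_add η z
  have hρ0 : 0 < ρ := hr.trans_le hrρ
  have e : gradKernel β η z - gradKernel β 0 z =
      (‖z‖ ^ (-2 - β) - ρ ^ (-2 - β)) • innerSL ℝ z := by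
    simp only [gradKernel, ← hρ]
    rw [show ‖z‖ ^ 2 + (0 : ℝ) ^ 2 = ‖z‖ ^ 2 by ring, Real.sqrt_sq hr.le]
    module
  have hmono : ρ ^ (-2 - β) ≤ ‖z‖ ^ (-2 - β) :=
    Real.rpow_le_rpow_of_nonpos hr hrρ (by linarith)
  rw [e, norm_smul, innerSL_apply_norm, Real.norm_of_nonneg (by linarith)]
  have h1 := one_sub_rpow_le (v := ‖z‖ / ρ) (p := 2 + β) (by positivity)
  have h2 : ρ ^ (-2 - β) = ‖z‖ ^ (-2 - β) * (‖z‖ / ρ) ^ (2 + β) := by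
    rw [Real.div_rpow hr.le hρ0.le, show -2 - β = -(2 + β) by ring, Real.rpow_neg hr.le,
      Real.rpow_neg hρ0.le]
    have := Real.rpow_pos_of_pos hr (2 + β)
    field_simp
  have h3 : -Real.log (‖z‖ / ρ) ≤ Real.log (1 + η / ‖z‖) := by
    rw [← Real.log_inv, inv_div]
    refine Real.log_le_log (by positivity) ?_
    rw [div_le_iff₀ hr, add_mul, div_mul_cancel₀ _ hr.ne', one_mul]
    exact sqrt_add_le hη.le z
  have h4 := log_one_add_le_rpow (t := η / ‖z‖) (by positivity) hγ hγ1
  have h5 : 1 - (‖z‖ / ρ) ^ (2 + β) ≤ (2 + β) * ((η / ‖z‖) ^ γ / γ) :=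
    h1.trans (by rw [← mul_neg]; gcongr; exact h3.trans h4)
  calc (‖z‖ ^ (-2 - β) - ρ ^ (-2 - β)) * ‖z‖
      = ‖z‖ ^ (-2 - β) * ‖z‖ * (1 - (‖z‖ / ρ) ^ (2 + β)) := by rw [h2]; ring
    _ ≤ ‖z‖ ^ (-2 - β) * ‖z‖ * ((2 + β) * ((η / ‖z‖) ^ γ / γ)) := by gcongr
    _ = _ := by
      rw [← Real.rpow_add_one hr.ne', Real.div_rpow hη.le hr.le,
        show -(1 + β + γ) = -2 - β + 1 - γ by ring, Real.rpow_sub hr]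
      field_simp

theorem continuous_gradKernel (β : ℝ) {η : ℝ} (hη : 0 < η) : Continuous (gradKernel β η) := by
  have h : Continuous fun z : ℂ => -(√(‖z‖ ^ 2 + η ^ 2)) ^ (-2 - β) := by
    refine (Continuous.rpow_const (by fun_prop) fun z => Or.inl ?_).neg
    positivity
  exact h.smul (innerSL ℝ).continuous

theorem measurable_gradKernel_zero (β : ℝ) : StronglyMeasurable (gradKernel β 0) := by
  have h : Measurable fun z : ℂ => -(√(‖z‖ ^ 2 + 0 ^ 2)) ^ (-2 - β) := by fun_prop
  exact h.stronglyMeasurable.smul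
    (innerSL ℝ : ℂ →L[ℝ] ℂ →L[ℝ] ℝ).continuous.stronglyMeasurable

/-- Replace |x − y| by √(|x − y|² + η²). The regularized potentials can be differentiated under the
integral sign and have continuous gradients. They and their gradients converge uniformly at the rate
η^γ, because with γ = (1 − β)/2 the singularity |x − y|^(-(1+β+γ)) is still integrable in the plane;
this needs β < 1. -/
theorem contDiff_pot {β : ℝ} (h0 : 0 ≤ β) (h1 : β < 1) {θ : ℂ → ℝ} (h : IsBddDensity θ) :
    ContDiff ℝ 1 (pot β θ) := by
  set γ : ℝ := (1 - β) / 2 with hγ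
  have hγ0 : 0 < γ := by rw [hγ]; linarith
  have hγ1 : γ ≤ 1 := by rw [hγ]; linarith
  set f : ℝ → ℂ → ℝ := fun η x => ∫ y, profile β √(‖x - y‖ ^ 2 + η ^ 2) * θ y
  set W : ℝ → ℂ → ℂ →L[ℝ] ℝ := fun η x => ∫ y, θ y • gradKernel β η (x - y)
  have hcont : ∀ η, 0 < η → Continuous fun z : ℂ => profile β √(‖z‖ ^ 2 + η ^ 2) := fun η hη =>
    continuous_iff_continuousAt.2 fun z => (hasFDerivAt_profile_sqrt β hη z).continuousAt
  have hb : ∀ η, 0 < η → ∀ x y, ‖θ y • gradKernel β η (x - y)‖ ≤ |θ y| * η ^ (-1 - β) :=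
    fun η hη x y => by
      rw [norm_smul, Real.norm_eq_abs]
      gcongr
      exact norm_gradKernel_le h0 hη _
  have hmW : ∀ η, 0 < η → ∀ x, AEStronglyMeasurable (fun y => θ y • gradKernel β η (x - y))
      volume := fun η hη x => h.measurable.aestronglyMeasurable.smul
    ((continuous_gradKernel β hη).comp
      (by fun_prop : Continuous fun y : ℂ => x - y)).aestronglyMeasurable
  have hiW : ∀ η, 0 < η → ∀ x, Integrable fun y => θ y • gradKernel β η (x - y) :=
    fun η hη x => (h.integrable.abs.mul_const _).mono' (hmW η hη x)
      (Eventually.of_forall (hb η hη x))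
  obtain ⟨C, hC0, hC⟩ := h.rpow_mul (s := 1 + β + γ) (by linarith) (by rw [hγ]; linarith)
  obtain ⟨C', hC'0, hC'⟩ := h.rpow_mul (s := β + γ) (by linarith) (by rw [hγ]; linarith)
  have hdiff : ∀ η, 0 < η → ∀ x y, ‖θ y • gradKernel β η (x - y) - θ y • gradKernel β 0 (x - y)‖ ≤
      (2 + β) * (η ^ γ / γ) * (‖x - y‖ ^ (-(1 + β + γ)) * |θ y|) := fun η hη x y => by
    rw [show θ y • gradKernel β η (x - y) - θ y • gradKernel β 0 (x - y) =
      θ y • (gradKernel β η (x - y) - gradKernel β 0 (x - y)) from (smul_sub _ _ _).symm,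
      norm_smul, Real.norm_eq_abs, mul_comm, ← mul_assoc]
    gcongr
    exact norm_gradKernel_sub_le h0 hγ0 hγ1 hη _
  -- Integrability of the singular gradient kernel is inherited from the one regularized at scale 1,
  -- through the bound for the difference.
  have hiW0 : ∀ x, Integrable fun y => θ y • gradKernel β 0 (x - y) := fun x => by
    have hd : Integrable fun y => θ y • gradKernel β 1 (x - y) - θ y • gradKernel β 0 (x - y) :=
      (((hC x).1.const_mul ((2 + β) * ((1 : ℝ) ^ γ / γ)))).mono'
        ((hmW 1 one_pos x).sub (h.measurable.aestronglyMeasurable.smul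
          ((measurable_gradKernel_zero β).comp_measurable (by fun_prop)).aestronglyMeasurable))
        (Eventually.of_forall (hdiff 1 one_pos x))
    refine ((hiW 1 one_pos x).sub hd).congr (Eventually.of_forall fun y => ?_)
    simp
  have hWd : ∀ η, 0 < η → ∀ x, ‖W η x - W 0 x‖ ≤ (2 + β) * (η ^ γ / γ) * C := fun η hη x => by
    simp only [W]
    rw [← integral_sub (hiW η hη x) (hiW0 x)]
    refine (norm_integral_le_of_norm_le ((hC x).1.const_mul _)
      (Eventually.of_forall (hdiff η hη x))).trans ?_
    rw [integral_const_mul]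
    have := (hC x).2
    gcongr
  have hdf : ∀ η, 0 < η → ∀ x y, y ≠ x →
      ‖profile β √(‖x - y‖ ^ 2 + η ^ 2) * θ y - profile β ‖x - y‖ * θ y‖ ≤
      η ^ γ / γ * (‖x - y‖ ^ (-(β + γ)) * |θ y|) := fun η hη x y hxy => by
    have hr : 0 < ‖x - y‖ := norm_pos_iff.2 (sub_ne_zero.2 hxy.symm)
    rw [← sub_mul, norm_mul, Real.norm_eq_abs, Real.norm_eq_abs, ← mul_assoc]
    gcongr
    have hle := norm_le_sqrt_add η (x - y)
    refine (abs_profile_sub_le_rpow h0 hγ0 hγ1 (hr.trans_le hle) hr).trans ?_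
    rw [min_eq_right hle, abs_of_nonneg (by linarith), show -(β + γ) = -β - γ by ring, mul_div_assoc,
      mul_comm]
    gcongr
    linarith [sqrt_add_le hη.le (x - y)]
  have hne : ∀ x : ℂ, ∀ᵐ y : ℂ, y ≠ x := fun x => compl_mem_ae_iff.2 (measure_singleton x)
  have hfi : ∀ η, 0 < η → ∀ x, Integrable fun y => profile β √(‖x - y‖ ^ 2 + η ^ 2) * θ y :=
    fun η hη x => by
      have hd : Integrable fun y =>
          profile β √(‖x - y‖ ^ 2 + η ^ 2) * θ y - profile β ‖x - y‖ * θ y := by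
        refine ((hC' x).1.const_mul (η ^ γ / γ)).mono' ?_ ((hne x).mono (hdf η hη x))
        exact ((((hcont η hη).comp (by fun_prop : Continuous fun y => x - y)).measurable.mul
          h.measurable).sub (((measurable_profile β).comp (by fun_prop)).mul
            h.measurable)).aestronglyMeasurable
      refine (hd.add (pot_integrable h0 h1 h x)).congr (Eventually.of_forall fun y => ?_)
      simp
  have hfd : ∀ η, 0 < η → ∀ x, ‖f η x - pot β θ x‖ ≤ η ^ γ / γ * C' := fun η hη x => by
    simp only [f, pot]
    rw [← integral_sub (hfi η hη x) (pot_integrable h0 h1 h x)]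
    refine (norm_integral_le_of_norm_le ((hC' x).1.const_mul _)
      ((hne x).mono (hdf η hη x))).trans ?_
    rw [integral_const_mul]
    have := (hC' x).2
    gcongr
  have hderiv : ∀ η, 0 < η → ∀ x, HasFDerivAt (f η) (W η x) x := fun η hη x => by
    refine hasFDerivAt_integral_of_dominated_of_fderiv_le (μ := volume) (s := univ)
      (F := fun x y => profile β √(‖x - y‖ ^ 2 + η ^ 2) * θ y)
      (F' := fun x y => θ y • gradKernel β η (x - y))
      (bound := fun y => |θ y| * η ^ (-1 - β)) univ_mem
      (Eventually.of_forall fun x => (hfi η hη x).aestronglyMeasurable) (hfi η hη x)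
      (hmW η hη x) (Eventually.of_forall fun y x _ => hb η hη x y)
      (h.integrable.abs.mul_const _) (Eventually.of_forall fun y x _ => ?_)
    have hx : HasFDerivAt (fun x : ℂ => x - y) (ContinuousLinearMap.id ℝ ℂ) x :=
      (hasFDerivAt_id x).sub_const y
    have := ((hasFDerivAt_profile_sqrt β hη (x - y)).comp x hx).mul_const (θ y)
    simpa using this
  have hWc : ∀ η, 0 < η → Continuous (W η) := fun η hη =>
    continuous_of_dominated (hmW η hη) (fun x => Eventually.of_forall (hb η hη x))
      (h.integrable.abs.mul_const _) (Eventually.of_forall fun y =>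
        ((continuous_gradKernel β hη).comp
          (by fun_prop : Continuous fun x : ℂ => x - y)).const_smul (θ y))
  have hη : ∀ n : ℕ, (0 : ℝ) < 1 / (n + 1) := fun n => by positivity
  have hlim : Tendsto (fun n : ℕ => (1 / (n + 1 : ℝ)) ^ γ) atTop (𝓝 0) := by
    have := (tendsto_one_div_add_atTop_nhds_zero_nat (𝕜 := ℝ)).rpow_const (p := γ)
      (Or.inr hγ0.le)
    rwa [Real.zero_rpow hγ0.ne'] at this
  have hunif : TendstoUniformly (fun n : ℕ => W (1 / (n + 1))) (W 0) atTop := by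
    rw [Metric.tendstoUniformly_iff]
    intro e he
    have : Tendsto (fun n : ℕ => (2 + β) * ((1 / (n + 1 : ℝ)) ^ γ / γ) * C) atTop (𝓝 0) := by
      have := ((hlim.div_const γ).const_mul (2 + β)).mul_const C
      simpa using this
    filter_upwards [this.eventually_lt_const he] with n hn x
    rw [dist_comm, dist_eq_norm]
    exact (hWd _ (hη n) x).trans_lt hn
  have hpt : ∀ x, Tendsto (fun n : ℕ => f (1 / (n + 1)) x) atTop (𝓝 (pot β θ x)) := fun x => by
    rw [tendsto_iff_norm_sub_tendsto_zero]
    refine squeeze_zero (fun _ => norm_nonneg _) (fun n => hfd _ (hη n) x) ?_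
    have := (hlim.div_const γ).mul_const C'
    simpa using this
  have hfin : ∀ x, HasFDerivAt (pot β θ) (W 0 x) x :=
    hasFDerivAt_of_tendstoUniformly hunif (fun n x => hderiv _ (hη n) x) hpt
  have hW0 : Continuous (W 0) :=
    hunif.continuous (Frequently.of_forall fun n => hWc _ (hη n))
  rw [contDiff_one_iff_fderiv]
  refine ⟨fun x => (hfin x).differentiableAt, ?_⟩
  rw [show fderiv ℝ (pot β θ) = W 0 from funext fun x => (hfin x).fderiv]
  exact hW0

/-! ### Algebra and Lipschitz bounds for potentials -/

theorem potential_eq (β : ℝ) (θ : ℂ → ℝ) (x : ℂ) :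
    potential β θ x = kernelFactor β * pot β θ x := by
  simp only [potential, pot, kernel_eq, mul_assoc, integral_const_mul]

theorem IsBddDensity.const_mul {θ : ℂ → ℝ} (h : IsBddDensity θ) (c : ℝ) :
    IsBddDensity fun x => c * θ x where
  measurable := h.measurable.const_mul c
  bounded := by
    obtain ⟨M, hM⟩ := h.bounded
    exact ⟨|c| * M, fun x => by rw [abs_mul]; exact mul_le_mul_of_nonneg_left (hM x) (abs_nonneg c)⟩
  support := by
    obtain ⟨R, hR⟩ := h.support
    exact ⟨R, fun x hx => by rw [hR x hx, mul_zero]⟩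

theorem IsBddDensity.add {θ θ' : ℂ → ℝ} (h : IsBddDensity θ) (h' : IsBddDensity θ') :
    IsBddDensity fun x => θ x + θ' x where
  measurable := h.measurable.add h'.measurable
  bounded := by
    obtain ⟨M, hM⟩ := h.bounded
    obtain ⟨M', hM'⟩ := h'.bounded
    exact ⟨M + M', fun x => (abs_add_le _ _).trans (add_le_add (hM x) (hM' x))⟩
  support := by
    obtain ⟨R, hR⟩ := h.support
    obtain ⟨R', hR'⟩ := h'.support
    exact ⟨max R R', fun x hx => by
      rw [hR x ((le_max_left _ _).trans hx), hR' x ((le_max_right _ _).trans hx), add_zero]⟩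

theorem IsBddDensity.sub {θ θ' : ℂ → ℝ} (h : IsBddDensity θ) (h' : IsBddDensity θ') :
    IsBddDensity fun x => θ x - θ' x := by
  simpa [sub_eq_add_neg] using h.add (h'.const_mul (-1))

theorem IsBddDensity.sum {ι : Type*} (s : Finset ι) {θ : ι → ℂ → ℝ}
    (h : ∀ i ∈ s, IsBddDensity (θ i)) : IsBddDensity fun x => ∑ i ∈ s, θ i x := by
  classical
  induction s using Finset.induction_on with
  | empty => exact ⟨by simp, ⟨0, by simp⟩, ⟨0, by simp⟩⟩
  | insert a s ha ih =>
    simp only [Finset.sum_insert ha]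
    exact (h a (by simp)).add (ih fun i hi => h i (by simp [hi]))

theorem pot_const_mul (β : ℝ) (θ : ℂ → ℝ) (c : ℝ) (x : ℂ) :
    pot β (fun y => c * θ y) x = c * pot β θ x := by
  simp only [pot, mul_left_comm, integral_const_mul]

theorem pot_sub {β : ℝ} (h0 : 0 ≤ β) (h1 : β < 1) {θ θ' : ℂ → ℝ} (h : IsBddDensity θ)
    (h' : IsBddDensity θ') (x : ℂ) :
    pot β (fun y => θ y - θ' y) x = pot β θ x - pot β θ' x := by
  simp only [pot, mul_sub]
  exact integral_sub (pot_integrable h0 h1 h x) (pot_integrable h0 h1 h' x)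

theorem pot_sum {β : ℝ} (h0 : 0 ≤ β) (h1 : β < 1) {ι : Type*} (s : Finset ι) {θ : ι → ℂ → ℝ}
    (h : ∀ i ∈ s, IsBddDensity (θ i)) (x : ℂ) :
    pot β (fun y => ∑ i ∈ s, θ i y) x = ∑ i ∈ s, pot β (θ i) x := by
  simp only [pot, Finset.mul_sum]
  exact integral_finsetSum _ fun i hi => pot_integrable h0 h1 (h i hi) x

/-- The positive power of the volume is the point: two nearby patches differ by a thin set, so the
difference of their potentials has a small Lipschitz constant, even across the set itself. -/
theorem pot_lipschitz {β : ℝ} (h0 : 0 ≤ β) (h1 : β < 1) {θ : ℂ → ℝ} (h : IsBddDensity θ)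
    {A : Set ℂ} (hA : MeasurableSet A) (hfin : volume A ≠ ⊤)
    (hθ : ∀ y, |θ y| ≤ A.indicator (fun _ => 1) y) (x x' : ℂ) :
    |pot β θ x - pot β θ x'| ≤
      2 * (rieszMass (1 + β) + 1) * volume.real A ^ ((1 - β) / 2) * ‖x - x'‖ := by
  have hi : ∀ x : ℂ, IntegrableOn (fun y : ℂ => ‖x - y‖ ^ (-(1 + β))) A := fun x =>
    integrableOn_norm_sub_rpow (by linarith) (by linarith) x hA hfin
  have hb : ∀ x : ℂ, ∫ y in A, ‖x - y‖ ^ (-(1 + β)) ≤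
      (rieszMass (1 + β) + 1) * volume.real A ^ ((1 - β) / 2) := fun x => by
    have := integral_norm_sub_rpow_le_volume (s := 1 + β) (by linarith) (by linarith) x hA hfin
    rwa [show 2 - (1 + β) = 1 - β by ring] at this
  have hle : ∀ᵐ y : ℂ, ‖profile β ‖x - y‖ * θ y - profile β ‖x' - y‖ * θ y‖ ≤
      A.indicator (fun y => (‖x - y‖ ^ (-(1 + β)) + ‖x' - y‖ ^ (-(1 + β))) * ‖x - x'‖) y := by
    filter_upwards [compl_mem_ae_iff.2 (measure_singleton x),
      compl_mem_ae_iff.2 (measure_singleton x')] with y hy hy'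
    have hr : 0 < ‖x - y‖ := norm_pos_iff.2 (sub_ne_zero.2 (Ne.symm hy))
    have hr' : 0 < ‖x' - y‖ := norm_pos_iff.2 (sub_ne_zero.2 (Ne.symm hy'))
    rw [← sub_mul, norm_mul, Real.norm_eq_abs, Real.norm_eq_abs]
    have h3 := hθ y
    by_cases hyA : y ∈ A
    · rw [indicator_of_mem hyA] at h3 ⊢
      refine (mul_le_of_le_one_right (abs_nonneg _) h3).trans
        ((abs_profile_sub_le_add h0 hr hr').trans ?_)
      rw [show -(1 + β) = -1 - β by ring]
      gcongr
      refine (abs_norm_sub_norm_le _ _).trans_eq ?_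
      congr 1; ring
    · rw [indicator_of_notMem hyA] at h3 ⊢
      rw [le_antisymm h3 (abs_nonneg _), mul_zero]
  unfold pot
  rw [← integral_sub (pot_integrable h0 h1 h x) (pot_integrable h0 h1 h x')]
  have hint : Integrable (A.indicator fun y =>
      (‖x - y‖ ^ (-(1 + β)) + ‖x' - y‖ ^ (-(1 + β))) * ‖x - x'‖) :=
    IntegrableOn.integrable_indicator (((hi x).add (hi x')).mul_const _) hA
  refine (norm_integral_le_of_norm_le hint hle).trans ?_
  rw [integral_indicator hA, integral_mul_const, integral_add (hi x) (hi x')]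
  gcongr
  linarith [hb x, hb x']

/-- Away from the support, the potential is Lipschitz with the constant given by the decay of the
kernel. -/
theorem pot_lipschitz_far {β : ℝ} (h0 : 0 ≤ β) (h1 : β < 1) {θ : ℂ → ℝ} (h : IsBddDensity θ)
    {A : Set ℂ} (hA : MeasurableSet A) (hfin : volume A ≠ ⊤)
    (hθ : ∀ y, |θ y| ≤ A.indicator (fun _ => 1) y) {R : ℝ} (hR : 0 < R) (x x' : ℂ)
    (hx : ∀ y ∈ A, R ≤ ‖x - y‖) (hx' : ∀ y ∈ A, R ≤ ‖x' - y‖) :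
    |pot β θ x - pot β θ x'| ≤ volume.real A * (R ^ (-1 - β) * ‖x - x'‖) := by
  have hle : ∀ y : ℂ, ‖profile β ‖x - y‖ * θ y - profile β ‖x' - y‖ * θ y‖ ≤
      A.indicator (fun _ => R ^ (-1 - β) * ‖x - x'‖) y := fun y => by
    rw [← sub_mul, norm_mul, Real.norm_eq_abs, Real.norm_eq_abs]
    have h3 := hθ y
    by_cases hyA : y ∈ A
    · rw [indicator_of_mem hyA] at h3 ⊢
      refine (mul_le_of_le_one_right (abs_nonneg _) h3).trans
        ((abs_profile_sub_le h0 (hR.trans_le (hx y hyA)) (hR.trans_le (hx' y hyA))).trans ?_)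
      gcongr ?_ * ?_
      · exact Real.rpow_le_rpow_of_nonpos hR (le_min (hx y hyA) (hx' y hyA)) (by linarith)
      · refine (abs_norm_sub_norm_le _ _).trans_eq ?_
        congr 1; ring
    · rw [indicator_of_notMem hyA] at h3 ⊢
      rw [le_antisymm h3 (abs_nonneg _), mul_zero]
  unfold pot
  rw [← integral_sub (pot_integrable h0 h1 h x) (pot_integrable h0 h1 h x')]
  have hint : Integrable (A.indicator fun _ : ℂ => R ^ (-1 - β) * ‖x - x'‖) :=
    (integrableOn_const hfin).integrable_indicator hA
  refine (norm_integral_le_of_norm_le hint (Eventually.of_forall hle)).trans_eq ?_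
  rw [integral_indicator hA, setIntegral_const, smul_eq_mul]

/-! ### Rotation, conjugation and scaling of potentials -/

theorem measurePreserving_rotation (ζ : Circle) :
    MeasurePreserving (fun z : ℂ => (ζ : ℂ) * z) :=
  (rotation ζ).measurePreserving

theorem measurableEmbedding_rotation (ζ : Circle) :
    MeasurableEmbedding (fun z : ℂ => (ζ : ℂ) * z) :=
  (rotation ζ).toHomeomorph.measurableEmbedding

theorem integral_rotation {E : Type*} [NormedAddCommGroup E] [NormedSpace ℝ E] (ζ : Circle)
    (f : ℂ → E) : ∫ z, f (ζ * z) = ∫ z, f z :=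
  (measurePreserving_rotation ζ).integral_comp (measurableEmbedding_rotation ζ) f

theorem pot_rotation (β : ℝ) (θ : ℂ → ℝ) (ζ : Circle) (x : ℂ) :
    pot β (fun y => θ (ζ * y)) x = pot β θ (ζ * x) := by
  unfold pot
  rw [← integral_rotation ζ fun y => profile β ‖ζ * x - y‖ * θ y]
  congr 1
  ext y
  rw [← mul_sub, norm_mul, Circle.norm_coe, one_mul]

theorem pot_conj (β : ℝ) (θ : ℂ → ℝ) (x : ℂ) :
    pot β (fun y => θ (starRingEnd ℂ y)) x = pot β θ (starRingEnd ℂ x) := by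
  unfold pot
  have := Complex.conjLIE.measurePreserving.integral_comp
    Complex.conjLIE.toHomeomorph.measurableEmbedding
    (fun y => profile β ‖starRingEnd ℂ x - y‖ * θ y)
  rw [← this]
  congr 1
  ext y
  simp only [Complex.conjLIE_apply]
  rw [← map_sub, Complex.norm_conj]

/-- The area element contributes ε² and the kernel ε^(-β). The additive constant of `profile_scale`
is multiplied by the total mass, hence does not depend on the point. -/
theorem pot_affine {β : ℝ} (h0 : 0 ≤ β) (h1 : β < 1) {θ : ℂ → ℝ} (h : IsBddDensity θ) (p : ℂ)
    {ε : ℝ} (hε : 0 < ε) : ∃ c, ∀ z, pot β (fun y => θ ((y - p) / ε)) (p + ε * z) =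
      ε ^ (2 - β) * pot β θ z + c := by
  obtain ⟨c, hc⟩ := profile_scale β hε
  refine ⟨ε ^ 2 * (c * ∫ y, θ y), fun z => ?_⟩
  unfold pot
  have e1 : ∫ y, profile β ‖p + ε * z - y‖ * θ ((y - p) / ε) =
      ∫ y, profile β ‖ε * z - y‖ * θ (y / ε) := by
    rw [← integral_add_left_eq_self _ p]
    congr 1; ext y; congr 2
    · ring_nf
    · congr 1; ring
  have e2 := Measure.integral_comp_smul (volume : Measure ℂ)
    (fun y => profile β ‖ε * z - y‖ * θ (y / ε)) ε
  rw [Complex.finrank_real_complex, abs_of_pos (by positivity), smul_eq_mul,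
    eq_inv_mul_iff_mul_eq₀ (by positivity)] at e2
  have hε' : (ε : ℂ) ≠ 0 := by exact_mod_cast hε.ne'
  have e3 : ∫ y : ℂ, profile β ‖ε * z - ε • y‖ * θ (ε • y / ε) =
      ∫ y : ℂ, ε ^ (-β) * (profile β ‖z - y‖ * θ y) + c * θ y := by
    refine integral_congr_ae ?_
    filter_upwards [compl_mem_ae_iff.2 (measure_singleton z)] with y hy
    have hr : 0 < ‖z - y‖ := norm_pos_iff.2 (sub_ne_zero.2 (Ne.symm hy))
    simp only [Complex.real_smul]
    rw [← mul_sub, norm_mul, Complex.norm_real, Real.norm_of_nonneg hε.le, hc _ hr,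
      mul_div_cancel_left₀ _ hε']
    ring
  rw [e1, ← e2, e3, integral_add ((pot_integrable h0 h1 h z).const_mul _)
    (h.integrable.const_mul _), integral_const_mul, integral_const_mul, sub_eq_add_neg,
    Real.rpow_add hε, Real.rpow_two]
  ring

/-! ### Patches whose boundary is a level set are stationary -/

/-- Integration by parts moves the derivatives of g onto φ, where the mixed second derivatives
cancel. For g, differentiability everywhere and a bounded derivative suffice, which suits functions
cut off along an arbitrary boundary. -/
theorem integral_jacobian_eq_zero {g φ : ℂ → ℝ} (hg : Differentiable ℝ g)
    (hgs : HasCompactSupport g) {M : ℝ} (hM : ∀ x, ‖fderiv ℝ g x‖ ≤ M) (hφ : ContDiff ℝ 2 φ)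
    (hφs : HasCompactSupport φ) :
    ∫ x, (fderiv ℝ g x Complex.I * fderiv ℝ φ x 1 - fderiv ℝ g x 1 * fderiv ℝ φ x Complex.I) =
      0 := by
  have hφ1 : ContDiff ℝ 1 (fderiv ℝ φ) := hφ.fderiv_right (by norm_num)
  have hd : ∀ v : ℂ, ContDiff ℝ 1 fun x => fderiv ℝ φ x v := fun v => hφ1.clm_apply contDiff_const
  have hds : ∀ v : ℂ, HasCompactSupport fun x => fderiv ℝ φ x v := fun v => hφs.fderiv_apply ℝ v
  have hint : ∀ v w : ℂ, Integrable fun x => fderiv ℝ φ x w * fderiv ℝ g x v := fun v w => by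
    refine Integrable.mul_bdd (c := M * ‖v‖)
      ((hd w).continuous.integrable_of_hasCompactSupport (hds w))
      (measurable_fderiv_apply_const ℝ g v).aestronglyMeasurable (Eventually.of_forall fun x => ?_)
    exact (ContinuousLinearMap.le_opNorm _ _).trans (by gcongr; exact hM x)
  have hibp : ∀ v w : ℂ, ∫ x, fderiv ℝ φ x w * fderiv ℝ g x v =
      -∫ x, fderiv ℝ (fun x => fderiv ℝ φ x w) x v * g x := fun v w => by
    refine integral_mul_fderiv_eq_neg_fderiv_mul_of_integrable ?_ (hint v w) ?_
      (fun x _ => ((hd w).differentiable one_ne_zero) x) (fun x _ => hg x)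
    · have h1 : Continuous fun x => fderiv ℝ (fun x => fderiv ℝ φ x w) x v :=
        ((hd w).continuous_fderiv one_ne_zero).clm_apply continuous_const
      exact (h1.mul hg.continuous).integrable_of_hasCompactSupport hgs.mul_left
    · exact ((hd w).continuous.mul hg.continuous).integrable_of_hasCompactSupport hgs.mul_left
  have hsymm : ∀ x v w, fderiv ℝ (fun x => fderiv ℝ φ x w) x v =
      fderiv ℝ (fun x => fderiv ℝ φ x v) x w := fun x v w => by
    have h := (hφ.contDiffAt (x := x)).isSymmSndFDerivAt (by simp)
    have e : ∀ v w : ℂ, fderiv ℝ (fun x => fderiv ℝ φ x w) x v =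
        fderiv ℝ (fderiv ℝ φ) x v w := fun v w => by
      rw [fderiv_clm_apply (hφ1.differentiable one_ne_zero x) (by fun_prop)]
      simp
    rw [e, e]
    exact h v w
  simp only [mul_comm (fderiv ℝ g _ _)]
  rw [integral_sub (hint _ _) (hint _ _), hibp, hibp]
  simp only [hsymm _ 1 Complex.I]
  ring

/-- At a density point of the level set the derivative is determined by increments along the set,
and these vanish. -/
theorem ae_fderiv_eq_zero_of_level {Ψ : ℂ → ℝ} (hΨ : ContDiff ℝ 1 Ψ) (c : ℝ) :
    ∀ᵐ x : ℂ, Ψ x = c → fderiv ℝ Ψ x = 0 := by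
  set s : Set ℂ := {x | Ψ x = c}
  have hs : MeasurableSet s := (isClosed_eq hΨ.continuous continuous_const).measurableSet
  -- The values are embedded in ℂ because `ApproximatesLinearOn.norm_fderiv_sub_le` concerns maps of
  -- a space into itself. On the level set the zero map is an exact approximation, whence the
  -- constant 0.
  have hf : ApproximatesLinearOn (fun x => ((Ψ x : ℝ) : ℂ)) (0 : ℂ →L[ℝ] ℂ) s 0 := by
    intro x hx y hy
    have e : Ψ x = Ψ y := Eq.trans hx (Eq.symm hy)
    simp [e]
  have h := hf.norm_fderiv_sub_le (μ := volume) hs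
    (fun x => Complex.ofRealCLM.comp (fderiv ℝ Ψ x)) fun x _ =>
    (Complex.ofRealCLM.hasFDerivAt.comp x
      ((hΨ.differentiable one_ne_zero) x).hasFDerivAt).hasFDerivWithinAt
  rw [ae_restrict_iff' hs] at h
  filter_upwards [h] with x hx hxc
  have h1 := hx hxc
  rw [sub_zero, nonpos_iff_eq_zero, nnnorm_eq_zero] at h1
  ext v
  have := congrArg (fun L : ℂ →L[ℝ] ℂ => L v) h1
  simpa using this

/-- A smooth truncation which is flat at `0`. -/
def flatTrunc (n : ℕ) (s : ℝ) : ℝ := s - Real.arctan ((n + 1) * s) / (n + 1)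

theorem hasDerivAt_flatTrunc (n : ℕ) (s : ℝ) :
    HasDerivAt (flatTrunc n) (1 - 1 / (1 + ((n + 1) * s) ^ 2)) s := by
  unfold flatTrunc
  have h1 : HasDerivAt (fun s : ℝ => ((n : ℝ) + 1) * s) ((n : ℝ) + 1) s := by
    simpa using (hasDerivAt_id s).const_mul ((n : ℝ) + 1)
  have h2 := (hasDerivAt_id s).sub ((h1.arctan).div_const ((n : ℝ) + 1))
  convert! h2 using 1
  field_simp

/-- Cut off flatTrunc(Ψ − c) outside D. The truncation is flat at 0, so the result is differentiable
everywhere, however rough the boundary of D is, and its Jacobian with φ integrates to zero. As n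
grows its gradient tends a.e. to that of Ψ on D: off {Ψ = c} the factor tends to 1, and on {Ψ = c}
the gradient of Ψ vanishes a.e. -/
theorem integral_jacobian_level_set {D : Set ℂ} (hD : IsOpen D) (hb : Bornology.IsBounded D)
    {Ψ φ : ℂ → ℝ} (hΨ : ContDiff ℝ 1 Ψ) {c : ℝ} (hc : ∀ x ∈ frontier D, Ψ x = c)
    (hφ : ContDiff ℝ 2 φ) (hφs : HasCompactSupport φ) :
    ∫ x in D, (fderiv ℝ Ψ x Complex.I * fderiv ℝ φ x 1 -
      fderiv ℝ Ψ x 1 * fderiv ℝ φ x Complex.I) = 0 := by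
  set d : ℕ → ℝ → ℝ := fun n s => 1 - 1 / (1 + ((n + 1) * s) ^ 2) with hd
  have hd01 : ∀ n s, 0 ≤ d n s ∧ d n s ≤ 1 := fun n s => by
    have h1 : (1 : ℝ) ≤ 1 + ((n + 1) * s) ^ 2 := by nlinarith [sq_nonneg (((n : ℝ) + 1) * s)]
    have h2 : 1 / (1 + (((n : ℝ) + 1) * s) ^ 2) ≤ 1 := by
      rw [div_le_one (by linarith)]; exact h1
    have h3 : 0 < 1 / (1 + (((n : ℝ) + 1) * s) ^ 2) := by positivity
    constructor <;> simp only [hd] <;> linarith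
  have hcomp : IsCompact (closure D) := hb.isCompact_closure
  obtain ⟨M, hM⟩ := hcomp.exists_bound_of_continuousOn
    (hΨ.continuous_fderiv one_ne_zero).continuousOn
  set g : ℕ → ℂ → ℝ := fun n => D.indicator fun x => flatTrunc n (Ψ x - c)
  set g' : ℕ → ℂ → ℂ →L[ℝ] ℝ := fun n => D.indicator fun x => d n (Ψ x - c) • fderiv ℝ Ψ x
  have hcompd : ∀ n x, HasFDerivAt (fun x => flatTrunc n (Ψ x - c))
      (d n (Ψ x - c) • fderiv ℝ Ψ x) x := fun n x => by
    have := (hasDerivAt_flatTrunc n (Ψ x - c)).comp_hasFDerivAt x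
      (((hΨ.differentiable one_ne_zero) x).hasFDerivAt.sub_const c)
    exact this
  have hg : ∀ n x, HasFDerivAt (g n) (g' n x) x := fun n x => by
    by_cases hx : x ∈ D
    · simp only [g', indicator_of_mem hx]
      refine (hcompd n x).congr_of_eventuallyEq ?_
      filter_upwards [hD.mem_nhds hx] with y hy
      simp only [g, indicator_of_mem hy]
    simp only [g', indicator_of_notMem hx]
    by_cases hx' : x ∈ closure D
    -- At a frontier point the truncated function vanishes together with its derivative, so it is
    -- o(|y − x|). Replacing it by 0 outside D only makes it smaller.
    · have hxf : Ψ x = c := hc x (by rw [hD.frontier_eq]; exact ⟨hx', hx⟩)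
      have h := hcompd n x
      rw [hxf] at h
      have h0 : d n (c - c) = 0 := by simp [hd]
      rw [h0, zero_smul, hasFDerivAt_iff_isLittleO] at h
      rw [hasFDerivAt_iff_isLittleO]
      refine (Asymptotics.isBigO_of_le _ fun y => ?_).trans_isLittleO h
      by_cases hy : y ∈ D
      · simp [g, indicator_of_mem hy, indicator_of_notMem hx, hxf, flatTrunc]
      · simp [g, indicator_of_notMem hy, indicator_of_notMem hx]
    · refine (hasFDerivAt_const (0 : ℝ) x).congr_of_eventuallyEq ?_
      filter_upwards [isClosed_closure.isOpen_compl.mem_nhds hx'] with y hy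
      simp only [g]
      exact indicator_of_notMem (fun h => hy (subset_closure h)) _
  have hM0 : ∀ x ∈ D, ‖fderiv ℝ Ψ x‖ ≤ M := fun x hx => hM x (subset_closure hx)
  have hg'b : ∀ n x, ‖g' n x‖ ≤ D.indicator (fun _ => M) x := fun n x => by
    by_cases hx : x ∈ D
    · simp only [g', indicator_of_mem hx, norm_smul, Real.norm_of_nonneg (hd01 n _).1]
      exact (mul_le_of_le_one_left (norm_nonneg _) (hd01 n _).2).trans (hM0 x hx)
    · simp [g', indicator_of_notMem hx]
  have hzero : ∀ n, ∫ x, (g' n x Complex.I * fderiv ℝ φ x 1 - g' n x 1 * fderiv ℝ φ x Complex.I) =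
      0 := fun n => by
    have hfg : ∀ x, fderiv ℝ (g n) x = g' n x := fun x => (hg n x).fderiv
    have := integral_jacobian_eq_zero (g := g n) (φ := φ) (M := max M 0)
      (fun x => (hg n x).differentiableAt)
      (HasCompactSupport.intro hcomp fun x hx => indicator_of_notMem
        (fun h => hx (subset_closure h)) _)
      (fun x => by
        rw [hfg]
        refine (hg'b n x).trans ?_
        by_cases hx : x ∈ D <;> simp [hx]) hφ hφs
    simpa only [hfg] using this
  obtain ⟨M', hM'⟩ := (hφs.fderiv ℝ).exists_bound_of_continuous (hφ.continuous_fderiv (by norm_num))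
  rw [← integral_indicator hD.measurableSet]
  refine tendsto_nhds_unique (f := fun n : ℕ =>
    ∫ x, (g' n x Complex.I * fderiv ℝ φ x 1 - g' n x 1 * fderiv ℝ φ x Complex.I)) (l := atTop) ?_
    (by simp only [hzero]; exact tendsto_const_nhds)
  refine tendsto_integral_of_dominated_convergence (D.indicator fun _ => M * (2 * M')) ?_ ?_ ?_ ?_
  · intro n
    have hfg : g' n = fderiv ℝ (g n) := funext fun x => (hg n x).fderiv.symm
    rw [hfg]
    have hφc : ∀ v, Measurable fun x => fderiv ℝ φ x v := measurable_fderiv_apply_const ℝ φ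
    have hgc : ∀ v, Measurable fun x => fderiv ℝ (g n) x v := measurable_fderiv_apply_const ℝ (g n)
    exact (((hgc _).mul (hφc _)).sub ((hgc _).mul (hφc _))).aestronglyMeasurable
  · exact (integrableOn_const hb.measure_lt_top.ne).integrable_indicator hD.measurableSet
  · intro n
    refine Eventually.of_forall fun x => ?_
    have h1 := hg'b n x
    by_cases hx : x ∈ D
    · rw [indicator_of_mem hx] at h1 ⊢
      have hI : ∀ L : ℂ →L[ℝ] ℝ, ‖L Complex.I‖ ≤ ‖L‖ := fun L => by
        simpa using L.le_opNorm Complex.I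
      have h1' : ∀ L : ℂ →L[ℝ] ℝ, ‖L 1‖ ≤ ‖L‖ := fun L => by simpa using L.le_opNorm 1
      have hMnn : 0 ≤ M := (norm_nonneg _).trans h1
      have hM'nn : 0 ≤ M' := (norm_nonneg _).trans (hM' x)
      refine (norm_sub_le _ _).trans ?_
      rw [norm_mul, norm_mul]
      have a1 : ‖g' n x Complex.I‖ * ‖fderiv ℝ φ x 1‖ ≤ M * M' := mul_le_mul
        ((hI _).trans h1) ((h1' _).trans (hM' x)) (norm_nonneg _) hMnn
      have a2 : ‖g' n x 1‖ * ‖fderiv ℝ φ x Complex.I‖ ≤ M * M' := mul_le_mul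
        ((h1' _).trans h1) ((hI _).trans (hM' x)) (norm_nonneg _) hMnn
      linarith
    · simp [g', indicator_of_notMem hx]
  · filter_upwards [ae_fderiv_eq_zero_of_level hΨ c] with x hx
    by_cases hxD : x ∈ D
    · simp only [g', indicator_of_mem hxD]
      by_cases hxc : Ψ x = c
      · simp [hx hxc]
      · have ht : Tendsto (fun n : ℕ => d n (Ψ x - c)) atTop (𝓝 1) := by
          have h1 : Tendsto (fun n : ℕ => 1 + (((n : ℝ) + 1) * (Ψ x - c)) ^ 2) atTop atTop := by
            refine tendsto_atTop_add_const_left _ _ ?_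
            simp only [mul_pow]
            refine Tendsto.atTop_mul_const (by have := sub_ne_zero.2 hxc; positivity) ?_
            exact (tendsto_pow_atTop two_ne_zero).comp
              (tendsto_atTop_add_const_right _ _ tendsto_natCast_atTop_atTop)
          have h2 := (tendsto_inv_atTop_zero.comp h1).const_sub 1
          simpa [hd, Function.comp_def] using h2
        have h3 := ht.mul_const (fderiv ℝ Ψ x Complex.I * fderiv ℝ φ x 1 -
          fderiv ℝ Ψ x 1 * fderiv ℝ φ x Complex.I)
        rw [one_mul] at h3
        refine h3.congr fun n => ?_
        simp only [smul_apply, smul_eq_mul]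
        ring
    · simp only [g', indicator_of_notMem hxD]
      simp

/-! ### Rotating solutions from relative equilibria -/

theorem IsBddDensity.comp_rotation {θ : ℂ → ℝ} (h : IsBddDensity θ) (ζ : Circle) :
    IsBddDensity fun x => θ (ζ * x) where
  measurable := h.measurable.comp (measurableEmbedding_rotation ζ).measurable
  bounded := by
    obtain ⟨M, hM⟩ := h.bounded
    exact ⟨M, fun x => hM _⟩
  support := by
    obtain ⟨R, hR⟩ := h.support
    exact ⟨R, fun x hx => hR _ (by rwa [norm_mul, Circle.norm_coe, one_mul])⟩

theorem potential_rotation (β : ℝ) (θ : ℂ → ℝ) (ζ : Circle) (x : ℂ) :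
    potential β (fun y => θ (ζ * y)) x = potential β θ (ζ * x) := by
  rw [potential_eq, potential_eq, pot_rotation]

theorem contDiff_potential {β : ℝ} (h0 : 0 ≤ β) (h1 : β < 1) {θ : ℂ → ℝ} (h : IsBddDensity θ) :
    ContDiff ℝ 1 (potential β θ) := by
  rw [show potential β θ = fun x => kernelFactor β * pot β θ x from funext (potential_eq β θ)]
  exact contDiff_const.mul (contDiff_pot h0 h1 h)

theorem clm_complex_apply (L : ℂ →L[ℝ] ℝ) (w : ℂ) : L w = w.re * L 1 + w.im * L Complex.I := by
  have h : w = w.re • (1 : ℂ) + w.im • Complex.I := by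
    apply Complex.ext <;> simp
  calc L w = L (w.re • (1 : ℂ) + w.im • Complex.I) := by rw [← h]
    _ = _ := by rw [map_add, map_smul, map_smul, smul_eq_mul, smul_eq_mul]

theorem velocity_rotation {β : ℝ} (h0 : 0 ≤ β) (h1 : β < 1) {θ : ℂ → ℝ} (h : IsBddDensity θ)
    (ζ : Circle) (x : ℂ) :
    velocity β (fun y => θ (ζ * y)) x = starRingEnd ℂ ζ * velocity β θ (ζ * x) := by
  have hd : HasFDerivAt (potential β fun y => θ (ζ * y))
      ((fderiv ℝ (potential β θ) (ζ * x)).comp ((ζ : ℂ) • ContinuousLinearMap.id ℝ ℂ)) x := by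
    rw [show potential β (fun y => θ (ζ * y)) = fun x => potential β θ (ζ * x) from
      funext (potential_rotation β θ ζ)]
    have h2 : HasFDerivAt (fun x : ℂ => (ζ : ℂ) * x) ((ζ : ℂ) • ContinuousLinearMap.id ℝ ℂ) x :=
      (hasFDerivAt_id (𝕜 := ℝ) x).const_mul (ζ : ℂ)
    exact (((contDiff_potential h0 h1 h).differentiable one_ne_zero) _).hasFDerivAt.comp x h2
  unfold velocity
  rw [hd.fderiv]
  set L := fderiv ℝ (potential β θ) (ζ * x)
  have e1 := clm_complex_apply L ((ζ : ℂ) * Complex.I)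
  have e2 := clm_complex_apply L (ζ : ℂ)
  apply Complex.ext
  · simp only [ContinuousLinearMap.comp_apply, smul_apply, ContinuousLinearMap.id_apply,
      smul_eq_mul, e1, Complex.mul_re, Complex.mul_im, Complex.I_re, Complex.I_im,
      Complex.conj_re, Complex.conj_im]
    ring
  · simp only [ContinuousLinearMap.comp_apply, smul_apply, ContinuousLinearMap.id_apply,
      smul_eq_mul, mul_one, e2, Complex.mul_im, Complex.conj_re, Complex.conj_im]
    ring

theorem continuous_velocity {β : ℝ} (h0 : 0 ≤ β) (h1 : β < 1) {θ : ℂ → ℝ} (h : IsBddDensity θ) :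
    Continuous (velocity β θ) := by
  have hc := (contDiff_potential h0 h1 h).continuous_fderiv one_ne_zero
  have e : velocity β θ = fun x => ((fderiv ℝ (potential β θ) x Complex.I : ℝ) : ℂ) +
      ((-fderiv ℝ (potential β θ) x 1 : ℝ) : ℂ) * Complex.I :=
    funext fun x => by apply Complex.ext <;> simp [velocity]
  rw [e]
  have h2 : ∀ v : ℂ, Continuous fun x => fderiv ℝ (potential β θ) x v :=
    fun v => hc.clm_apply continuous_const
  have h3 := h2 Complex.I
  have h4 := h2 1
  fun_prop

/-- A bounded density which is stationary in the frame rotating with angular velocity `Ω` gives a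
rotating solution. -/
theorem isRotatingSolution_of_stationary {β : ℝ} (h0 : 0 ≤ β) (h1 : β < 1) {θ : ℂ → ℝ}
    (h : IsBddDensity θ) {Ω : ℝ}
    (hst : ∀ φ : ℂ → ℝ, ContDiff ℝ ∞ φ → HasCompactSupport φ →
      ∫ y, θ y * fderiv ℝ φ y (velocity β θ y - Complex.I * Ω * y) = 0) :
    IsRotatingSolution β θ Ω := by
  obtain ⟨M, hM⟩ := h.bounded
  set ζ : ℝ → Circle := fun t => Circle.exp (-(Ω * t)) with hζ
  have hζe : ∀ t : ℝ, Complex.exp (-(Complex.I * Ω * t)) = ζ t := fun t => by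
    rw [hζ, Circle.coe_exp]; congr 1; push_cast; ring
  have hζc : Continuous fun t => (ζ t : ℂ) := by
    simp only [hζ]; fun_prop
  have hζn : ∀ t, starRingEnd ℂ (ζ t : ℂ) * ζ t = 1 := fun t => by
    rw [← Complex.normSq_eq_conj_mul_self, Complex.normSq_eq_norm_sq, Circle.norm_coe (ζ t)]
    simp
  have hmeas : Measurable fun p : ℝ × ℂ => θ (ζ p.1 * p.2) :=
    h.measurable.comp (by fun_prop : Continuous fun p : ℝ × ℂ => (ζ p.1 : ℂ) * p.2).measurable
  have hvel : ∀ t x, velocity β (fun y => θ (ζ t * y)) x =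
      starRingEnd ℂ (ζ t) * velocity β θ (ζ t * x) := fun t x => velocity_rotation h0 h1 h (ζ t) x
  have hvc := continuous_velocity h0 h1 h
  have htest : ∀ φ : ℝ × ℂ → ℝ, ContDiff ℝ ∞ φ → HasCompactSupport φ →
      Integrable (fun p : ℝ × ℂ => θ (ζ p.1 * p.2) * (fderiv ℝ φ p (1, 0) +
        fderiv ℝ φ p (0, velocity β (fun y => θ (ζ p.1 * y)) p.2))) := fun φ hφ hφs => by
    have hc : Continuous fun p : ℝ × ℂ => fderiv ℝ φ p (1, 0) +
        fderiv ℝ φ p (0, velocity β (fun y => θ (ζ p.1 * y)) p.2) := by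
      simp only [hvel]
      have hf := hφ.continuous_fderiv (by simp)
      refine (hf.clm_apply continuous_const).add (hf.clm_apply ?_)
      fun_prop
    refine Integrable.bdd_mul (c := M) (hc.integrable_of_hasCompactSupport ?_)
      hmeas.aestronglyMeasurable (Eventually.of_forall fun p => hM _)
    refine HasCompactSupport.intro (hφs.fderiv ℝ) fun p hp => ?_
    rw [image_eq_zero_of_notMem_tsupport hp]
    simp
  unfold IsRotatingSolution
  simp only [hζe]
  refine
    { aestronglyMeasurable := hmeas.aestronglyMeasurable
      bounded := ⟨M, fun t _ x => hM _⟩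
      integrable := fun t _ => (h.comp_rotation (ζ t)).integrable
      initial := by ext x; simp [hζ]
      potential_integrable := fun t _ x => ?_
      potential_contDiff := fun t _ => contDiff_potential h0 h1 (h.comp_rotation (ζ t))
      integrable_test := fun φ hφ hφs => (htest φ hφ hφs).restrict
      weak := fun φ hφ hφs => ?_ }
  · simp only [kernel_eq, mul_assoc]
    exact (pot_integrable h0 h1 (h.comp_rotation (ζ t)) x).const_mul _
  have hφd : Differentiable ℝ φ := hφ.differentiable (by simp)
  have hfc := hφ.continuous_fderiv (by simp)
  -- the time derivative of the test function in the rotating frame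
  set G : ℝ → ℂ → ℝ := fun t y =>
    fderiv ℝ φ (t, starRingEnd ℂ (ζ t) * y) (1, Complex.I * Ω * (starRingEnd ℂ (ζ t) * y)) with hG
  have hderiv : ∀ t y, HasDerivAt (fun t => φ (t, starRingEnd ℂ (ζ t) * y)) (G t y) t :=
    fun t y => by
      have e1 : ∀ t, starRingEnd ℂ (ζ t : ℂ) = Complex.exp (Complex.I * Ω * t) := fun t => by
        rw [← hζe, ← Complex.exp_conj]; congr 1; simp
      have e2 : HasDerivAt (fun t : ℝ => starRingEnd ℂ (ζ t : ℂ) * y)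
          (Complex.I * Ω * (starRingEnd ℂ (ζ t) * y)) t := by
        simp only [e1]
        have h3 : HasDerivAt (fun t : ℝ => Complex.I * Ω * (t : ℂ)) (Complex.I * Ω) t := by
          simpa using (Complex.ofRealCLM.hasDerivAt (x := t)).const_mul (Complex.I * (Ω : ℂ))
        have h4 := (h3.cexp).mul_const y
        convert! h4 using 1
        ring
      exact (hφd _).hasFDerivAt.comp_hasDerivAt t ((hasDerivAt_id t).prodMk e2)
  have hGc : Continuous fun p : ℝ × ℂ => G p.1 p.2 := by
    simp only [hG]
    refine Continuous.clm_apply (hfc.comp (by fun_prop)) (by fun_prop)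
  set K : Set ℝ := Prod.fst '' tsupport φ with hK
  have hKc : IsCompact K := hφs.isCompact.image continuous_fst
  obtain ⟨R, hR⟩ := (hφs.isCompact.image continuous_snd).isBounded.subset_closedBall (0 : ℂ)
  have hsupp : ∀ t y, (t, y) ∉ K ×ˢ Metric.closedBall (0 : ℂ) R →
      (t, starRingEnd ℂ (ζ t : ℂ) * y) ∉ tsupport φ := fun t y hty hmem => by
    refine hty ⟨⟨_, hmem, rfl⟩, ?_⟩
    have := hR ⟨_, hmem, rfl⟩
    rwa [mem_closedBall_zero_iff, norm_mul, Complex.norm_conj, Circle.norm_coe (ζ t), one_mul,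
      ← mem_closedBall_zero_iff] at this
  have hGi : Integrable (fun p : ℝ × ℂ => θ p.2 * G p.1 p.2) := by
    refine Integrable.bdd_mul (c := M) (hGc.integrable_of_hasCompactSupport ?_)
      (h.measurable.comp measurable_snd).aestronglyMeasurable (Eventually.of_forall fun p => hM _)
    refine HasCompactSupport.intro (hKc.prod (isCompact_closedBall (0 : ℂ) R)) fun p hp => ?_
    have := hsupp p.1 p.2 hp
    have h0 : fderiv ℝ φ (p.1, starRingEnd ℂ (ζ p.1 : ℂ) * p.2) = 0 :=
      image_eq_zero_of_notMem_tsupport fun hm => this (tsupport_fderiv_subset ℝ hm)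
    simp only [hG, h0, zero_apply]
  -- Substitute y = ζ(t)x. Stationarity replaces the velocity by the rigid rotation iΩy, so the
  -- slice at time t becomes the integral of θ against the time derivative of φ(t, e^(iΩt)y).
  have hslice : ∀ t, ∫ x, θ (ζ t * x) * (fderiv ℝ φ (t, x) (1, 0) +
      fderiv ℝ φ (t, x) (0, velocity β (fun y => θ (ζ t * y)) x)) = ∫ y, θ y * G t y := fun t => by
    set φt : ℂ → ℝ := fun y => φ (t, starRingEnd ℂ (ζ t) * y) with hφt
    have hlin : ContDiff ℝ ∞ fun y : ℂ => (t, starRingEnd ℂ (ζ t : ℂ) * y) := by fun_prop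
    have hφtc : ContDiff ℝ ∞ φt := hφ.comp hlin
    have hφts : HasCompactSupport φt :=
      HasCompactSupport.intro (isCompact_closedBall (0 : ℂ) R) fun y hy =>
        image_eq_zero_of_notMem_tsupport (f := φ) (hsupp t y fun hm => hy hm.2)
    have hφtd : ∀ y v, fderiv ℝ φt y v =
        fderiv ℝ φ (t, starRingEnd ℂ (ζ t) * y) (0, starRingEnd ℂ (ζ t) * v) := fun y v => by
      have h5 : HasFDerivAt (fun y : ℂ => (t, starRingEnd ℂ (ζ t : ℂ) * y))
          ((0 : ℂ →L[ℝ] ℝ).prod (starRingEnd ℂ (ζ t : ℂ) • ContinuousLinearMap.id ℝ ℂ)) y :=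
        (hasFDerivAt_const t y).prodMk ((hasFDerivAt_id (𝕜 := ℝ) y).const_mul _)
      have h6 : HasFDerivAt φt _ y := (hφd _).hasFDerivAt.comp y h5
      rw [h6.fderiv]
      simp
    have hz := hst φt hφtc hφts
    rw [← integral_rotation (ζ t) fun y => θ y * G t y]
    rw [← integral_rotation (ζ t)] at hz
    refine Eq.trans ?_ ((congrArg (fun r => (∫ x, θ (ζ t * x) * G t (ζ t * x)) + r) hz).trans
      (add_zero _))
    have hcancel : ∀ x : ℂ, starRingEnd ℂ (ζ t : ℂ) * (ζ t * x) = x := fun x => by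
      rw [← mul_assoc, hζn, one_mul]
    rw [← integral_add]
    · refine integral_congr_ae (Eventually.of_forall fun x => ?_)
      simp only [hφtd, hG, hcancel, hvel, ← mul_add, ← map_add]
      congr 2
      ext <;> simp only [Prod.mk_add_mk, add_zero, zero_add, mul_sub]
      rw [show starRingEnd ℂ (ζ t : ℂ) * (Complex.I * Ω * (ζ t * x)) =
        Complex.I * Ω * (starRingEnd ℂ (ζ t : ℂ) * (ζ t * x)) by ring, hcancel]
      ring
    · have h6 : Integrable fun y => θ y * G t y := by
        refine Integrable.bdd_mul (c := M) ((hGc.comp (by fun_prop :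
          Continuous fun y : ℂ => (t, y))).integrable_of_hasCompactSupport ?_)
          h.measurable.aestronglyMeasurable (Eventually.of_forall fun p => hM _)
        refine HasCompactSupport.intro (isCompact_closedBall (0 : ℂ) R) fun y hy => ?_
        have h0 : fderiv ℝ φ (t, starRingEnd ℂ (ζ t : ℂ) * y) = 0 :=
          image_eq_zero_of_notMem_tsupport fun hm =>
            hsupp t y (fun hm => hy hm.2) (tsupport_fderiv_subset ℝ hm)
        simp only [Function.comp_apply, hG, h0, zero_apply]
      exact (measurePreserving_rotation (ζ t)).integrable_comp_of_integrable h6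
    · have h6 : Integrable fun y => θ y *
          fderiv ℝ φt y (velocity β θ y - Complex.I * Ω * y) := by
        have hc : Continuous fun y => fderiv ℝ φt y (velocity β θ y - Complex.I * Ω * y) :=
          (hφtc.continuous_fderiv (by simp)).clm_apply (by fun_prop)
        refine Integrable.bdd_mul (c := M) (hc.integrable_of_hasCompactSupport ?_)
          h.measurable.aestronglyMeasurable (Eventually.of_forall fun p => hM _)
        refine HasCompactSupport.intro (hφts.fderiv ℝ) fun y hy => ?_
        rw [image_eq_zero_of_notMem_tsupport hy, zero_apply]
      exact (measurePreserving_rotation (ζ t)).integrable_comp_of_integrable h6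
  have hrestr : (volume : Measure (ℝ × ℂ)).restrict (Ici 0 ×ˢ univ) =
      ((volume : Measure ℝ).restrict (Ici 0)).prod (volume : Measure ℂ) := by
    rw [Measure.volume_eq_prod, ← Measure.prod_restrict, Measure.restrict_univ]
  have hI := (htest φ hφ hφs).restrict (s := Ici 0 ×ˢ univ)
  have hGi' := hGi.restrict (s := Ici 0 ×ˢ univ)
  rw [hrestr] at hI hGi' ⊢
  rw [integral_prod _ hI]
  simp only [hslice]
  -- After exchanging the integrals, integration in time for fixed y leaves −φ(0, y), which cancels
  -- the initial term.
  rw [integral_integral_swap (f := fun t y => θ y * G t y) hGi', ← integral_add]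
  · refine (integral_congr_ae (Eventually.of_forall fun y => ?_)).trans (integral_zero _ _)
    simp only [integral_const_mul]
    have hd : deriv (fun t => φ (t, starRingEnd ℂ (ζ t : ℂ) * y)) = fun t => G t y :=
      funext fun t => (hderiv t y).deriv
    have hcd : ContDiff ℝ 1 fun t => φ (t, starRingEnd ℂ (ζ t : ℂ) * y) := by
      rw [contDiff_one_iff_deriv, hd]
      exact ⟨fun t => (hderiv t y).differentiableAt,
        hGc.comp (by fun_prop : Continuous fun t : ℝ => (t, y))⟩
    have hcs : HasCompactSupport fun t => φ (t, starRingEnd ℂ (ζ t : ℂ) * y) :=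
      HasCompactSupport.intro hKc fun t ht =>
        image_eq_zero_of_notMem_tsupport (hsupp t y fun hm => ht hm.1)
    have := hcs.integral_Ioi_deriv_eq hcd 0
    rw [hd] at this
    rw [integral_Ici_eq_integral_Ioi, this]
    simp [hζ]
  · exact hGi'.integral_prod_right
  · refine Integrable.bdd_mul (c := M) (Continuous.integrable_of_hasCompactSupport
      (hφ.continuous.comp (by fun_prop)) ?_) h.measurable.aestronglyMeasurable
      (Eventually.of_forall fun p => hM _)
    refine HasCompactSupport.intro (isCompact_closedBall (0 : ℂ) R) fun y hy => ?_
    have := hsupp 0 y fun hm => hy hm.2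
    simp only [hζ, mul_zero, neg_zero, Circle.exp_zero, Circle.coe_one, map_one, one_mul] at this
    exact image_eq_zero_of_notMem_tsupport this

/-! ### Polygonal patches -/

/-- The rotation by the angle `2π/N`. -/
def polygonRoot (N : ℕ) : Circle := Circle.exp (2 * Real.pi / N)

theorem polygonRoot_pow_coe (N m : ℕ) : ((polygonRoot N ^ m : Circle) : ℂ) =
    Complex.exp (2 * Real.pi * Complex.I * m / N) := by
  rw [polygonRoot, Circle.coe_pow, Circle.coe_exp, ← Complex.exp_nat_mul]
  congr 1
  push_cast
  ring

theorem polygonRoot_pow_self {N : ℕ} (hN : N ≠ 0) : polygonRoot N ^ N = 1 := by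
  apply Circle.ext
  rw [polygonRoot_pow_coe, Circle.coe_one]
  have : (N : ℂ) ≠ 0 := by exact_mod_cast hN
  rw [mul_div_cancel_right₀ _ this, Complex.exp_two_pi_mul_I]

theorem indicator_rotation_image (D : Set ℂ) (ζ : Circle) (x : ℂ) :
    ((fun z : ℂ => (ζ : ℂ) * z) '' D).indicator (fun _ => (1 : ℝ)) x =
      D.indicator (fun _ => 1) ((ζ⁻¹ : Circle) * x) := by
  have h : ((ζ : ℂ) * ((ζ⁻¹ : Circle) * x)) = x := by
    rw [← mul_assoc, ← Circle.coe_mul, mul_inv_cancel, Circle.coe_one, one_mul]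
  have h' : ∀ z : ℂ, ((ζ⁻¹ : Circle) * ((ζ : ℂ) * z)) = z := fun z => by
    rw [← mul_assoc, ← Circle.coe_mul, inv_mul_cancel, Circle.coe_one, one_mul]
  by_cases hx : ((ζ⁻¹ : Circle) : ℂ) * x ∈ D
  · rw [indicator_of_mem hx, indicator_of_mem]
    exact ⟨_, hx, h⟩
  · rw [indicator_of_notMem hx, indicator_of_notMem]
    rintro ⟨z, hz, rfl⟩
    rw [h'] at hx
    exact hx hz

theorem polygonPatch_eq (N : ℕ) (ε : ℝ) (D : Set ℂ) (x : ℂ) :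
    polygonPatch N ε D x = 1 / (Real.pi * ε ^ 2) *
      ∑ m ∈ Finset.range N, D.indicator (fun _ => (1 : ℝ)) (((polygonRoot N ^ m)⁻¹ : Circle) * x) := by
  simp only [polygonPatch, ← polygonRoot_pow_coe, indicator_rotation_image]

theorem isBddDensity_polygonPatch (N : ℕ) (ε : ℝ) {D : Set ℂ} (hD : IsOpen D)
    (hb : Bornology.IsBounded D) : IsBddDensity (polygonPatch N ε D) := by
  rw [show polygonPatch N ε D = _ from funext (polygonPatch_eq N ε D)]
  exact (IsBddDensity.sum _ fun m _ =>
    (isBddDensity_indicator hD.measurableSet hb).comp_rotation _).const_mul _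

theorem sum_range_shift {g : ℕ → ℝ} {N : ℕ} (hg : g N = g 0) :
    ∑ m ∈ Finset.range N, g (m + 1) = ∑ m ∈ Finset.range N, g m := by
  have h1 := Finset.sum_range_succ g N
  have h2 := Finset.sum_range_succ' g N
  linarith

theorem sum_polygonRoot_mul {N : ℕ} (hN : N ≠ 0) (F : Circle → ℝ) (j : ℕ) :
    ∑ m ∈ Finset.range N, F (polygonRoot N ^ m * polygonRoot N ^ j) =
      ∑ m ∈ Finset.range N, F (polygonRoot N ^ m) := by
  induction j with
  | zero => simp
  | succ j ih =>
    rw [← ih, ← sum_range_shift (g := fun m => F (polygonRoot N ^ m * polygonRoot N ^ j))]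
    · simp only [pow_succ, mul_assoc, mul_comm (polygonRoot N)]
    · simp [polygonRoot_pow_self hN]

theorem sum_polygonRoot_inv {N : ℕ} (hN : N ≠ 0) (F : Circle → ℝ) :
    ∑ m ∈ Finset.range N, F (polygonRoot N ^ m)⁻¹ = ∑ m ∈ Finset.range N, F (polygonRoot N ^ m) := by
  rw [← sum_range_shift (by simp [polygonRoot_pow_self hN]),
    ← Finset.sum_range_reflect (fun m => F (polygonRoot N ^ m))]
  refine Finset.sum_congr rfl fun m hm => ?_
  rw [Finset.mem_range] at hm
  congr 1
  rw [inv_eq_iff_mul_eq_one, ← pow_add, show m + 1 + (N - 1 - m) = N by omega,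
    polygonRoot_pow_self hN]

theorem polygonPatch_rotation {N : ℕ} (hN : N ≠ 0) (ε : ℝ) (D : Set ℂ) (j : ℕ) (x : ℂ) :
    polygonPatch N ε D ((polygonRoot N ^ j : Circle) * x) = polygonPatch N ε D x := by
  rw [polygonPatch_eq, polygonPatch_eq]
  congr 1
  set F : Circle → ℝ := fun w => D.indicator (fun _ => (1 : ℝ)) ((w : ℂ) * x)
  have h1 := sum_polygonRoot_inv hN F
  have h2 := sum_polygonRoot_inv hN fun w => F (w * polygonRoot N ^ j)
  have h3 := sum_polygonRoot_mul hN F j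
  rw [h3, ← h1] at h2
  rw [← h2]
  refine Finset.sum_congr rfl fun m _ => ?_
  simp only [F, Circle.coe_mul, mul_assoc]

/-- In the rotating frame the velocity is −∇^⊥Ψ with Ψ = potential + Ω|x|²/2, so the stationarity
condition is a sum of Jacobian integrals over the rotated copies. Both terms of Ψ are invariant
under the rotations of the polygon, so Ψ takes the value c on the frontier of each copy. Each
indicator is treated separately, so the copies need not be disjoint. -/
theorem isRotatingSolution_polygonPatch {β : ℝ} (h0 : 0 ≤ β) (h1 : β < 1) {N : ℕ} (hN : N ≠ 0)
    {ε Ω c : ℝ} {D : Set ℂ} (hD : IsOpen D) (hb : Bornology.IsBounded D)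
    (hc : ∀ x ∈ frontier D, potential β (polygonPatch N ε D) x + Ω / 2 * ‖x‖ ^ 2 = c) :
    IsRotatingSolution β (polygonPatch N ε D) Ω := by
  have hθ := isBddDensity_polygonPatch N ε hD hb
  refine isRotatingSolution_of_stationary h0 h1 hθ fun φ hφ hφs => ?_
  set θ := polygonPatch N ε D
  set Ψ : ℂ → ℝ := fun x => potential β θ x + Ω / 2 * ‖x‖ ^ 2 with hΨ
  have hp := contDiff_potential h0 h1 hθ
  have hΨc : ContDiff ℝ 1 Ψ := hp.add (contDiff_const.mul (contDiff_norm_sq ℝ))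
  have hΨd : ∀ y v, fderiv ℝ Ψ y v = fderiv ℝ (potential β θ) y v +
      Ω * (y.re * v.re + y.im * v.im) := fun y v => by
    have h2 : HasFDerivAt Ψ _ y := ((hp.differentiable one_ne_zero) y).hasFDerivAt.add
      ((hasStrictFDerivAt_norm_sq y).hasFDerivAt.const_mul (Ω / 2))
    rw [h2.fderiv]
    simp [Complex.inner]
    ring
  have hrot : ∀ j x, Ψ ((polygonRoot N ^ j : Circle) * x) = Ψ x := fun j x => by
    simp only [hΨ, norm_mul, Circle.norm_coe, one_mul]
    rw [← potential_rotation]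
    simp only [θ, polygonPatch_rotation hN]
  set J : ℂ → ℝ := fun y => fderiv ℝ Ψ y Complex.I * fderiv ℝ φ y 1 -
    fderiv ℝ Ψ y 1 * fderiv ℝ φ y Complex.I
  have hJ : ∀ y, fderiv ℝ φ y (velocity β θ y - Complex.I * Ω * y) = J y := fun y => by
    rw [clm_complex_apply]
    simp only [J, hΨd, velocity]
    simp
    ring
  set E : ℕ → Set ℂ := fun m => (fun z : ℂ => ((polygonRoot N ^ m : Circle) : ℂ) * z) '' D
  have hEh : ∀ m, E m = (rotation (polygonRoot N ^ m)).toHomeomorph '' D := fun m => rfl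
  have hEo : ∀ m, IsOpen (E m) := fun m => by
    rw [hEh]; exact (Homeomorph.isOpen_image _).2 hD
  have hEb : ∀ m, Bornology.IsBounded (E m) := fun m =>
    (rotation (polygonRoot N ^ m)).isometry.lipschitz.isBounded_image hb
  have hJc : Integrable J := by
    have a1 : ∀ v, Continuous fun y => fderiv ℝ Ψ y v := fun v =>
      (hΨc.continuous_fderiv one_ne_zero).clm_apply continuous_const
    have a2 : ∀ v, Continuous fun y => fderiv ℝ φ y v := fun v =>
      (hφ.continuous_fderiv (by simp)).clm_apply continuous_const
    refine Continuous.integrable_of_hasCompactSupport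
      (((a1 _).mul (a2 _)).sub ((a1 _).mul (a2 _))) ?_
    refine HasCompactSupport.intro (hφs.fderiv ℝ) fun y hy => ?_
    simp only [J]
    rw [image_eq_zero_of_notMem_tsupport hy]
    simp
  have hzero : ∀ m, ∫ y in E m, J y = 0 := fun m => by
    refine integral_jacobian_level_set (c := c) (hEo m) (hEb m) hΨc (fun x hx => ?_)
      (contDiff_infty.1 hφ 2) hφs
    rw [hEh, ← Homeomorph.image_frontier] at hx
    obtain ⟨z, hz, rfl⟩ := hx
    exact (hrot m z).trans (hc z hz)
  have hθe : ∀ y, θ y * fderiv ℝ φ y (velocity β θ y - Complex.I * Ω * y) =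
      1 / (Real.pi * ε ^ 2) * ∑ m ∈ Finset.range N, (E m).indicator J y := fun y => by
    rw [hJ]
    simp only [θ, polygonPatch, ← polygonRoot_pow_coe]
    rw [mul_assoc, Finset.sum_mul]
    congr 1
    refine Finset.sum_congr rfl fun m _ => ?_
    by_cases hy : y ∈ E m
    · rw [indicator_of_mem hy, indicator_of_mem hy, one_mul]
    · rw [indicator_of_notMem hy, indicator_of_notMem hy, zero_mul]
  simp only [hθe]
  rw [integral_const_mul, integral_finsetSum _ fun m _ => hJc.indicator (hEo m).measurableSet]
  simp only [integral_indicator (hEo _).measurableSet, hzero, Finset.sum_const_zero, mul_zero]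

/-! ### Polar coordinates with angles in the circle -/

instance fact_two_pi_pos : Fact (0 < 2 * Real.pi) := ⟨Real.two_pi_pos⟩

/-- The circle of angles. -/
abbrev Angles := AddCircle (2 * Real.pi)

/-- The unit vector with a given angle. -/
def unitVec (α : Angles) : ℂ := (AddCircle.toCircle α : ℂ)

/-- The angle of a complex number. -/
def angle (z : ℂ) : Angles := (Complex.arg z : Angles)

theorem unitVec_coe (t : ℝ) : unitVec (t : Angles) = Complex.exp (t * Complex.I) := by
  have := Real.pi_ne_zero
  rw [unitVec, AddCircle.toCircle_apply_mk, Circle.coe_exp, div_self (by positivity), one_mul]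

theorem continuous_unitVec : Continuous unitVec :=
  continuous_subtype_val.comp AddCircle.continuous_toCircle

@[simp] theorem norm_unitVec (α : Angles) : ‖unitVec α‖ = 1 := Circle.norm_coe _

theorem unitVec_add (α η : Angles) : unitVec (α + η) = unitVec α * unitVec η := by
  simp [unitVec, AddCircle.toCircle_add]

theorem unitVec_neg (α : Angles) : unitVec (-α) = starRingEnd ℂ (unitVec α) := by
  rw [unitVec, AddCircle.toCircle_neg, Circle.coe_inv_eq_conj, unitVec]

@[simp] theorem unitVec_zero : unitVec 0 = 1 := by simp [unitVec]

theorem unitVec_sub (α η : Angles) : unitVec (α - η) = unitVec α * starRingEnd ℂ (unitVec η) := by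
  rw [sub_eq_add_neg, unitVec_add, unitVec_neg]

theorem unitVec_injective : Function.Injective unitVec :=
  Subtype.val_injective.comp (AddCircle.injective_toCircle (by positivity))

theorem norm_mul_unitVec (z : ℂ) : (‖z‖ : ℂ) * unitVec (angle z) = z := by
  rw [angle, unitVec_coe, Complex.norm_mul_exp_arg_mul_I]

theorem angle_mul_unitVec {r : ℝ} (hr : 0 < r) (α : Angles) : angle (r * unitVec α) = α := by
  apply unitVec_injective
  have h := norm_mul_unitVec (r * unitVec α)
  rw [norm_mul, norm_unitVec, mul_one, Complex.norm_real, Real.norm_of_nonneg hr.le] at h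
  exact mul_left_cancel₀ (by exact_mod_cast hr.ne') h

theorem continuousAt_angle {z : ℂ} (hz : z ≠ 0) : ContinuousAt angle z :=
  Complex.continuousAt_arg_coe_angle hz

theorem measurable_angle : Measurable angle :=
  AddCircle.measurable_mk'.comp Complex.measurable_arg

/-- The radial measure `r dr`. -/
def radialMeasure : Measure ℝ :=
  (volume.restrict (Ioi 0)).withDensity fun r => ENNReal.ofReal r

instance : SFinite radialMeasure := by unfold radialMeasure; infer_instance

theorem continuous_polarMap : Continuous fun p : ℝ × Angles => (p.1 : ℂ) * unitVec p.2 :=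
  (Complex.continuous_ofReal.comp continuous_fst).mul (continuous_unitVec.comp continuous_snd)

/-- Compare with `Complex.polarCoord` by unrolling the circle onto (−π, π]. Keeping the angle in
`AddCircle` makes translations available and the space of angles compact, with no branch cut. -/
theorem measurePreserving_polar :
    MeasurePreserving (fun p : ℝ × Angles => (p.1 : ℂ) * unitVec p.2)
      (radialMeasure.prod volume) volume := by
  refine ⟨continuous_polarMap.measurable, ?_⟩
  ext s hs
  rw [Measure.map_apply continuous_polarMap.measurable hs]
  set F : ℂ → ENNReal := s.indicator 1
  have hF : Measurable F := measurable_one.indicator hs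
  have hFp : Measurable fun p : ℝ × Angles => F ((p.1 : ℂ) * unitVec p.2) :=
    hF.comp continuous_polarMap.measurable
  have e1 : (radialMeasure.prod (volume : Measure Angles))
      ((fun p : ℝ × Angles => (p.1 : ℂ) * unitVec p.2) ⁻¹' s) =
      ∫⁻ r in Ioi (0 : ℝ), ENNReal.ofReal r * ∫⁻ α : Angles, F (r * unitVec α) := by
    rw [← lintegral_indicator_one (continuous_polarMap.measurable hs)]
    have : ∀ p : ℝ × Angles, ((fun p : ℝ × Angles => (p.1 : ℂ) * unitVec p.2) ⁻¹' s).indicator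
        (1 : ℝ × Angles → ENNReal) p = F ((p.1 : ℂ) * unitVec p.2) := fun p => rfl
    simp only [this]
    rw [lintegral_prod _ hFp.aemeasurable, radialMeasure,
      lintegral_withDensity_eq_lintegral_mul _ (by fun_prop) hFp.lintegral_prod_right']
    rfl
  have e2 : (volume : Measure ℂ) s =
      ∫⁻ r in Ioi (0 : ℝ), ENNReal.ofReal r * ∫⁻ α : Angles, F (r * unitVec α) := by
    rw [← lintegral_indicator_one hs, ← Complex.lintegral_comp_polarCoord_symm,
      polarCoord_target, Measure.volume_eq_prod, ← Measure.prod_restrict, lintegral_prod]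
    · refine lintegral_congr fun r => ?_
      simp only [smul_eq_mul]
      have hm : Measurable fun y : ℝ => F (Complex.polarCoord.symm (r, y)) := by
        simp only [Complex.polarCoord_symm_apply]
        exact hF.comp (by fun_prop)
      rw [lintegral_const_mul _ hm, ← AddCircle.lintegral_preimage (2 * Real.pi) (-Real.pi),
        show -Real.pi + 2 * Real.pi = Real.pi by ring, restrict_Ioo_eq_restrict_Ioc]
      congr 1
      refine lintegral_congr fun t => ?_
      rw [unitVec_coe, Complex.polarCoord_symm_apply, Complex.exp_mul_I]
      push_cast
      rfl
    · refine Measurable.aemeasurable ?_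
      simp only [smul_eq_mul]
      refine Measurable.mul (by fun_prop) ?_
      simp only [Complex.polarCoord_symm_apply]
      exact hF.comp (by fun_prop)
  rw [e1, e2]

/-- The patch with boundary `(1 + u α) e^(iα)`. -/
def starPatch (u : C(Angles, ℝ)) : Set ℂ := {z | ‖z‖ < 1 + u (angle z)}

variable {E : Type*} [NormedAddCommGroup E] [NormedSpace ℝ E]

theorem radialMeasure_integrableOn {f : ℝ → E} :
    Integrable f radialMeasure ↔ IntegrableOn (fun r => r • f r) (Ioi 0) := by
  rw [radialMeasure, integrable_withDensity_iff_integrable_smul' (by fun_prop) (by simp)]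
  refine integrable_congr ?_
  filter_upwards [ae_restrict_mem measurableSet_Ioi] with r hr
  rw [ENNReal.toReal_ofReal (le_of_lt hr)]

theorem integral_radialMeasure {f : ℝ → E} :
    ∫ r, f r ∂radialMeasure = ∫ r in Ioi 0, r • f r := by
  rw [radialMeasure, integral_withDensity_eq_integral_toReal_smul (by fun_prop) (by simp)]
  refine integral_congr_ae ?_
  filter_upwards [ae_restrict_mem measurableSet_Ioi] with r hr
  rw [ENNReal.toReal_ofReal (le_of_lt hr)]

theorem measurableSet_starPatch (u : C(Angles, ℝ)) : MeasurableSet (starPatch u) :=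
  measurableSet_lt measurable_norm
    (measurable_const.add (u.continuous.measurable.comp measurable_angle))

theorem starPatch_subset_ball {u : C(Angles, ℝ)} {δ : ℝ} (hu : ∀ α, |u α| ≤ δ) :
    starPatch u ⊆ Metric.ball 0 (1 + δ) := fun z hz => by
  rw [mem_ball_zero_iff]
  have h1 : ‖z‖ < 1 + u (angle z) := hz
  linarith [le_abs_self (u (angle z)), hu (angle z)]

theorem mem_starPatch_polar {u : C(Angles, ℝ)} {r : ℝ} (hr : 0 < r) (α : Angles) :
    (r : ℂ) * unitVec α ∈ starPatch u ↔ r < 1 + u α := by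
  rw [starPatch, mem_ofPred_eq, angle_mul_unitVec hr, norm_mul, norm_unitVec, mul_one,
    Complex.norm_real, Real.norm_of_nonneg hr.le]

theorem indicator_starPatch_integral {u : C(Angles, ℝ)} (hu : ∀ α, -1 < u α) (f : ℂ → E)
    (α : Angles) : ∫ r in Ioi (0 : ℝ), r • (starPatch u).indicator f (r * unitVec α) =
      ∫ r in (0 : ℝ)..1 + u α, r • f (r * unitVec α) := by
  rw [intervalIntegral.integral_of_le (by linarith [hu α]), ← restrict_Ioo_eq_restrict_Ioc,
    ← integral_indicator measurableSet_Ioi, ← integral_indicator measurableSet_Ioo]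
  congr 1
  ext r
  by_cases hr : 0 < r
  · by_cases hru : r < 1 + u α
    · rw [indicator_of_mem (show r ∈ Ioi 0 from hr),
        indicator_of_mem ((mem_starPatch_polar hr α).2 hru),
        indicator_of_mem (show r ∈ Ioo 0 (1 + u α) from ⟨hr, hru⟩)]
    · rw [indicator_of_mem (show r ∈ Ioi 0 from hr),
        indicator_of_notMem (fun h => hru ((mem_starPatch_polar hr α).1 h)),
        indicator_of_notMem (show r ∉ Ioo 0 (1 + u α) from fun h => hru h.2), smul_zero]
  · rw [indicator_of_notMem (show r ∉ Ioi 0 from hr),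
      indicator_of_notMem (show r ∉ Ioo 0 (1 + u α) from fun h => hr h.1)]

theorem integral_starPatch {u : C(Angles, ℝ)} (hu : ∀ α, -1 < u α) {f : ℂ → E}
    (hf : IntegrableOn f (starPatch u)) :
    Integrable (fun α => ∫ r in (0 : ℝ)..1 + u α, r • f (r * unitVec α)) ∧
    ∫ z in starPatch u, f z = ∫ α, ∫ r in (0 : ℝ)..1 + u α, r • f (r * unitVec α) := by
  have hi := hf.integrable_indicator (measurableSet_starPatch u)
  have hp := measurePreserving_polar.integrable_comp_of_integrable hi
  have hr := hp.integral_prod_right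
  simp only [Function.comp_apply, integral_radialMeasure, indicator_starPatch_integral hu] at hr
  refine ⟨hr, ?_⟩
  rw [← integral_indicator (measurableSet_starPatch u)]
  have h1 : ∫ z, (starPatch u).indicator f z = ∫ p : ℝ × Angles,
      (starPatch u).indicator f ((p.1 : ℂ) * unitVec p.2) ∂radialMeasure.prod volume := by
    have hae := hi.aestronglyMeasurable
    rw [← measurePreserving_polar.map_eq] at hae
    rw [← integral_map measurePreserving_polar.measurable.aemeasurable hae,
      measurePreserving_polar.map_eq]
  rw [h1]
  refine (integral_prod_symm _ hp).trans ?_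
  simp only [Function.comp_apply, integral_radialMeasure, indicator_starPatch_integral hu]

theorem ae_intervalIntegrable_polar {R : ℝ} (hR : 0 ≤ R) {f : ℂ → E}
    (hf : IntegrableOn f (Metric.ball 0 R)) :
    ∀ᵐ α : Angles, IntervalIntegrable (fun r : ℝ => r • f (r * unitVec α)) volume 0 R := by
  have hi := hf.integrable_indicator measurableSet_ball
  have hp := measurePreserving_polar.integrable_comp_of_integrable hi
  filter_upwards [hp.prod_left_ae] with α hα
  rw [intervalIntegrable_iff_integrableOn_Ioo_of_le hR]
  simp only [Function.comp_apply, radialMeasure_integrableOn] at hα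
  refine (hα.mono_set Ioo_subset_Ioi_self).congr_fun (fun r hr => ?_) measurableSet_Ioo
  beta_reduce
  rw [indicator_of_mem]
  rw [mem_ball_zero_iff, norm_mul, norm_unitVec, mul_one, Complex.norm_real,
    Real.norm_of_nonneg hr.1.le]
  exact hr.2

/-- Interval integrals are signed, so no ordering of u and w is required. -/
theorem integral_starPatch_sub {u w : C(Angles, ℝ)} {δ : ℝ} (hδ : δ < 1) (hu : ∀ α, |u α| ≤ δ)
    (hw : ∀ α, |w α| ≤ δ) {f : ℂ → E} (hf : IntegrableOn f (Metric.ball 0 (1 + δ))) :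
    Integrable (fun α => ∫ r in (1 + w α)..(1 + u α), r • f (r * unitVec α)) ∧
    (∫ z in starPatch u, f z) - ∫ z in starPatch w, f z =
      ∫ α, ∫ r in (1 + w α)..(1 + u α), r • f (r * unitVec α) := by
  have hδ0 : 0 ≤ δ := (abs_nonneg _).trans (hu 0)
  have hu1 : ∀ α, -1 < u α := fun α => by linarith [(abs_le.1 (hu α)).1]
  have hw1 : ∀ α, -1 < w α := fun α => by linarith [(abs_le.1 (hw α)).1]
  obtain ⟨iu, eu⟩ := integral_starPatch hu1 (hf.mono_set (starPatch_subset_ball hu))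
  obtain ⟨iw, ew⟩ := integral_starPatch hw1 (hf.mono_set (starPatch_subset_ball hw))
  have hae : (fun α => (∫ r in (0 : ℝ)..1 + u α, r • f (r * unitVec α)) -
      ∫ r in (0 : ℝ)..1 + w α, r • f (r * unitVec α)) =ᵐ[volume]
      fun α => ∫ r in (1 + w α)..(1 + u α), r • f (r * unitVec α) := by
    filter_upwards [ae_intervalIntegrable_polar (by linarith : (0 : ℝ) ≤ 1 + δ) hf] with α hα
    refine intervalIntegral.integral_interval_sub_left (hα.mono_set ?_) (hα.mono_set ?_)
    · rw [uIcc_of_le (by linarith [hu1 α]), uIcc_of_le (by linarith)]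
      exact Icc_subset_Icc_right (by linarith [(abs_le.1 (hu α)).2])
    · rw [uIcc_of_le (by linarith [hw1 α]), uIcc_of_le (by linarith)]
      exact Icc_subset_Icc_right (by linarith [(abs_le.1 (hw α)).2])
  refine ⟨(iu.sub iw).congr hae, ?_⟩
  rw [eu, ew, ← integral_sub iu iw]
  exact integral_congr_ae hae

/-! ### The single layer kernel on the circle -/

theorem norm_unitVec_sub (α η : Angles) : ‖unitVec α - unitVec η‖ = ‖1 - unitVec (α - η)‖ := by
  have h : unitVec α = unitVec η * unitVec (α - η) := by rw [← unitVec_add]; congr 1; abel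
  rw [h, show unitVec η * unitVec (α - η) - unitVec η = unitVec η * (unitVec (α - η) - 1) by ring,
    norm_mul, norm_unitVec, one_mul, norm_sub_rev]

theorem one_sub_unitVec_pos {η : Angles} (h : η ≠ 0) : 0 < ‖1 - unitVec η‖ := by
  rw [norm_pos_iff, sub_ne_zero, ← unitVec_zero]
  exact fun h' => h (unitVec_injective h').symm

theorem norm_one_sub_unitVec_le (η : Angles) : ‖1 - unitVec η‖ ≤ 2 :=
  (norm_sub_le _ _).trans (by simp; norm_num)

theorem sq_norm_one_sub_unitVec (η : Angles) : ‖1 - unitVec η‖ ^ 2 = 2 - 2 * (unitVec η).re := by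
  have h1 : (unitVec η).re * (unitVec η).re + (unitVec η).im * (unitVec η).im = 1 := by
    rw [← Complex.normSq_apply, Complex.normSq_eq_norm_sq, norm_unitVec, one_pow]
  rw [← Complex.normSq_eq_norm_sq, Complex.normSq_apply]
  simp only [Complex.sub_re, Complex.one_re, Complex.sub_im, Complex.one_im]
  linarith

theorem ae_ne_angles (α : Angles) : ∀ᵐ η : Angles, η ≠ α := by
  have h := (AddCircle.measurePreserving_mk (2 * Real.pi) 0).map_eq
  rw [ae_iff, ← h, Measure.map_apply AddCircle.measurable_mk' (by simp)]
  refine measure_mono_null ?_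
    ((Set.countable_range fun n : ℤ => n • (2 * Real.pi) + Quotient.out α).measure_zero _)
  intro t ht
  simp only [ne_eq, not_not, mem_preimage, mem_ofPred_eq] at ht
  have h2 : ((Quotient.out α : ℝ) : Angles) = α := Quotient.out_eq α
  rw [← h2] at ht
  have h3 : ((t - Quotient.out α : ℝ) : Angles) = 0 := by
    rw [AddCircle.coe_sub, sub_eq_zero]; exact ht
  obtain ⟨n, hn⟩ := (AddCircle.coe_eq_zero_iff _).1 h3
  exact ⟨n, by simp only at hn ⊢; linarith⟩

/-- Chord against arc: |1 − e^(it)| = 2|sin(t/2)| ≥ (2/π)|t| for |t| ≤ π. -/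
theorem integrable_norm_one_sub_unitVec {s : ℝ} (hs0 : 0 ≤ s) (hs : s < 1) :
    Integrable fun η : Angles => ‖1 - unitVec η‖ ^ (-s) := by
  have hm : Measurable fun η : Angles => ‖1 - unitVec η‖ ^ (-s) :=
    ((measurable_const.sub continuous_unitVec.measurable).norm).pow_const _
  rw [← (AddCircle.measurePreserving_mk (2 * Real.pi) (-Real.pi)).integrable_comp
    hm.aestronglyMeasurable]
  have h1 : IntegrableOn (fun t : ℝ => ‖t‖ ^ (-s)) (Metric.ball 0 (Real.pi + 1)) := by
    rw [integrableOn_fun_norm_addHaar (E := ℝ) volume (f := fun t : ℝ => t ^ (-s))]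
    simpa using (intervalIntegral.integrableOn_Ioo_rpow_iff (s := -s)
      (by positivity : 0 < Real.pi + 1)).2 (by linarith)
  have h2 : Ioc (-Real.pi) (-Real.pi + 2 * Real.pi) ⊆ Metric.ball (0 : ℝ) (Real.pi + 1) := by
    intro t ht
    rw [mem_ball_zero_iff, Real.norm_eq_abs, abs_lt]
    constructor <;> linarith [ht.1, ht.2]
  refine ((h1.mono_set h2).const_mul ((2 / Real.pi) ^ (-s))).mono'
    (hm.comp AddCircle.measurable_mk').aestronglyMeasurable ?_
  filter_upwards [ae_restrict_mem measurableSet_Ioc,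
    ae_restrict_of_ae (compl_mem_ae_iff.2 (measure_singleton (0 : ℝ)))] with t ht ht0
  simp only [Function.comp_apply]
  have ht0' : 0 < |t| := abs_pos.2 ht0
  have e : ‖(1 : ℂ) - unitVec (t : Angles)‖ = 2 * |Real.sin (t / 2)| := by
    rw [unitVec_coe, norm_sub_rev, mul_comm, Complex.norm_exp_I_mul_ofReal_sub_one, Real.norm_eq_abs,
      abs_mul, abs_two]
  have hle : 2 / Real.pi * |t| ≤ ‖(1 : ℂ) - unitVec (t : Angles)‖ := by
    have ha : |t / 2| ≤ Real.pi / 2 := by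
      rw [abs_div, abs_two]
      have : |t| ≤ Real.pi := abs_le.2 ⟨ht.1.le, by linarith [ht.2]⟩
      linarith
    have := Real.mul_abs_le_abs_sin ha
    rw [e]
    rw [abs_div, abs_two] at this
    linarith
  have : ((t : ℝ) : Angles) = QuotientAddGroup.mk t := rfl
  rw [← this, Real.norm_of_nonneg (by positivity), Real.norm_eq_abs,
    ← Real.mul_rpow (by positivity) (abs_nonneg t)]
  exact Real.rpow_le_rpow_of_nonpos (by positivity) hle (by linarith)

/-- The kernel of the single layer potential of the unit circle. -/
def layerKernel (β : ℝ) (η : Angles) : ℝ := profile β ‖1 - unitVec η‖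

theorem measurable_layerKernel (β : ℝ) : Measurable (layerKernel β) :=
  (measurable_profile β).comp (measurable_const.sub continuous_unitVec.measurable).norm

theorem layerKernel_neg (β : ℝ) (η : Angles) : layerKernel β (-η) = layerKernel β η := by
  unfold layerKernel
  congr 1
  rw [unitVec_neg, ← Complex.norm_conj, map_sub, map_one, Complex.conj_conj]

/-- The exponent `(1-β)/2` of Hölder type estimates. -/
def holderExp (β : ℝ) : ℝ := (1 - β) / 2

/-- A constant for `abs_profile_le_rpow`. -/
def profileConst (β : ℝ) : ℝ := 2 * |profile β 1| + 3 / holderExp β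

theorem holderExp_pos {β : ℝ} (h1 : β < 1) : 0 < holderExp β := by unfold holderExp; linarith

theorem holderExp_le {β : ℝ} (h0 : 0 ≤ β) : holderExp β ≤ 1 / 2 := by unfold holderExp; linarith

theorem profileConst_nonneg {β : ℝ} (h1 : β < 1) : 0 ≤ profileConst β := by
  have := holderExp_pos h1
  unfold profileConst; positivity

theorem abs_profile_le_rpow {β s : ℝ} (h0 : 0 ≤ β) (h1 : β < 1) (hs : 0 < s) (hs2 : s ≤ 2) :
    |profile β s| ≤ profileConst β * s ^ (-((1 + β) / 2)) := by
  have hγ := holderExp_pos h1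
  have h := abs_profile_le h0 hγ (by linarith [holderExp_le h0]) hs
  have e1 : -β - holderExp β = -((1 + β) / 2) := by unfold holderExp; ring
  rw [e1] at h
  set σ := (1 + β) / 2
  have hσ : 0 ≤ σ ∧ σ ≤ 1 := ⟨by simp only [σ]; linarith, by simp only [σ]; linarith⟩
  have hp := Real.rpow_pos_of_pos hs (-σ)
  have hone : 1 ≤ 2 * s ^ (-σ) := by
    rw [Real.rpow_neg hs.le, ← div_eq_mul_inv, le_div_iff₀ (Real.rpow_pos_of_pos hs σ), one_mul]
    calc s ^ σ ≤ 2 ^ σ := Real.rpow_le_rpow hs.le hs2 hσ.1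
      _ ≤ 2 ^ (1 : ℝ) := Real.rpow_le_rpow_of_exponent_le one_le_two hσ.2
      _ = 2 := Real.rpow_one 2
  have hg : s ^ holderExp β ≤ 2 * s ^ (-σ) := by
    have : s ^ holderExp β = s * s ^ (-σ) := by
      rw [mul_comm, ← Real.rpow_add_one hs.ne']; congr 1; simp only [holderExp, σ]; ring
    rw [this]; gcongr
  have h2 : (s ^ (-σ) + s ^ holderExp β) / holderExp β ≤ 3 * s ^ (-σ) / holderExp β := by
    gcongr; linarith
  have h3 := mul_le_mul_of_nonneg_left hone (abs_nonneg (profile β 1))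
  refine h.trans ((add_le_add (by simpa using h3) h2).trans_eq ?_)
  unfold profileConst; ring

theorem integrable_layerKernel {β : ℝ} (h0 : 0 ≤ β) (h1 : β < 1) : Integrable (layerKernel β) := by
  refine ((integrable_norm_one_sub_unitVec (s := (1 + β) / 2) (by linarith)
    (by linarith)).const_mul (profileConst β)).mono' (measurable_layerKernel β).aestronglyMeasurable ?_
  filter_upwards [ae_ne_angles 0] with η hη
  exact abs_profile_le_rpow h0 h1 (one_sub_unitVec_pos hη) (norm_one_sub_unitVec_le η)

/-- The single layer potential of the unit circle. -/
def layerPot (β : ℝ) (w : Angles → ℝ) (α : Angles) : ℝ := ∫ η, layerKernel β (α - η) * w η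

theorem integrable_layerKernel_sub {β : ℝ} (h0 : 0 ≤ β) (h1 : β < 1) (α : Angles) :
    Integrable fun η => layerKernel β (α - η) :=
  (integrable_layerKernel h0 h1).comp_sub_left α

theorem integrable_layerPot {β : ℝ} (h0 : 0 ≤ β) (h1 : β < 1) (α : Angles) {w : Angles → ℝ}
    (hw : Continuous w) : Integrable fun η => layerKernel β (α - η) * w η := by
  obtain ⟨M, hM⟩ := isCompact_univ.exists_bound_of_continuousOn hw.continuousOn
  exact (integrable_layerKernel_sub h0 h1 α).mul_bdd (c := M) hw.aestronglyMeasurable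
    (Eventually.of_forall fun η => hM η (mem_univ _))

theorem layerPot_comm (β : ℝ) (w : Angles → ℝ) (α : Angles) :
    layerPot β w α = ∫ η, layerKernel β η * w (α - η) := by
  unfold layerPot
  rw [← integral_sub_left_eq_self (fun η => layerKernel β (α - η) * w η) volume α]
  simp

theorem continuous_layerPot {β : ℝ} (h0 : 0 ≤ β) (h1 : β < 1) {w : Angles → ℝ}
    (hw : Continuous w) : Continuous (layerPot β w) := by
  obtain ⟨M, hM⟩ := isCompact_univ.exists_bound_of_continuousOn hw.continuousOn
  rw [show layerPot β w = fun α => ∫ η, layerKernel β η * w (α - η) from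
    funext (layerPot_comm β w)]
  refine continuous_of_dominated (F := fun α η => layerKernel β η * w (α - η)) (bound := fun η => ‖layerKernel β η‖ * M) (fun α => ?_) (fun α => ?_)
    ((integrable_layerKernel h0 h1).norm.mul_const M) (Eventually.of_forall fun η => by fun_prop)
  · exact ((measurable_layerKernel β).mul (hw.comp (by fun_prop)).measurable).aestronglyMeasurable
  · refine Eventually.of_forall fun η => ?_
    rw [norm_mul]
    gcongr
    exact hM _ (mem_univ _)

theorem layerPot_sub {β : ℝ} (h0 : 0 ≤ β) (h1 : β < 1) {w w' : Angles → ℝ}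
    (hw : Continuous w) (hw' : Continuous w') (α : Angles) :
    layerPot β (fun η => w η - w' η) α = layerPot β w α - layerPot β w' α := by
  simp only [layerPot, mul_sub]
  exact integral_sub (integrable_layerPot h0 h1 α hw) (integrable_layerPot h0 h1 α hw')

theorem layerPot_const_mul (β : ℝ) (w : Angles → ℝ) (c : ℝ) (α : Angles) :
    layerPot β (fun η => c * w η) α = c * layerPot β w α := by
  simp only [layerPot, mul_left_comm, integral_const_mul]

theorem abs_layerPot_le {β : ℝ} (h0 : 0 ≤ β) (h1 : β < 1) {w : Angles → ℝ} {K : ℝ}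
    (hK : ∀ η, |w η| ≤ K) (α : Angles) :
    |layerPot β w α| ≤ (∫ η, |layerKernel β η|) * K := by
  rw [layerPot_comm, ← integral_mul_const, ← Real.norm_eq_abs]
  refine norm_integral_le_of_norm_le ((integrable_layerKernel h0 h1).abs.mul_const K)
    (Eventually.of_forall fun η => ?_)
  rw [norm_mul, Real.norm_eq_abs, Real.norm_eq_abs]
  gcongr
  exact hK _

/-! ### Potentials of star-shaped patches -/

/-- The potential of a star-shaped patch. -/
def patchPot (β : ℝ) (u : C(Angles, ℝ)) : ℂ → ℝ :=
  pot β ((starPatch u).indicator fun _ => 1)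

theorem isBounded_starPatch (u : C(Angles, ℝ)) : Bornology.IsBounded (starPatch u) :=
  Metric.isBounded_ball.subset (starPatch_subset_ball fun α => u.norm_coe_le_norm α)

theorem isBddDensity_starPatch (u : C(Angles, ℝ)) :
    IsBddDensity ((starPatch u).indicator fun _ => (1 : ℝ)) :=
  isBddDensity_indicator (measurableSet_starPatch u) (isBounded_starPatch u)

theorem pot_indicator (β : ℝ) {A : Set ℂ} (hA : MeasurableSet A) (x : ℂ) :
    pot β (A.indicator fun _ => 1) x = ∫ y in A, profile β ‖x - y‖ := by
  rw [pot, ← integral_indicator hA]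
  congr 1
  ext y
  by_cases hy : y ∈ A <;> simp [hy]

theorem integrableOn_profile {β : ℝ} (h0 : 0 ≤ β) (h1 : β < 1) {A : Set ℂ} (hA : MeasurableSet A)
    (hb : Bornology.IsBounded A) (x : ℂ) : IntegrableOn (fun y => profile β ‖x - y‖) A := by
  rw [← integrable_indicator_iff hA]
  refine (pot_integrable h0 h1 (isBddDensity_indicator hA hb) x).congr
    (Eventually.of_forall fun y => ?_)
  by_cases hy : y ∈ A <;> simp [hy]

/-- From |ρa − rb|² = (ρ − r)² + ρr|a − b|² and ρr ≥ 1/4. -/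
theorem half_norm_sub_le {a b : ℂ} (ha : ‖a‖ = 1) (hb : ‖b‖ = 1) {ρ r : ℝ} (hρ : 1 / 2 ≤ ρ)
    (hr : 1 / 2 ≤ r) : ‖a - b‖ / 2 ≤ ‖ρ * a - r * b‖ := by
  have h1 : a.re * a.re + a.im * a.im = 1 := by
    rw [← Complex.normSq_apply, Complex.normSq_eq_norm_sq, ha, one_pow]
  have h2 : b.re * b.re + b.im * b.im = 1 := by
    rw [← Complex.normSq_apply, Complex.normSq_eq_norm_sq, hb, one_pow]
  have e1 : ‖a - b‖ ^ 2 = 2 - 2 * (a.re * b.re + a.im * b.im) := by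
    rw [← Complex.normSq_eq_norm_sq, Complex.normSq_apply]
    simp only [Complex.sub_re, Complex.sub_im]
    linarith
  have e2 : ‖ρ * a - r * b‖ ^ 2 = (ρ - r) ^ 2 + ρ * r * ‖a - b‖ ^ 2 := by
    rw [e1, ← Complex.normSq_eq_norm_sq, Complex.normSq_apply]
    simp only [Complex.sub_re, Complex.sub_im, Complex.re_ofReal_mul, Complex.im_ofReal_mul]
    linear_combination ρ ^ 2 * h1 + r ^ 2 * h2
  have h3 : 1 / 4 ≤ ρ * r := by nlinarith
  refine le_of_sq_le_sq ?_ (norm_nonneg _)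
  rw [e2, div_pow]
  nlinarith [sq_nonneg (ρ - r), sq_nonneg ‖a - b‖]

/-- A constant for the estimates below. -/
def layerConst (β : ℝ) : ℝ := 8 / holderExp β + profileConst β

theorem layerConst_nonneg {β : ℝ} (h1 : β < 1) : 0 ≤ layerConst β := by
  have := holderExp_pos h1
  have := profileConst_nonneg h1
  unfold layerConst; positivity

/-- Moving the two points radially by at most δ changes their distance s by at most 2δ and keeps it
above s/2. The Hölder bound for the profile, with exponent (1 − β)/2, turns this into a small factor
times s^(-(1+β)/2), which is integrable on the circle. The error of the factor r is absorbed by the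
size of the profile. -/
theorem abs_profile_sub_layerKernel_le {β δ p r : ℝ} (h0 : 0 ≤ β) (h1 : β < 1) (hδ : δ ≤ 1 / 4)
    (hp : |p| ≤ δ) (hr : |r - 1| ≤ δ) {α η : Angles} (hη : η ≠ α) :
    |r * profile β ‖(1 + p : ℝ) * unitVec α - r * unitVec η‖ - layerKernel β (α - η)| ≤
      layerConst β * δ ^ holderExp β * ‖1 - unitVec (α - η)‖ ^ (-((1 + β) / 2)) := by
  have hδ0 : 0 ≤ δ := (abs_nonneg _).trans hp
  have hγ := holderExp_pos h1
  have hγ2 := holderExp_le h0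
  obtain ⟨hp1, hp2⟩ := abs_le.1 hp
  obtain ⟨hr1, hr2⟩ := abs_le.1 hr
  set s := ‖1 - unitVec (α - η)‖ with hs
  set d := ‖((1 + p : ℝ) : ℂ) * unitVec α - r * unitVec η‖ with hd
  have hs0 : 0 < s := one_sub_unitVec_pos (sub_ne_zero.2 hη.symm)
  have hse : s = ‖unitVec α - unitVec η‖ := (norm_unitVec_sub α η).symm
  have hds : s / 2 ≤ d := by
    rw [hse]
    exact half_norm_sub_le (norm_unitVec α) (norm_unitVec η) (by linarith) (by linarith)
  have hd0 : 0 < d := by linarith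
  have hdiff : |d - s| ≤ 2 * δ := by
    rw [hse, hd]
    refine (abs_norm_sub_norm_le _ _).trans ?_
    have : ((1 + p : ℝ) : ℂ) * unitVec α - r * unitVec η - (unitVec α - unitVec η) =
        (p : ℂ) * unitVec α - ((r - 1 : ℝ) : ℂ) * unitVec η := by push_cast; ring
    rw [this]
    refine (norm_sub_le _ _).trans ?_
    rw [norm_mul, norm_mul, norm_unitVec, norm_unitVec, Complex.norm_real, Complex.norm_real,
      Real.norm_eq_abs, Real.norm_eq_abs]
    linarith
  have k1 := abs_profile_sub_le_rpow h0 hγ (by linarith) hd0 hs0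
  have e1 : -β - holderExp β = -((1 + β) / 2) := by unfold holderExp; ring
  rw [e1] at k1
  set σ := (1 + β) / 2 with hσ
  have hsp := Real.rpow_pos_of_pos hs0 (-σ)
  have hδp := Real.rpow_nonneg hδ0 (holderExp β)
  have k2 : (min d s) ^ (-σ) ≤ 2 * s ^ (-σ) := by
    have hm : s / 2 ≤ min d s := le_min hds (by linarith)
    calc (min d s) ^ (-σ) ≤ (s / 2) ^ (-σ) :=
          Real.rpow_le_rpow_of_nonpos (by positivity) hm (by linarith)
      _ = 2 ^ σ * s ^ (-σ) := by
          rw [Real.div_rpow hs0.le zero_le_two, Real.rpow_neg zero_le_two, div_inv_eq_mul, mul_comm]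
      _ ≤ 2 ^ (1 : ℝ) * s ^ (-σ) := by
          gcongr
          · exact one_le_two
          · linarith
      _ = 2 * s ^ (-σ) := by rw [Real.rpow_one]
  have k3 : |d - s| ^ holderExp β ≤ 2 * δ ^ holderExp β := by
    calc |d - s| ^ holderExp β ≤ (2 * δ) ^ holderExp β :=
          Real.rpow_le_rpow (abs_nonneg _) hdiff hγ.le
      _ = 2 ^ holderExp β * δ ^ holderExp β := Real.mul_rpow zero_le_two hδ0
      _ ≤ 2 ^ (1 : ℝ) * δ ^ holderExp β := by
          gcongr
          · exact one_le_two
          · linarith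
      _ = 2 * δ ^ holderExp β := by rw [Real.rpow_one]
  have k4 : |profile β d - profile β s| ≤
      4 / holderExp β * (δ ^ holderExp β * s ^ (-σ)) := by
    refine k1.trans ?_
    calc (min d s) ^ (-σ) * |d - s| ^ holderExp β / holderExp β
        ≤ (2 * s ^ (-σ)) * (2 * δ ^ holderExp β) / holderExp β := by gcongr
      _ = _ := by ring
  have k5 : |profile β s| ≤ profileConst β * s ^ (-σ) :=
    abs_profile_le_rpow h0 h1 hs0 (norm_one_sub_unitVec_le _)
  have k6 : δ ≤ δ ^ holderExp β := by
    rcases hδ0.eq_or_lt with h | h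
    · rw [← h, Real.zero_rpow hγ.ne']
    · nth_rewrite 1 [← Real.rpow_one δ]
      exact Real.rpow_le_rpow_of_exponent_ge h (by linarith) (by linarith)
  have hsplit : r * profile β d - layerKernel β (α - η) =
      r * (profile β d - profile β s) + (r - 1) * profile β s := by
    rw [layerKernel]; ring
  rw [hsplit]
  refine (abs_add_le _ _).trans ?_
  rw [abs_mul, abs_mul, abs_of_nonneg (by linarith : 0 ≤ r)]
  have hc := profileConst_nonneg h1
  calc r * |profile β d - profile β s| + |r - 1| * |profile β s|
      ≤ 2 * (4 / holderExp β * (δ ^ holderExp β * s ^ (-σ))) +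
        δ ^ holderExp β * (profileConst β * s ^ (-σ)) := by
        gcongr
        · linarith
        · exact hr.trans k6
    _ = _ := by unfold layerConst; ring

/-- First variation of the potential with respect to the shape of the patch. -/
theorem patchPot_sub_layerPot_le {β δ K p : ℝ} (h0 : 0 ≤ β) (h1 : β < 1) (hδ : δ ≤ 1 / 4)
    {u w : C(Angles, ℝ)} (hu : ∀ α, |u α| ≤ δ) (hw : ∀ α, |w α| ≤ δ)
    (hK : ∀ α, |u α - w α| ≤ K) (hp : |p| ≤ δ) (α : Angles) :
    |patchPot β u ((1 + p : ℝ) * unitVec α) - patchPot β w ((1 + p : ℝ) * unitVec α) -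
      layerPot β (fun η => u η - w η) α| ≤
      layerConst β * (∫ η : Angles, ‖1 - unitVec η‖ ^ (-((1 + β) / 2))) * δ ^ holderExp β * K := by
  set z : ℂ := ((1 + p : ℝ) : ℂ) * unitVec α
  set σ := (1 + β) / 2 with hσ
  have hball : IntegrableOn (fun y => profile β ‖z - y‖) (Metric.ball 0 (1 + δ)) :=
    integrableOn_profile h0 h1 measurableSet_ball Metric.isBounded_ball z
  obtain ⟨hi, he⟩ := integral_starPatch_sub (by linarith) hu hw hball
  have hδ0 : 0 ≤ δ := (abs_nonneg _).trans hp
  rw [patchPot, patchPot, pot_indicator β (measurableSet_starPatch u),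
    pot_indicator β (measurableSet_starPatch w), he, layerPot,
    ← integral_sub hi (integrable_layerPot h0 h1 α (by fun_prop))]
  have hint := (integrable_norm_one_sub_unitVec (s := σ) (by linarith) (by linarith)).comp_sub_left α
  have hle := norm_integral_le_of_norm_le (f := fun η : Angles =>
    (∫ r in (1 + w η)..(1 + u η), r • profile β ‖z - r * unitVec η‖) -
      layerKernel β (α - η) * (u η - w η))
    (hint.const_mul (layerConst β * δ ^ holderExp β * K)) ?_
  · refine hle.trans_eq ?_
    rw [integral_const_mul,
      integral_sub_left_eq_self (fun η => ‖1 - unitVec η‖ ^ (-σ)) volume α]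
    ring
  filter_upwards [ae_ne_angles α,
    ae_intervalIntegrable_polar (by linarith : (0 : ℝ) ≤ 1 + δ) hball] with η hη hηi
  have hu' := abs_le.1 (hu η)
  have hw' := abs_le.1 (hw η)
  have hsub : IntervalIntegrable (fun r : ℝ => r • profile β ‖z - r * unitVec η‖) volume
      (1 + w η) (1 + u η) := by
    refine hηi.mono_set ?_
    rw [uIcc_of_le (by linarith : (0 : ℝ) ≤ 1 + δ)]
    exact uIcc_subset_Icc ⟨by linarith, by linarith⟩ ⟨by linarith, by linarith⟩
  -- The main term is written as an integral over the same radial interval; the length of this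
  -- interval then supplies the factor K.
  have hconst : layerKernel β (α - η) * (u η - w η) =
      ∫ _ in (1 + w η)..(1 + u η), layerKernel β (α - η) := by
    rw [intervalIntegral.integral_const, smul_eq_mul]; ring
  rw [hconst, ← intervalIntegral.integral_sub hsub intervalIntegrable_const]
  refine (intervalIntegral.norm_integral_le_of_norm_le_const (C := layerConst β *
    δ ^ holderExp β * ‖1 - unitVec (α - η)‖ ^ (-σ)) fun r hr => ?_).trans ?_
  · rw [smul_eq_mul, Real.norm_eq_abs]
    refine abs_profile_sub_layerKernel_le h0 h1 hδ hp ?_ hη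
    have := uIoc_subset_uIcc hr
    have h2 := (uIcc_subset_Icc (a₁ := 1 + w η) (b₁ := 1 + u η) (a₂ := 1 - δ) (b₂ := 1 + δ)
      ⟨by linarith, by linarith⟩ ⟨by linarith, by linarith⟩) this
    rw [abs_le]
    constructor <;> linarith [h2.1, h2.2]
  · have hlc := layerConst_nonneg h1
    have h3 : |1 + u η - (1 + w η)| ≤ K := by
      rw [show 1 + u η - (1 + w η) = u η - w η by ring]; exact hK η
    calc _ ≤ layerConst β * δ ^ holderExp β * ‖1 - unitVec (α - η)‖ ^ (-σ) * K := by gcongr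
      _ = _ := by ring

/-! ### The difference of two nearby star-shaped patches -/

theorem measureReal_univ_angles : volume.real (univ : Set Angles) = 2 * Real.pi := by
  rw [measureReal_def, AddCircle.measure_univ, ENNReal.toReal_ofReal (by positivity)]

theorem starPatch_mono {u w : C(Angles, ℝ)} (h : ∀ α, u α ≤ w α) : starPatch u ⊆ starPatch w :=
  fun z hz => lt_of_lt_of_le hz (by linarith [h (angle z)] : 1 + u (angle z) ≤ 1 + w (angle z))

theorem measureReal_starPatch_diff_le {u w : C(Angles, ℝ)} {δ K : ℝ} (hδ : δ ≤ 1 / 4)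
    (hu : ∀ α, |u α| ≤ δ) (hw : ∀ α, |w α| ≤ δ) (h : ∀ α, w α ≤ u α) (hK : ∀ α, u α - w α ≤ K) :
    volume.real (starPatch u \ starPatch w) ≤ 4 * Real.pi * K := by
  have hfin : ∀ u : C(Angles, ℝ), volume (starPatch u) ≠ ⊤ := fun u =>
    (isBounded_starPatch u).measure_lt_top.ne
  have hK0 : 0 ≤ K := (sub_nonneg.2 (h 0)).trans (hK 0)
  obtain ⟨-, he⟩ := integral_starPatch_sub (f := fun _ => (1 : ℝ)) (by linarith) hu hw
    (integrableOn_const measure_ball_lt_top.ne)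
  rw [setIntegral_const, setIntegral_const, smul_eq_mul, smul_eq_mul, mul_one, mul_one] at he
  rw [measureReal_sdiff (starPatch_mono h) (measurableSet_starPatch w) (hfin _), he]
  refine (le_abs_self _).trans ?_
  have hb : ∀ α : Angles, ‖∫ r in (1 + w α)..(1 + u α), r • (1 : ℝ)‖ ≤ 2 * K := fun α => by
    refine (intervalIntegral.norm_integral_le_of_norm_le_const (C := 2) fun r hr => ?_).trans ?_
    · rw [uIoc_of_le (by linarith [h α])] at hr
      have h1 := abs_le.1 (hu α)
      have h2 := abs_le.1 (hw α)
      rw [smul_eq_mul, mul_one, Real.norm_eq_abs, abs_le]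
      constructor <;> linarith [hr.1, hr.2]
    · rw [abs_of_nonneg (by linarith [h α])]
      linarith [hK α]
  refine (norm_integral_le_of_norm_le_const (Eventually.of_forall hb)).trans_eq ?_
  rw [measureReal_univ_angles]
  ring

/-- Two nearby star-shaped patches differ by a set of small measure. -/
theorem exists_starPatch_diff {u w : C(Angles, ℝ)} {δ K : ℝ} (hδ : δ ≤ 1 / 4)
    (hu : ∀ α, |u α| ≤ δ) (hw : ∀ α, |w α| ≤ δ) (hK : ∀ α, |u α - w α| ≤ K) :
    ∃ A ⊆ Metric.ball (0 : ℂ) (1 + δ), MeasurableSet A ∧ volume.real A ≤ 4 * Real.pi * K ∧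
      ∀ y, |(starPatch u).indicator (fun _ => (1 : ℝ)) y -
        (starPatch w).indicator (fun _ => (1 : ℝ)) y| ≤ A.indicator (fun _ => 1) y := by
  have h1 : ∀ α, |(u ⊔ w) α| ≤ δ := fun α => by
    rw [ContinuousMap.sup_apply]
    exact abs_max_le_max_abs_abs.trans (max_le (hu α) (hw α))
  have h2 : ∀ α, |(u ⊓ w) α| ≤ δ := fun α => by
    rw [ContinuousMap.inf_apply]
    exact abs_min_le_max_abs_abs.trans (max_le (hu α) (hw α))
  -- The layer between the pointwise minimum and maximum of the boundaries; outside it the two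
  -- indicators agree.
  refine ⟨starPatch (u ⊔ w) \ starPatch (u ⊓ w),
    sdiff_subset.trans (starPatch_subset_ball h1),
    (measurableSet_starPatch _).diff (measurableSet_starPatch _),
    measureReal_starPatch_diff_le hδ h1 h2 (fun α => ?_) (fun α => ?_), fun y => ?_⟩
  · simp
  · rw [ContinuousMap.sup_apply, ContinuousMap.inf_apply, max_sub_min_eq_abs]
    rw [abs_sub_comm]
    exact hK α
  · have m1 := starPatch_mono (u := u) (w := u ⊔ w) fun α => by simp
    have m2 := starPatch_mono (u := w) (w := u ⊔ w) fun α => by simp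
    by_cases hyu : y ∈ starPatch u <;> by_cases hyw : y ∈ starPatch w
    · simp only [indicator_of_mem hyu, indicator_of_mem hyw, sub_self, abs_zero]
      exact indicator_nonneg (fun _ _ => zero_le_one) _
    · have hn : y ∉ starPatch (u ⊓ w) := fun hy =>
        hyw (starPatch_mono (fun α => by simp) hy)
      rw [indicator_of_mem hyu, indicator_of_notMem hyw, 
        indicator_of_mem (show y ∈ starPatch (u ⊔ w) \ starPatch (u ⊓ w) from ⟨m1 hyu, hn⟩)]
      simp
    · have hn : y ∉ starPatch (u ⊓ w) := fun hy =>
        hyu (starPatch_mono (fun α => by simp) hy)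
      rw [indicator_of_notMem hyu, indicator_of_mem hyw, 
        indicator_of_mem (show y ∈ starPatch (u ⊔ w) \ starPatch (u ⊓ w) from ⟨m2 hyw, hn⟩)]
      simp
    · simp only [indicator_of_notMem hyu, indicator_of_notMem hyw, sub_self, abs_zero]
      exact indicator_nonneg (fun _ _ => zero_le_one) _

theorem patchPot_sub_lipschitz {β : ℝ} (h0 : 0 ≤ β) (h1 : β < 1) {u w : C(Angles, ℝ)} {δ K : ℝ}
    (hδ : δ ≤ 1 / 4) (hu : ∀ α, |u α| ≤ δ) (hw : ∀ α, |w α| ≤ δ) (hK : ∀ α, |u α - w α| ≤ K)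
    (x x' : ℂ) :
    |(patchPot β u x - patchPot β w x) - (patchPot β u x' - patchPot β w x')| ≤
      2 * (rieszMass (1 + β) + 1) * (4 * Real.pi * K) ^ holderExp β * ‖x - x'‖ := by
  obtain ⟨A, hAb, hA, hAv, hθ⟩ := exists_starPatch_diff hδ hu hw hK
  have hb := (isBddDensity_starPatch u).sub (isBddDensity_starPatch w)
  have hl := pot_lipschitz h0 h1 hb hA
    ((measure_mono hAb).trans_lt measure_ball_lt_top).ne hθ x x'
  rw [pot_sub h0 h1 (isBddDensity_starPatch u) (isBddDensity_starPatch w),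
    pot_sub h0 h1 (isBddDensity_starPatch u) (isBddDensity_starPatch w)] at hl
  refine hl.trans ?_
  have := rieszMass_nonneg (1 + β)
  have hγ := holderExp_pos h1
  unfold holderExp at hγ ⊢
  gcongr

/-! ### The potential of the disc near its boundary -/

theorem starPatch_zero : starPatch 0 = Metric.ball 0 1 := by
  ext z
  simp [starPatch]

theorem contDiff_patchPot {β : ℝ} (h0 : 0 ≤ β) (h1 : β < 1) (u : C(Angles, ℝ)) :
    ContDiff ℝ 1 (patchPot β u) := contDiff_pot h0 h1 (isBddDensity_starPatch u)

theorem patchPot_zero_radial (β ρ : ℝ) (α : Angles) :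
    patchPot β 0 (ρ * unitVec α) = patchPot β 0 ρ := by
  rw [mul_comm (ρ : ℂ), patchPot, unitVec]
  refine (pot_rotation β _ (AddCircle.toCircle α) ρ).symm.trans ?_
  congr 1
  ext y
  simp only [starPatch_zero]
  by_cases hy : y ∈ Metric.ball (0 : ℂ) 1
  · rw [indicator_of_mem hy, indicator_of_mem]
    rwa [mem_ball_zero_iff, norm_mul, Circle.norm_coe, one_mul, ← mem_ball_zero_iff]
  · rw [indicator_of_notMem hy, indicator_of_notMem]
    rwa [mem_ball_zero_iff, norm_mul, Circle.norm_coe, one_mul, ← mem_ball_zero_iff]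

/-- The boundary of the unit disc centred at `-h`, in polar coordinates about the origin. -/
def discShift (h : ℝ) : C(Angles, ℝ) where
  toFun α := -h * (unitVec α).re + √(1 - h ^ 2 * (unitVec α).im ^ 2) - 1
  continuous_toFun := by
    have := continuous_unitVec
    fun_prop

theorem sq_re_add_sq_im_unitVec (α : Angles) : (unitVec α).re ^ 2 + (unitVec α).im ^ 2 = 1 := by
  rw [sq, sq, ← Complex.normSq_apply, Complex.normSq_eq_norm_sq, norm_unitVec, one_pow]

/-- In polar coordinates |z + h|² = (r + h cos α)² + h² sin² α. -/
theorem starPatch_discShift {h : ℝ} (hh : |h| < 1) :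
    starPatch (discShift h) = Metric.ball (-h : ℂ) 1 := by
  ext z
  set α := angle z
  set r := ‖z‖ with hr
  set c := (unitVec α).re with hc
  set s := (unitVec α).im with hs
  have hcs : c ^ 2 + s ^ 2 = 1 := sq_re_add_sq_im_unitVec α
  have hr0 : 0 ≤ r := norm_nonneg z
  have hz : z = (r : ℂ) * unitVec α := (norm_mul_unitVec z).symm
  have hh2 : h ^ 2 < 1 := by rw [← sq_abs]; nlinarith [abs_nonneg h]
  have e1 : z ∈ Metric.ball (-h : ℂ) 1 ↔ (r + h * c) ^ 2 < 1 - h ^ 2 * s ^ 2 := by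
    rw [Metric.mem_ball, dist_eq_norm, sub_neg_eq_add, ← sq_lt_one_iff₀ (norm_nonneg _),
      ← Complex.normSq_eq_norm_sq, Complex.normSq_apply, Complex.add_re, Complex.add_im, hz,
      Complex.re_ofReal_mul, Complex.im_ofReal_mul, Complex.ofReal_re, Complex.ofReal_im,
      ← hc, ← hs]
    have e : (r * c + h) * (r * c + h) + (r * s + 0) * (r * s + 0) =
        (r + h * c) ^ 2 + h ^ 2 * s ^ 2 := by linear_combination (r ^ 2 - h ^ 2) * hcs
    constructor <;> intro hlt <;> linarith
  have e2 : z ∈ starPatch (discShift h) ↔ r + h * c < √(1 - h ^ 2 * s ^ 2) := by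
    change r < 1 + (-h * c + √(1 - h ^ 2 * s ^ 2) - 1) ↔ _
    constructor <;> intro hlt <;> linarith
  rw [e1, e2]
  rcases le_or_gt 0 (r + h * c) with hp | hp
  · rw [Real.lt_sqrt hp]
  · have h1 : (r + h * c) ^ 2 < 1 - h ^ 2 * s ^ 2 := by nlinarith
    exact ⟨fun _ => h1, fun _ => hp.trans_le (Real.sqrt_nonneg _)⟩

theorem discShift_apply (h : ℝ) (α : Angles) :
    discShift h α = -h * (unitVec α).re + √(1 - h ^ 2 * (unitVec α).im ^ 2) - 1 := rfl

theorem abs_discShift_add_le {h : ℝ} (hh : |h| < 1) (α : Angles) :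
    |discShift h α + h * (unitVec α).re| ≤ h ^ 2 := by
  have hcs := sq_re_add_sq_im_unitVec α
  have hh2 : h ^ 2 < 1 := by rw [← sq_abs]; nlinarith [abs_nonneg h]
  set x := h ^ 2 * (unitVec α).im ^ 2 with hx
  have hx0 : 0 ≤ x := by positivity
  have hxh : x ≤ h ^ 2 := by
    rw [hx]; exact mul_le_of_le_one_right (sq_nonneg h) (by nlinarith [sq_nonneg (unitVec α).re])
  have h1 : √(1 - x) ≤ 1 := Real.sqrt_le_one.2 (by linarith)
  have h2 : 1 - x ≤ √(1 - x) := Real.le_sqrt_of_sq_le (by nlinarith)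
  rw [discShift_apply, abs_le]
  constructor <;> linarith

theorem patchPot_discShift (β : ℝ) {h : ℝ} (hh : |h| < 1) :
    patchPot β (discShift h) 1 = patchPot β 0 (1 + h : ℝ) := by
  rw [patchPot, patchPot, starPatch_discShift hh, starPatch_zero, pot, pot,
    ← integral_add_right_eq_self (fun y => profile β ‖((1 + h : ℝ) : ℂ) - y‖ *
      (Metric.ball (0 : ℂ) 1).indicator (fun _ => (1 : ℝ)) y) (h : ℂ)]
  congr 1
  ext y
  congr 1
  · congr 2; push_cast; ring
  · by_cases hy : y ∈ Metric.ball (-h : ℂ) 1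
    · rw [indicator_of_mem hy, indicator_of_mem]
      simpa [dist_eq_norm] using hy
    · rw [indicator_of_notMem hy, indicator_of_notMem]
      simpa [dist_eq_norm] using hy

/-- The first Fourier multiplier of the single layer potential of the unit circle. -/
def layerEig (β : ℝ) : ℝ := ∫ η, layerKernel β η * (unitVec η).re

theorem continuous_re_unitVec : Continuous fun α : Angles => (unitVec α).re :=
  Complex.continuous_re.comp continuous_unitVec

theorem continuous_im_unitVec : Continuous fun α : Angles => (unitVec α).im :=
  Complex.continuous_im.comp continuous_unitVec

/-- Moving the point outwards by h amounts to moving the disc by −h. The boundary of the shifted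
disc is −h cos α + O(h²), and the first variation of the potential at the point 1 is the single
layer potential of −h cos, that is −h times the first multiplier. The slope is thus identified
without evaluating any integral, and it balances the first mode exactly in the linearized equation.
-/
theorem hasDerivAt_patchPot_zero {β : ℝ} (h0 : 0 ≤ β) (h1 : β < 1) :
    HasDerivAt (fun ρ : ℝ => patchPot β 0 ρ) (-layerEig β) 1 := by
  have hγ := holderExp_pos h1
  set L := ∫ η, |layerKernel β η|
  set C := layerConst β * (∫ η : Angles, ‖1 - unitVec η‖ ^ (-((1 + β) / 2)))
  have hbound : ∀ h : ℝ, |h| < 1 / 8 →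
      ‖patchPot β 0 (1 + h : ℝ) - patchPot β 0 (1 : ℝ) - h • (-layerEig β)‖ ≤
        (C * (2 * |h|) ^ holderExp β * 2 + L * |h|) * ‖h‖ := fun h hh => by
    have hh1 : |h| < 1 := by linarith
    have hsq : h ^ 2 = |h| * |h| := by rw [← sq, sq_abs]
    have hb : ∀ α, |discShift h α| ≤ 2 * |h| := fun α => by
      have k1 := abs_discShift_add_le hh1 α
      have k2 : |h * (unitVec α).re| ≤ |h| := by
        rw [abs_mul]
        refine mul_le_of_le_one_right (abs_nonneg h) ?_
        exact (Complex.abs_re_le_norm _).trans_eq (norm_unitVec α)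
      have k3 := abs_sub (discShift h α + h * (unitVec α).re) (h * (unitVec α).re)
      rw [add_sub_cancel_right] at k3
      nlinarith [abs_nonneg h]
    have k4 := patchPot_sub_layerPot_le (β := β) (δ := 2 * |h|) (K := 2 * |h|) (p := 0) h0 h1
      (by linarith) hb (w := 0) (fun α => by simp) (fun α => by simpa using hb α) (by simp) 0
    simp only [add_zero, Complex.ofReal_one, unitVec_zero, mul_one, ContinuousMap.zero_apply,
      sub_zero] at k4
    rw [patchPot_discShift β hh1] at k4
    have k5 := abs_layerPot_le h0 h1 (w := fun η => discShift h η - (-h) * (unitVec η).re)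
      (K := h ^ 2) (fun η => by
        rw [neg_mul, sub_neg_eq_add]; exact abs_discShift_add_le hh1 η) 0
    rw [layerPot_sub h0 h1 (w' := fun η => -h * (unitVec η).re) (discShift h).continuous
      (continuous_const.mul continuous_re_unitVec), layerPot_const_mul] at k5
    have k6 : layerPot β (fun η => (unitVec η).re) 0 = layerEig β := by
      simp only [layerPot, layerEig, zero_sub, layerKernel_neg]
    rw [k6] at k5
    rw [Real.norm_eq_abs, Real.norm_eq_abs, smul_eq_mul]
    have e : patchPot β 0 (1 + h : ℝ) - patchPot β 0 (1 : ℝ) - h * (-layerEig β) =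
        (patchPot β 0 (1 + h : ℝ) - patchPot β 0 1 - layerPot β (fun η => discShift h η) 0) +
        (layerPot β (fun η => discShift h η) 0 - -h * layerEig β) := by
      rw [Complex.ofReal_one]; ring
    rw [e]
    refine (abs_add_le _ _).trans ((add_le_add k4 k5).trans_eq ?_)
    rw [hsq]; ring
  rw [hasDerivAt_iff_isLittleO_nhds_zero, Asymptotics.isLittleO_iff]
  intro c hc
  have hlim : Tendsto (fun h : ℝ => C * (2 * |h|) ^ holderExp β * 2 + L * |h|) (𝓝 0) (𝓝 0) := by
    have hcont : Continuous fun h : ℝ => C * (2 * |h|) ^ holderExp β * 2 + L * |h| := by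
      have : Continuous fun h : ℝ => (2 * |h|) ^ holderExp β :=
        Continuous.rpow_const (by fun_prop) fun _ => Or.inr hγ.le
      fun_prop
    have := hcont.tendsto 0
    simpa [Real.zero_rpow hγ.ne'] using this
  have h8 : ∀ᶠ h : ℝ in 𝓝 0, |h| < 1 / 8 := by
    have := (continuous_abs.tendsto (0 : ℝ)).eventually_lt_const (u := 1 / 8) (by norm_num)
    exact this
  filter_upwards [hlim.eventually_lt_const hc, h8] with h k1 k2
  exact (hbound h k2).trans (by gcongr)

/-- The potential is C¹, so its derivative at radius 1 is a strict derivative; radial symmetry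
extends the estimate to all directions. -/
theorem exists_patchPot_zero_radial {β : ℝ} (h0 : 0 ≤ β) (h1 : β < 1) {c : ℝ} (hc : 0 < c) :
    ∃ δ > 0, ∀ ρ ρ' : ℝ, |ρ - 1| ≤ δ → |ρ' - 1| ≤ δ → ∀ α,
      |patchPot β 0 (ρ * unitVec α) - patchPot β 0 (ρ' * unitVec α) + layerEig β * (ρ - ρ')| ≤
        c * |ρ - ρ'| := by
  have hcd : ContDiff ℝ 1 fun ρ : ℝ => patchPot β 0 ρ :=
    (contDiff_patchPot h0 h1 0).comp Complex.ofRealCLM.contDiff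
  have hs := hcd.contDiffAt.hasStrictDerivAt' (hasDerivAt_patchPot_zero h0 h1) one_ne_zero
  have hs' := (hasStrictDerivAt_iff_hasStrictFDerivAt.1 hs).isLittleO
  rw [Asymptotics.isLittleO_iff] at hs'
  obtain ⟨δ, hδ, hb⟩ := Metric.eventually_nhds_iff.1 (hs' hc)
  refine ⟨δ / 2, by positivity, fun ρ ρ' hρ hρ' α => ?_⟩
  rw [patchPot_zero_radial, patchPot_zero_radial]
  have := @hb (ρ, ρ') (by
    rw [Prod.dist_eq, max_lt_iff, Real.dist_eq, Real.dist_eq]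
    constructor <;> linarith)
  simp only [ContinuousLinearMap.toSpanSingleton_apply, smul_eq_mul, Real.norm_eq_abs] at this
  convert this using 2
  ring

/-- Near the unit circle the potential of a nearly circular patch is nearly radial, with slope
`-layerEig β`. -/
theorem exists_patchPot_radial {β : ℝ} (h0 : 0 ≤ β) (h1 : β < 1) {c : ℝ} (hc : 0 < c) :
    ∃ δ > 0, δ ≤ 1 / 4 ∧ ∀ u : C(Angles, ℝ), (∀ α, |u α| ≤ δ) → ∀ ρ ρ' : ℝ, |ρ - 1| ≤ δ →
      |ρ' - 1| ≤ δ → ∀ α, |patchPot β u (ρ * unitVec α) - patchPot β u (ρ' * unitVec α) +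
        layerEig β * (ρ - ρ')| ≤ c * |ρ - ρ'| := by
  have hγ := holderExp_pos h1
  obtain ⟨δ₁, hδ₁, hb₁⟩ := exists_patchPot_zero_radial h0 h1 (half_pos hc)
  have hlim : ∀ᶠ δ in 𝓝[>] (0 : ℝ),
      2 * (rieszMass (1 + β) + 1) * (4 * Real.pi * δ) ^ holderExp β < c / 2 := by
    refine nhdsWithin_le_nhds ?_
    have hcont : Continuous fun δ : ℝ =>
        2 * (rieszMass (1 + β) + 1) * (4 * Real.pi * δ) ^ holderExp β := by
      have : Continuous fun δ : ℝ => (4 * Real.pi * δ) ^ holderExp β :=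
        Continuous.rpow_const (by fun_prop) fun _ => Or.inr hγ.le
      fun_prop
    have := hcont.tendsto 0
    simp only [mul_zero, Real.zero_rpow hγ.ne'] at this
    exact this.eventually_lt_const (half_pos hc)
  have hsmall : ∀ᶠ δ in 𝓝[>] (0 : ℝ), δ < min δ₁ (1 / 4) :=
    nhdsWithin_le_nhds (eventually_lt_nhds (by positivity))
  obtain ⟨δ, ⟨hδc, hδm⟩, hδ0⟩ := ((hlim.and hsmall).and self_mem_nhdsWithin).exists
  have hδ0 : 0 < δ := hδ0
  have hm := lt_min_iff.1 hδm
  refine ⟨δ, hδ0, hm.2.le, fun u hu ρ ρ' hρ hρ' α => ?_⟩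
  have k1 := hb₁ ρ ρ' (hρ.trans hm.1.le) (hρ'.trans hm.1.le) α
  have k2 := patchPot_sub_lipschitz h0 h1 hm.2.le hu (w := 0) (fun α => by simpa using hδ0.le)
    (K := δ) (fun α => by simpa using hu α) (ρ * unitVec α) (ρ' * unitVec α)
  rw [← sub_mul, norm_mul, norm_unitVec, mul_one, ← Complex.ofReal_sub, Complex.norm_real,
    Real.norm_eq_abs] at k2
  have k3 : 2 * (rieszMass (1 + β) + 1) * (4 * Real.pi * δ) ^ holderExp β * |ρ - ρ'| ≤
      c / 2 * |ρ - ρ'| := by gcongr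
  -- The disc carries the slope; the potential of the difference between patch and disc has
  -- Lipschitz constant O(δ^((1-β)/2)).
  have e : patchPot β u (ρ * unitVec α) - patchPot β u (ρ' * unitVec α) + layerEig β * (ρ - ρ') =
      (patchPot β u (ρ * unitVec α) - patchPot β 0 (ρ * unitVec α) -
        (patchPot β u (ρ' * unitVec α) - patchPot β 0 (ρ' * unitVec α))) +
      (patchPot β 0 (ρ * unitVec α) - patchPot β 0 (ρ' * unitVec α) +
        layerEig β * (ρ - ρ')) := by ring
  rw [e]
  refine (abs_add_le _ _).trans ?_
  linarith

/-- Strict differentiability, in the supremum norm, of the potential on the boundary of a nearly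
circular patch as a function of the boundary. -/
theorem exists_patchPot_boundary {β : ℝ} (h0 : 0 ≤ β) (h1 : β < 1) {c : ℝ} (hc : 0 < c) :
    ∃ δ > 0, δ ≤ 1 / 4 ∧ ∀ (u w : C(Angles, ℝ)) (K : ℝ), (∀ α, |u α| ≤ δ) → (∀ α, |w α| ≤ δ) →
      (∀ α, |u α - w α| ≤ K) → ∀ α,
      |patchPot β u ((1 + u α : ℝ) * unitVec α) - patchPot β w ((1 + w α : ℝ) * unitVec α) +
        layerEig β * (u α - w α) - layerPot β (fun η => u η - w η) α| ≤ c * K := by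
  have hγ := holderExp_pos h1
  obtain ⟨δ₁, hδ₁, hδ₁4, hb₁⟩ := exists_patchPot_radial h0 h1 (half_pos hc)
  set C := layerConst β * (∫ η : Angles, ‖1 - unitVec η‖ ^ (-((1 + β) / 2)))
  have hlim : ∀ᶠ δ in 𝓝[>] (0 : ℝ), C * δ ^ holderExp β < c / 2 := by
    refine nhdsWithin_le_nhds ?_
    have hcont : Continuous fun δ : ℝ => C * δ ^ holderExp β :=
      continuous_const.mul (continuous_id.rpow_const fun _ => Or.inr hγ.le)
    have := hcont.tendsto 0
    simp only [mul_zero, Real.zero_rpow hγ.ne'] at this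
    exact this.eventually_lt_const (half_pos hc)
  have hsmall : ∀ᶠ δ in 𝓝[>] (0 : ℝ), δ < δ₁ := nhdsWithin_le_nhds (eventually_lt_nhds hδ₁)
  obtain ⟨δ, ⟨hδc, hδm⟩, hδ0⟩ := ((hlim.and hsmall).and self_mem_nhdsWithin).exists
  have hδ0 : 0 < δ := hδ0
  refine ⟨δ, hδ0, by linarith, fun u w K hu hw hK α => ?_⟩
  have hK0 : 0 ≤ K := (abs_nonneg _).trans (hK 0)
  have k1 := hb₁ u (fun α => (hu α).trans hδm.le) (1 + u α) (1 + w α)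
    (by simpa using (hu α).trans hδm.le) (by simpa using (hw α).trans hδm.le) α
  have k2 := patchPot_sub_layerPot_le h0 h1 (by linarith) hu hw hK (hw α) α
  have k3 : C * δ ^ holderExp β * K ≤ c / 2 * K := by gcongr
  have k4 : c / 2 * |1 + u α - (1 + w α)| ≤ c / 2 * K := by
    gcongr
    rw [show 1 + u α - (1 + w α) = u α - w α by ring]; exact hK α
  -- Move first the evaluation point with the patch u kept fixed, then the patch with the point kept
  -- on the boundary of w.
  have e : patchPot β u ((1 + u α : ℝ) * unitVec α) - patchPot β w ((1 + w α : ℝ) * unitVec α) +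
      layerEig β * (u α - w α) - layerPot β (fun η => u η - w η) α =
      (patchPot β u ((1 + u α : ℝ) * unitVec α) - patchPot β u ((1 + w α : ℝ) * unitVec α) +
        layerEig β * (1 + u α - (1 + w α))) +
      (patchPot β u ((1 + w α : ℝ) * unitVec α) - patchPot β w ((1 + w α : ℝ) * unitVec α) -
        layerPot β (fun η => u η - w η) α) := by ring
  rw [e]
  refine (abs_add_le _ _).trans ?_
  linarith

/-! ### The spectral gap of the single layer potential -/

theorem unitVec_pi : unitVec (Real.pi : Angles) = -1 := by
  rw [unitVec_coe, Complex.exp_pi_mul_I]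

theorem integral_unitVec_re : ∫ η, (unitVec η).re = 0 := by
  have h := integral_add_right_eq_self (μ := (volume : Measure Angles))
    (fun η : Angles => (unitVec η).re) (Real.pi : Angles)
  simp only [unitVec_add, unitVec_pi, mul_neg, mul_one, Complex.neg_re, integral_neg] at h
  linarith

theorem integrable_of_continuous {f : Angles → ℝ} (hf : Continuous f) : Integrable f :=
  hf.integrable_of_hasCompactSupport (HasCompactSupport.of_compactSpace f)

theorem half_sq_norm_one_sub_unitVec (η : Angles) :
    ‖1 - unitVec η‖ ^ 2 / 2 = 1 - (unitVec η).re := by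
  rw [sq_norm_one_sub_unitVec]; ring

theorem rpow_eq_of_half_sq {s τ p : ℝ} (hs : 0 < s) (hτ : s ^ 2 / 2 = τ) :
    s ^ p = 2 ^ (p / 2) * τ ^ (p / 2) := by
  have hτ0 : 0 < τ := by rw [← hτ]; positivity
  rw [← Real.mul_rpow zero_le_two hτ0.le, ← hτ, mul_div_cancel₀ _ two_ne_zero, ← Real.rpow_natCast,
    ← Real.rpow_mul hs.le]
  congr 1
  push_cast
  ring

theorem log_eq_of_half_sq {s τ : ℝ} (hs : 0 < s) (hτ : s ^ 2 / 2 = τ) :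
    Real.log s = (Real.log 2 + Real.log τ) / 2 := by
  have hτ0 : 0 < τ := by rw [← hτ]; positivity
  rw [← Real.log_mul two_ne_zero hτ0.ne', ← hτ, mul_div_cancel₀ _ two_ne_zero, Real.log_pow]
  push_cast
  ring

/-- The value of the profile at distance `√2`. -/
def midProfile (β : ℝ) : ℝ := profile β √2

theorem midProfile_eq (β : ℝ) :
    midProfile β = if β = 0 then -(Real.log 2 / 2) else 2 ^ (-β / 2) / β := by
  unfold midProfile profile
  split_ifs with h
  · rw [Real.log_sqrt zero_le_two]
  · rw [Real.sqrt_eq_rpow, ← Real.rpow_mul zero_le_two]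
    congr 2
    ring

/-- The profile lies above its tangent at `√2`, as a function of the squared distance. -/
theorem exists_profile_tangent {β : ℝ} (h0 : 0 ≤ β) : ∃ b, ∀ s, 0 < s →
    midProfile β + b * (s ^ 2 / 2 - 1) ≤ profile β s := by
  -- The slope of the profile in τ = s²/2 is −s^(-2-β), taken at s = √2; the formula also covers β =
  -- 0.
  refine ⟨-(2 ^ (-β / 2) / 2), fun s hs => ?_⟩
  set τ := s ^ 2 / 2 with hτ
  have hτ0 : 0 < τ := by positivity
  have hlog := Real.log_le_sub_one_of_pos hτ0
  rw [midProfile_eq]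
  unfold profile
  by_cases h : β = 0
  · simp only [h, if_true, neg_zero, zero_div, Real.rpow_zero]
    rw [log_eq_of_half_sq hs hτ.symm]
    linarith
  · have hβ : 0 < β := lt_of_le_of_ne h0 (Ne.symm h)
    simp only [h, if_false]
    rw [rpow_eq_of_half_sq hs hτ.symm]
    have h1 := one_sub_rpow_le (v := τ) (p := -β / 2) hτ0
    have h2 : 1 + (-β / 2) * (τ - 1) ≤ τ ^ (-β / 2) := by nlinarith
    have h3 : (0 : ℝ) < 2 ^ (-β / 2) := by positivity
    have h4 : 2 ^ (-β / 2) / β * (1 + (-β / 2) * (τ - 1)) ≤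
        2 ^ (-β / 2) / β * τ ^ (-β / 2) := by gcongr
    calc _ = 2 ^ (-β / 2) / β * (1 + (-β / 2) * (τ - 1)) := by field_simp
      _ ≤ _ := h4
      _ = _ := by ring

/-- Strict convexity of `-τ * profile` as a function of the squared distance. -/
theorem exists_profile_jensen {β : ℝ} (h0 : 0 ≤ β) (h1 : β < 1) : ∃ b, ∀ s, 0 < s →
    0 ≤ midProfile β - profile β s * (s ^ 2 / 2) + b * (s ^ 2 / 2 - 1) ∧
    (1 < s ^ 2 / 2 → 0 < midProfile β - profile β s * (s ^ 2 / 2) + b * (s ^ 2 / 2 - 1)) := by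
  -- In both cases b is the derivative of τ·profile at τ = 1, so the expression compares a convex
  -- function with its tangent there. The inequalities are log v ≤ v − 1 at v = 1/τ, respectively
  -- Bernoulli's inequality with exponent 1 − β/2 in (0, 1).
  by_cases h : β = 0
  · refine ⟨-((1 + Real.log 2) / 2), fun s hs => ?_⟩
    set τ := s ^ 2 / 2 with hτ
    have hτ0 : 0 < τ := by positivity
    rw [midProfile_eq]
    unfold profile
    simp only [h, if_true]
    rw [log_eq_of_half_sq hs hτ.symm]
    have e : -(Real.log 2 / 2) - -((Real.log 2 + Real.log τ) / 2) * τ +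
        -((1 + Real.log 2) / 2) * (τ - 1) = (τ * Real.log τ - (τ - 1)) / 2 := by ring
    rw [e]
    have hinv : Real.log τ = -Real.log τ⁻¹ := by rw [Real.log_inv, neg_neg]
    have hmul : τ * τ⁻¹ = 1 := mul_inv_cancel₀ hτ0.ne'
    constructor
    · have := Real.log_le_sub_one_of_pos (inv_pos.2 hτ0)
      rw [hinv]; nlinarith
    · intro hτ1
      have := Real.log_lt_sub_one_of_pos (inv_pos.2 hτ0) (inv_ne_one.2 hτ1.ne')
      rw [hinv]; nlinarith
  · have hβ : 0 < β := lt_of_le_of_ne h0 (Ne.symm h)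
    refine ⟨2 ^ (-β / 2) / β * (1 - β / 2), fun s hs => ?_⟩
    set τ := s ^ 2 / 2 with hτ
    have hτ0 : 0 < τ := by positivity
    rw [midProfile_eq]
    unfold profile
    simp only [h, if_false]
    rw [rpow_eq_of_half_sq hs hτ.symm]
    have e1 : τ ^ (-β / 2) * τ = τ ^ (1 - β / 2) := by
      rw [← Real.rpow_add_one hτ0.ne']; congr 1; ring
    have e : 2 ^ (-β / 2) / β - 2 ^ (-β / 2) * τ ^ (-β / 2) / β * τ +
        2 ^ (-β / 2) / β * (1 - β / 2) * (τ - 1) =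
        2 ^ (-β / 2) / β * (1 + (1 - β / 2) * (τ - 1) - τ ^ (1 - β / 2)) := by
      rw [← e1]; ring
    rw [e]
    have h3 : (0 : ℝ) < 2 ^ (-β / 2) / β := by positivity
    constructor
    · have := rpow_one_add_le_one_add_mul_self (s := τ - 1) (by linarith)
        (p := 1 - β / 2) (by linarith) (by linarith)
      rw [add_sub_cancel] at this
      exact mul_nonneg h3.le (by linarith)
    · intro hτ1
      have := rpow_one_add_lt_one_add_mul_self (s := τ - 1) (by linarith) (by linarith)
        (p := 1 - β / 2) (by linarith) (by linarith)
      rw [add_sub_cancel] at this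
      exact mul_pos h3 (by linarith)

/-- The norm of the single layer potential on functions without modes `0` and `±1`. -/
def layerGap (β : ℝ) : ℝ := (∫ η, layerKernel β η) - 2 * Real.pi * midProfile β

theorem integrable_layerKernel_mul {β : ℝ} (h0 : 0 ≤ β) (h1 : β < 1) {f : Angles → ℝ}
    (hf : Continuous f) : Integrable fun η => layerKernel β η * f η := by
  have h := integrable_layerPot h0 h1 0 (hf.comp continuous_neg)
  have h2 := h.comp_neg
  simpa [layerKernel_neg] using h2

theorem integral_layerKernel_sub_tangent {β : ℝ} (h0 : 0 ≤ β) (h1 : β < 1) (b : ℝ) :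
    Integrable (fun η => layerKernel β η - (midProfile β - b * (unitVec η).re)) ∧
      ∫ η, (layerKernel β η - (midProfile β - b * (unitVec η).re)) = layerGap β := by
  have hc : Integrable fun η => midProfile β - b * (unitVec η).re :=
    integrable_of_continuous (continuous_const.sub (continuous_const.mul continuous_re_unitVec))
  refine ⟨(integrable_layerKernel h0 h1).sub hc, ?_⟩
  have hc' : Integrable fun η : Angles => b * (unitVec η).re :=
    integrable_of_continuous (continuous_const.mul continuous_re_unitVec)
  rw [integral_sub (integrable_layerKernel h0 h1) hc, integral_sub (integrable_const _) hc',
    integral_const_mul,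
    integral_unitVec_re, integral_const, measureReal_univ_angles, layerGap, smul_eq_mul]
  ring

theorem exists_layerKernel_tangent {β : ℝ} (h0 : 0 ≤ β) : ∃ b, ∀ᵐ η : Angles,
    0 ≤ layerKernel β η - (midProfile β - b * (unitVec η).re) := by
  obtain ⟨b, hb⟩ := exists_profile_tangent h0
  refine ⟨b, ?_⟩
  filter_upwards [ae_ne_angles 0] with η hη
  have := hb _ (one_sub_unitVec_pos hη)
  rw [half_sq_norm_one_sub_unitVec] at this
  rw [layerKernel]
  linarith

theorem layerGap_nonneg {β : ℝ} (h0 : 0 ≤ β) (h1 : β < 1) : 0 ≤ layerGap β := by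
  obtain ⟨b, hb⟩ := exists_layerKernel_tangent h0
  rw [← (integral_layerKernel_sub_tangent h0 h1 b).2]
  exact integral_nonneg_of_ae hb

/-- With τ = 1 − cos η, which has mean 1, the difference of the two sides is ∫ (profile(√2) − τk).
The tangent term b(τ − 1) integrates to zero and may be added, after which the integrand is
nonnegative. Strictness is needed only on a set of positive measure; the half circle cos η < 0,
where τ > 1, will do. -/
theorem layerGap_lt_layerEig {β : ℝ} (h0 : 0 ≤ β) (h1 : β < 1) : layerGap β < layerEig β := by
  obtain ⟨b, hb⟩ := exists_profile_jensen h0 h1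
  set f : Angles → ℝ := fun η => midProfile β - layerKernel β η * (1 - (unitVec η).re) +
    b * -(unitVec η).re with hf
  have hcre := continuous_re_unitVec
  have hi1 : Integrable fun η => layerKernel β η * (1 - (unitVec η).re) :=
    integrable_layerKernel_mul h0 h1 (by fun_prop)
  have hi2 : Integrable fun η : Angles => b * -(unitVec η).re :=
    integrable_of_continuous (by fun_prop)
  have hfi : Integrable f := ((integrable_const _).sub hi1).add hi2
  have hτ : ∀ η : Angles, η ≠ 0 → 0 ≤ f η ∧ ((unitVec η).re < 0 → 0 < f η) := fun η hη => by
    have := hb _ (one_sub_unitVec_pos hη)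
    rw [half_sq_norm_one_sub_unitVec] at this
    simp only [hf, layerKernel]
    rw [show -(unitVec η).re = 1 - (unitVec η).re - 1 by ring]
    exact ⟨this.1, fun h => this.2 (by linarith)⟩
  have hnn : 0 ≤ᵐ[volume] f := (ae_ne_angles 0).mono fun η hη => (hτ η hη).1
  have hint : ∫ η, f η = layerEig β - layerGap β := by
    simp only [hf]
    have hi3 : Integrable fun η => midProfile β - layerKernel β η * (1 - (unitVec η).re) :=
      (integrable_const _).sub hi1
    rw [integral_add hi3 hi2, integral_sub (integrable_const _) hi1,
      integral_const, measureReal_univ_angles, integral_const_mul, integral_neg,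
      integral_unitVec_re]
    have : ∫ η, layerKernel β η * (1 - (unitVec η).re) =
        (∫ η, layerKernel β η) - layerEig β := by
      simp only [mul_sub, mul_one]
      exact integral_sub (integrable_layerKernel h0 h1) (integrable_layerKernel_mul h0 h1 hcre)
    rw [this, layerGap, smul_eq_mul]
    ring
  have hpos : 0 < ∫ η, f η := by
    rw [integral_pos_iff_support_of_nonneg_ae hnn hfi]
    have ho : IsOpen {η : Angles | (unitVec η).re < 0} := isOpen_lt hcre continuous_const
    refine (ho.measure_pos volume ⟨(Real.pi : Angles), ?_⟩).trans_le (measure_mono fun η hη => ?_)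
    · simp [unitVec_pi]
    · have hη' : (unitVec η).re < 0 := hη
      have hne : η ≠ 0 := by
        rintro rfl
        simp at hη'
        linarith
      exact ((hτ η hne).2 hη').ne'
  linarith

theorem layerEig_pos {β : ℝ} (h0 : 0 ≤ β) (h1 : β < 1) : 0 < layerEig β :=
  (layerGap_nonneg h0 h1).trans_lt (layerGap_lt_layerEig h0 h1)

theorem unitVec_sub_re (α η : Angles) : (unitVec (α - η)).re =
    (unitVec α).re * (unitVec η).re + (unitVec α).im * (unitVec η).im := by
  rw [unitVec_sub]
  simp

/-- By the addition formula cos(α − η) is a combination of cos η and sin η, so constants and cos may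
be added to the kernel when these modes are absent from w. This freedom makes the kernel
nonnegative. -/
theorem layerPot_eq_of_modes {β : ℝ} (h0 : 0 ≤ β) (h1 : β < 1) {w : Angles → ℝ}
    (hw : Continuous w) (hw0 : ∫ η, w η = 0) (hwr : ∫ η, w η * (unitVec η).re = 0)
    (hwi : ∫ η, w η * (unitVec η).im = 0) (m b : ℝ) (α : Angles) :
    layerPot β w α = ∫ η, (layerKernel β (α - η) - (m - b * (unitVec (α - η)).re)) * w η := by
  have hcr := continuous_re_unitVec
  have hci := continuous_im_unitVec
  have i0 : Integrable fun η : Angles => m * w η :=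
    integrable_of_continuous (by fun_prop)
  have i1 : Integrable fun η : Angles => b * (unitVec α).re * (w η * (unitVec η).re) :=
    integrable_of_continuous (by fun_prop)
  have i2 : Integrable fun η : Angles => b * (unitVec α).im * (w η * (unitVec η).im) :=
    integrable_of_continuous (by fun_prop)
  have e1 : ∀ η, (layerKernel β (α - η) - (m - b * (unitVec (α - η)).re)) * w η =
      layerKernel β (α - η) * w η - m * w η +
      b * (unitVec α).re * (w η * (unitVec η).re) +
      b * (unitVec α).im * (w η * (unitVec η).im) := fun η => by
    rw [unitVec_sub_re]; ring
  simp only [e1]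
  have i3 := integrable_layerPot h0 h1 α hw
  have i4 : Integrable fun η => layerKernel β (α - η) * w η - m * w η := i3.sub i0
  have i5 : Integrable fun η => layerKernel β (α - η) * w η - m * w η +
      b * (unitVec α).re * (w η * (unitVec η).re) := i4.add i1
  rw [integral_add i5 i2, integral_add i4 i1, integral_sub i3 i0, integral_const_mul,
    integral_const_mul, integral_const_mul, hw0, hwr, hwi, layerPot]
  ring

theorem abs_integral_sub_mul_le {k w : Angles → ℝ} (hk : Integrable k) (hk0 : ∀ᵐ η, 0 ≤ k η)
    {K : ℝ} (hK : ∀ η, |w η| ≤ K) (α : Angles) :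
    |∫ η, k (α - η) * w η| ≤ (∫ η, k η) * K := by
  have hint : (∫ η, k η) * K = ∫ η, k (α - η) * K := by
    rw [integral_sub_left_eq_self (fun η => k η * K) volume α, integral_mul_const]
  rw [hint, ← Real.norm_eq_abs]
  refine norm_integral_le_of_norm_le ((hk.mul_const K).comp_sub_left α) ?_
  filter_upwards [(Measure.measurePreserving_sub_left (volume : Measure Angles)
    α).quasiMeasurePreserving.ae hk0] with η hη
  rw [norm_mul, Real.norm_of_nonneg hη, Real.norm_eq_abs]
  gcongr
  exact hK η

/-- The single layer potential contracts functions without modes `0` and `±1`. -/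
theorem abs_layerPot_le_layerGap {β : ℝ} (h0 : 0 ≤ β) (h1 : β < 1) {w : Angles → ℝ}
    (hw : Continuous w) (hw0 : ∫ η, w η = 0) (hwr : ∫ η, w η * (unitVec η).re = 0)
    (hwi : ∫ η, w η * (unitVec η).im = 0) {K : ℝ} (hK : ∀ η, |w η| ≤ K) (α : Angles) :
    |layerPot β w α| ≤ layerGap β * K := by
  obtain ⟨b, hb⟩ := exists_layerKernel_tangent h0
  obtain ⟨hki, hke⟩ := integral_layerKernel_sub_tangent h0 h1 b
  rw [layerPot_eq_of_modes h0 h1 hw hw0 hwr hwi (midProfile β) b α, ← hke]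
  exact abs_integral_sub_mul_le hki hb hK α

theorem integral_layerKernel_mul_im (β : ℝ) : ∫ η, layerKernel β η * (unitVec η).im = 0 := by
  have h := integral_neg_eq_self (fun η : Angles => layerKernel β η * (unitVec η).im) volume
  simp only [layerKernel_neg, unitVec_neg, Complex.conj_im, mul_neg, integral_neg] at h
  linarith

theorem layerPot_re {β : ℝ} (h0 : 0 ≤ β) (h1 : β < 1) (α : Angles) :
    layerPot β (fun η => (unitVec η).re) α = layerEig β * (unitVec α).re := by
  have hcr := continuous_re_unitVec
  have hci := continuous_im_unitVec
  rw [layerPot_comm]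
  simp only [unitVec_sub_re]
  have e : ∀ η, layerKernel β η * ((unitVec α).re * (unitVec η).re +
      (unitVec α).im * (unitVec η).im) = (unitVec α).re * (layerKernel β η * (unitVec η).re) +
      (unitVec α).im * (layerKernel β η * (unitVec η).im) := fun η => by ring
  simp only [e]
  rw [integral_add ((integrable_layerKernel_mul h0 h1 hcr).const_mul _)
    ((integrable_layerKernel_mul h0 h1 hci).const_mul _), integral_const_mul, integral_const_mul,
    integral_layerKernel_mul_im, layerEig]
  ring

theorem layerPot_one (β : ℝ) (α : Angles) :
    layerPot β (fun _ => 1) α = ∫ η, layerKernel β η := by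
  rw [layerPot_comm]; simp

theorem integral_layerPot_mul {β : ℝ} (h0 : 0 ≤ β) (h1 : β < 1) {w g : Angles → ℝ}
    (hw : Continuous w) (hg : Continuous g) :
    ∫ α, layerPot β w α * g α = ∫ η, w η * layerPot β g η := by
  have hint : Integrable (fun p : Angles × Angles => w p.2 * layerKernel β (p.1 - p.2))
      (volume.prod volume) :=
    Integrable.convolution_integrand (ContinuousLinearMap.mul ℝ ℝ) (integrable_of_continuous hw)
      (integrable_layerKernel h0 h1)
  obtain ⟨M, hM⟩ := isCompact_univ.exists_bound_of_continuousOn hg.continuousOn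
  have hint2 : Integrable (Function.uncurry fun α η : Angles => layerKernel β (α - η) * w η * g α)
      (volume.prod volume) := by
    refine (hint.mul_bdd (c := M) (g := fun p : Angles × Angles => g p.1)
      (hg.comp continuous_fst).aestronglyMeasurable
      (Eventually.of_forall fun p => hM _ (mem_univ _))).congr (Eventually.of_forall fun p => ?_)
    simp only [Function.uncurry]
    ring
  simp only [layerPot, ← integral_mul_const]
  rw [integral_integral_swap hint2]
  refine integral_congr_ae (Eventually.of_forall fun η => ?_)
  beta_reduce
  rw [← integral_const_mul]
  refine integral_congr_ae (Eventually.of_forall fun α => ?_)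
  beta_reduce
  rw [← layerKernel_neg β (η - α), neg_sub]
  ring

/-! ### Fourier modes and the reduced equation -/

/-- The function `cos` on the circle of angles. -/
def reMode : C(Angles, ℝ) := ⟨fun α => (unitVec α).re, continuous_re_unitVec⟩

theorem reMode_apply (α : Angles) : reMode α = (unitVec α).re := rfl

theorem norm_reMode_le : ‖reMode‖ ≤ 1 :=
  (ContinuousMap.norm_le _ zero_le_one).2 fun α => by
    rw [reMode_apply, Real.norm_eq_abs, ← norm_unitVec α]
    exact Complex.abs_re_le_norm _

/-- A quarter turn exchanges cos² and sin², whose sum is 1. -/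
theorem integral_re_mul_re : ∫ η, (unitVec η).re * (unitVec η).re = Real.pi := by
  have hs := integral_add_right_eq_self (μ := (volume : Measure Angles))
    (fun η : Angles => (unitVec η).re * (unitVec η).re) ((Real.pi / 2 : ℝ) : Angles)
  have hu : unitVec ((Real.pi / 2 : ℝ) : Angles) = Complex.I := by
    rw [unitVec_coe]
    push_cast
    exact Complex.exp_pi_div_two_mul_I
  simp only [unitVec_add, hu, Complex.mul_re, Complex.I_re, Complex.I_im, mul_zero, mul_one,
    zero_sub, neg_mul_neg] at hs
  have hr : Integrable fun η : Angles => (unitVec η).re * (unitVec η).re :=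
    integrable_of_continuous (continuous_re_unitVec.mul continuous_re_unitVec)
  have hi : Integrable fun η : Angles => (unitVec η).im * (unitVec η).im :=
    integrable_of_continuous (continuous_im_unitVec.mul continuous_im_unitVec)
  have h := integral_add hr hi
  have h1 : ∀ η : Angles, (unitVec η).re * (unitVec η).re + (unitVec η).im * (unitVec η).im = 1 :=
    fun η => by have := sq_re_add_sq_im_unitVec η; nlinarith
  simp only [h1, integral_const, measureReal_univ_angles, smul_eq_mul, mul_one] at h
  linarith

/-- The mean value of a function on the circle. -/
def meanMode : C(Angles, ℝ) →ₗ[ℝ] ℝ where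
  toFun f := (2 * Real.pi)⁻¹ * ∫ η, f η
  map_add' f g := by
    simp only [ContinuousMap.add_apply]
    rw [integral_add (integrable_of_continuous f.continuous)
      (integrable_of_continuous g.continuous), mul_add]
  map_smul' c f := by
    simp only [ContinuousMap.smul_apply, smul_eq_mul, RingHom.id_apply, integral_const_mul]
    ring

/-- The first cosine coefficient of a function on the circle. -/
def cosMode : C(Angles, ℝ) →ₗ[ℝ] ℝ where
  toFun f := Real.pi⁻¹ * ∫ η, f η * (unitVec η).re
  map_add' f g := by
    have h : ∀ f : C(Angles, ℝ), Integrable fun η => f η * (unitVec η).re := fun f =>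
      integrable_of_continuous (f.continuous.mul continuous_re_unitVec)
    simp only [ContinuousMap.add_apply, add_mul]
    rw [integral_add (h f) (h g), mul_add]
  map_smul' c f := by
    simp only [ContinuousMap.smul_apply, smul_eq_mul, RingHom.id_apply, mul_assoc,
      integral_const_mul]
    ring

theorem meanMode_apply (f : C(Angles, ℝ)) : meanMode f = (2 * Real.pi)⁻¹ * ∫ η, f η := rfl

theorem cosMode_apply (f : C(Angles, ℝ)) :
    cosMode f = Real.pi⁻¹ * ∫ η, f η * (unitVec η).re := rfl

theorem meanMode_const (k : ℝ) : meanMode (ContinuousMap.const _ k) = k := by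
  rw [meanMode_apply]
  simp only [ContinuousMap.const_apply, integral_const, measureReal_univ_angles, smul_eq_mul]
  field_simp

theorem meanMode_reMode : meanMode reMode = 0 := by
  rw [meanMode_apply]
  simp only [reMode_apply, integral_unitVec_re, mul_zero]

theorem cosMode_const (k : ℝ) : cosMode (ContinuousMap.const _ k) = 0 := by
  rw [cosMode_apply]
  simp only [ContinuousMap.const_apply, integral_const_mul, integral_unitVec_re, mul_zero]

theorem cosMode_reMode : cosMode reMode = 1 := by
  rw [cosMode_apply]
  simp only [reMode_apply, integral_re_mul_re]
  field_simp

theorem abs_integral_le_of_abs_le {f : Angles → ℝ} {K : ℝ} (hf : ∀ η, |f η| ≤ K) :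
    |∫ η, f η| ≤ 2 * Real.pi * K := by
  have := norm_integral_le_of_norm_le_const (μ := (volume : Measure Angles)) (f := f)
    (Eventually.of_forall hf)
  rw [measureReal_univ_angles, Real.norm_eq_abs] at this
  linarith

theorem abs_meanMode_le (f : C(Angles, ℝ)) : |meanMode f| ≤ ‖f‖ := by
  rw [meanMode_apply, abs_mul, abs_of_pos (by positivity), inv_mul_le_iff₀ (by positivity)]
  exact abs_integral_le_of_abs_le fun η => f.norm_coe_le_norm η

theorem abs_cosMode_le (f : C(Angles, ℝ)) : |cosMode f| ≤ 2 * ‖f‖ := by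
  rw [cosMode_apply, abs_mul, abs_of_pos (by positivity), inv_mul_le_iff₀ (by positivity)]
  refine (abs_integral_le_of_abs_le (K := ‖f‖) fun η => ?_).trans_eq (by ring)
  rw [abs_mul]
  have h1 : |(unitVec η).re| ≤ 1 := (Complex.abs_re_le_norm _).trans_eq (norm_unitVec η)
  have h2 : |f η| ≤ ‖f‖ := f.norm_coe_le_norm η
  nlinarith [abs_nonneg (f η), abs_nonneg (unitVec η).re]

/-- The projection which removes the mean and the first cosine mode. -/
def modeProj : C(Angles, ℝ) →ₗ[ℝ] C(Angles, ℝ) where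
  toFun f := f - ContinuousMap.const _ (meanMode f) - cosMode f • reMode
  map_add' f g := by
    ext α
    simp only [map_add, ContinuousMap.sub_apply, ContinuousMap.add_apply,
      ContinuousMap.const_apply, ContinuousMap.smul_apply, smul_eq_mul]
    ring
  map_smul' c f := by
    ext α
    simp only [map_smul, ContinuousMap.sub_apply, ContinuousMap.const_apply,
      ContinuousMap.smul_apply, smul_eq_mul, RingHom.id_apply]
    ring

theorem modeProj_apply (f : C(Angles, ℝ)) :
    modeProj f = f - ContinuousMap.const _ (meanMode f) - cosMode f • reMode := rfl

theorem modeProj_const (k : ℝ) : modeProj (ContinuousMap.const _ k) = 0 := by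
  rw [modeProj_apply, meanMode_const, cosMode_const, sub_self, zero_smul, sub_zero]

theorem modeProj_reMode : modeProj reMode = 0 := by
  rw [modeProj_apply, meanMode_reMode, cosMode_reMode, one_smul]
  ext α
  simp

theorem norm_const_angles_le (k : ℝ) : ‖(ContinuousMap.const Angles k : C(Angles, ℝ))‖ ≤ |k| :=
  (ContinuousMap.norm_le _ (abs_nonneg k)).2 fun _ => le_rfl

theorem norm_modeProj_le (f : C(Angles, ℝ)) : ‖modeProj f‖ ≤ 4 * ‖f‖ := by
  rw [modeProj_apply]
  have h1 := norm_sub_le (f - ContinuousMap.const _ (meanMode f)) (cosMode f • reMode)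
  have h2 := norm_sub_le f (ContinuousMap.const _ (meanMode f))
  have h3 := (norm_const_angles_le (meanMode f)).trans (abs_meanMode_le f)
  have h4 : ‖cosMode f • reMode‖ ≤ 2 * ‖f‖ := by
    rw [norm_smul, Real.norm_eq_abs]
    have := abs_cosMode_le f
    nlinarith [norm_reMode_le, norm_nonneg reMode, abs_nonneg (cosMode f)]
  linarith

theorem meanMode_modeProj (f : C(Angles, ℝ)) : meanMode (modeProj f) = 0 := by
  rw [modeProj_apply, map_sub, map_sub, map_smul, meanMode_const, meanMode_reMode]
  simp

theorem cosMode_modeProj (f : C(Angles, ℝ)) : cosMode (modeProj f) = 0 := by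
  rw [modeProj_apply, map_sub, map_sub, map_smul, cosMode_const, cosMode_reMode]
  simp

/-- Even functions without modes `0` and `1`. -/
def evenModes : Submodule ℝ C(Angles, ℝ) where
  carrier := {w | (∀ α, w (-α) = w α) ∧ meanMode w = 0 ∧ cosMode w = 0}
  add_mem' := fun ⟨a1, a2, a3⟩ ⟨b1, b2, b3⟩ =>
    ⟨fun α => by simp [a1, b1], by rw [map_add, a2, b2, add_zero],
      by rw [map_add, a3, b3, add_zero]⟩
  zero_mem' := ⟨fun _ => rfl, map_zero _, map_zero _⟩
  smul_mem' := fun c w ⟨a1, a2, a3⟩ =>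
    ⟨fun α => by simp [a1], by rw [map_smul, a2, smul_zero], by rw [map_smul, a3, smul_zero]⟩

theorem modeProj_eq_self {w : C(Angles, ℝ)} (hw : w ∈ evenModes) : modeProj w = w := by
  rw [modeProj_apply, hw.2.1, hw.2.2]
  ext α
  simp

theorem modeProj_mem_evenModes {f : C(Angles, ℝ)} (hf : ∀ α, f (-α) = f α) :
    modeProj f ∈ evenModes := by
  refine ⟨fun α => ?_, meanMode_modeProj f, cosMode_modeProj f⟩
  simp [modeProj_apply, reMode_apply, hf, unitVec_neg]

theorem isClosed_evenModes : IsClosed (evenModes : Set C(Angles, ℝ)) := by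
  have hm : Continuous meanMode := AddMonoidHomClass.continuous_of_bound meanMode 1
    fun f => by rw [one_mul]; exact abs_meanMode_le f
  have hc : Continuous cosMode := AddMonoidHomClass.continuous_of_bound cosMode 2 abs_cosMode_le
  have he : IsClosed {w : C(Angles, ℝ) | ∀ α, w (-α) = w α} := by
    rw [ofPred_forall]
    exact isClosed_iInter fun α =>
      isClosed_eq (continuous_eval_const (-α)) (continuous_eval_const α)
  exact he.inter ((isClosed_eq hm continuous_const).inter (isClosed_eq hc continuous_const))

theorem integral_mul_im_of_even {w : Angles → ℝ} (hw : ∀ α, w (-α) = w α) :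
    ∫ η, w η * (unitVec η).im = 0 := by
  have h := integral_neg_eq_self (fun η : Angles => w η * (unitVec η).im) volume
  simp only [hw, unitVec_neg, Complex.conj_im, mul_neg, integral_neg] at h
  linarith

theorem integral_eq_zero_of_mem {w : C(Angles, ℝ)} (hw : w ∈ evenModes) :
    ∫ η, w η = 0 ∧ ∫ η, w η * (unitVec η).re = 0 := by
  have h2 := hw.2.1
  have h3 := hw.2.2
  rw [meanMode_apply] at h2
  rw [cosMode_apply] at h3
  exact ⟨by simpa [Real.pi_ne_zero] using h2, by simpa [Real.pi_ne_zero] using h3⟩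

/-- The single layer potential as an operator on continuous functions. -/
def layerOp {β : ℝ} (h0 : 0 ≤ β) (h1 : β < 1) (w : C(Angles, ℝ)) : C(Angles, ℝ) :=
  ⟨layerPot β w, continuous_layerPot h0 h1 w.continuous⟩

theorem norm_layerOp_le {β : ℝ} (h0 : 0 ≤ β) (h1 : β < 1) {w : C(Angles, ℝ)}
    (hw : w ∈ evenModes) : ‖layerOp h0 h1 w‖ ≤ layerGap β * ‖w‖ := by
  have := integral_eq_zero_of_mem hw
  refine (ContinuousMap.norm_le _ (mul_nonneg (layerGap_nonneg h0 h1) (norm_nonneg w))).2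
    fun α => ?_
  exact abs_layerPot_le_layerGap h0 h1 w.continuous this.1 this.2
    (integral_mul_im_of_even hw.1) (fun η => w.norm_coe_le_norm η) α

/-- The operator is symmetric and has 1 and cos as eigenfunctions, so it preserves their orthogonal
complement. -/
theorem layerOp_modes {β : ℝ} (h0 : 0 ≤ β) (h1 : β < 1) {w : C(Angles, ℝ)}
    (hw : w ∈ evenModes) : meanMode (layerOp h0 h1 w) = 0 ∧ cosMode (layerOp h0 h1 w) = 0 := by
  have hm := integral_eq_zero_of_mem hw
  constructor
  · have := integral_layerPot_mul h0 h1 w.continuous (continuous_const (y := (1 : ℝ)))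
    simp only [layerPot_one, mul_one, integral_mul_const, hm.1, zero_mul] at this
    rw [meanMode_apply]
    simp [layerOp, this]
  · have := integral_layerPot_mul h0 h1 w.continuous continuous_re_unitVec
    simp only [layerPot_re h0 h1, mul_left_comm, integral_const_mul, hm.2, mul_zero] at this
    rw [cosMode_apply]
    simp [layerOp, this]

theorem modeProj_layerOp {β : ℝ} (h0 : 0 ≤ β) (h1 : β < 1) {w : C(Angles, ℝ)}
    (hw : w ∈ evenModes) : modeProj (layerOp h0 h1 w) = layerOp h0 h1 w := by
  rw [modeProj_apply, (layerOp_modes h0 h1 hw).1, (layerOp_modes h0 h1 hw).2]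
  ext α
  simp

/-- Admissible unknowns `(w, b, λ)` of the reduced equation. -/
def reducedBall (ρ : ℝ) : Set (C(Angles, ℝ) × ℝ × ℝ) := {x | x.1 ∈ evenModes ∧ ‖x‖ ≤ ρ}

theorem isComplete_reducedBall (ρ : ℝ) : IsComplete (reducedBall ρ) := by
  have h1 : IsClosed {x : C(Angles, ℝ) × ℝ × ℝ | x.1 ∈ evenModes} :=
    isClosed_evenModes.preimage continuous_fst
  have h2 : IsClosed {x : C(Angles, ℝ) × ℝ × ℝ | ‖x‖ ≤ ρ} :=
    isClosed_le continuous_norm continuous_const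
  exact (h1.inter h2).isComplete

/-- Solution of the reduced equation by the contraction principle. -/
theorem exists_reduced_solution {β : ℝ} (h0 : 0 ≤ β) (h1 : β < 1) :
    ∃ c > 0, ∃ C > 0, ∀ (E : C(Angles, ℝ) × ℝ × ℝ → C(Angles, ℝ))
      (M : C(Angles, ℝ) × ℝ × ℝ → ℝ) (ρ η : ℝ), 0 ≤ ρ → C * η ≤ ρ →
      (∃ k, ∀ α, |E 0 α - k| ≤ η) → M 0 = 0 →
      (∀ x ∈ reducedBall ρ, ∀ α, E x (-α) = E x α) →
      (∀ x ∈ reducedBall ρ, ∀ y ∈ reducedBall ρ, ∃ k, ∀ α,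
        |E x α - E y α - (-layerEig β * (x.1 - y.1) α + layerPot β (x.1 - y.1) α +
          (x.2.2 - y.2.2) * (unitVec α).re + k)| ≤ c * ‖x - y‖) →
      (∀ x ∈ reducedBall ρ, ∀ y ∈ reducedBall ρ,
        |M x - M y - (x.2.1 - y.2.1)| ≤ c * ‖x - y‖) →
      ∃ x ∈ reducedBall ρ, (∃ k, ∀ α, E x α = k) ∧ M x = 0 := by
  have ha := layerEig_pos h0 h1
  have hg := layerGap_lt_layerEig h0 h1
  have hg0 := layerGap_nonneg h0 h1
  set a := layerEig β with ha_def
  set g := layerGap β with hg_def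
  -- The contraction factor is placed halfway between g/a and 1; the other half of the gap pays for
  -- the nonlinear errors.
  set q := (1 + g / a) / 2 with hq
  have hga : g / a < 1 := (div_lt_one ha).2 hg
  have hga0 : 0 ≤ g / a := div_nonneg hg0 ha.le
  have hq1 : q < 1 := by rw [hq]; linarith
  have hq2 : 1 / 2 ≤ q := by rw [hq]; linarith
  -- The first bound gives g + 4c ≤ aq, where 4 bounds the norm of `modeProj`; the second gives c ≤
  -- q and 2c ≤ q for the two scalar components.
  set c := min ((a - g) / 8) (1 / 4) with hc
  have hc0 : 0 < c := lt_min (by linarith) (by norm_num)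
  have hc1 : 4 * c ≤ a * q - g := by
    have : c ≤ (a - g) / 8 := min_le_left _ _
    have e : a * q = (a + g) / 2 := by rw [hq]; field_simp
    linarith
  have hc2 : c ≤ 1 / 4 := min_le_right _ _
  -- This constant ensures ‖T 0‖ ≤ (4/a + 2)η ≤ (1 − q)ρ, so that T maps the ball into itself.
  refine ⟨c, hc0, (4 / a + 2) / (1 - q), div_pos (by positivity) (by linarith), ?_⟩
  intro E M ρ η hρ hη hE0 hM0 heven hE hM
  -- A simplified Newton step: on the higher modes only −a is inverted, so the layer operator
  -- remains and contributes g/a to the contraction factor. The equations for b and λ already have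
  -- derivative 1 in their own unknown.
  set T : C(Angles, ℝ) × ℝ × ℝ → C(Angles, ℝ) × ℝ × ℝ := fun x =>
    (x.1 + a⁻¹ • modeProj (E x), x.2.1 - M x, x.2.2 - cosMode (E x)) with hT
  have h0mem : (0 : C(Angles, ℝ) × ℝ × ℝ) ∈ reducedBall ρ :=
    ⟨evenModes.zero_mem, by simpa using hρ⟩
  have hTlip : ∀ x ∈ reducedBall ρ, ∀ y ∈ reducedBall ρ, ‖T x - T y‖ ≤ q * ‖x - y‖ := by
    intro x hx y hy
    obtain ⟨k, hk⟩ := hE x hx y hy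
    have hw : x.1 - y.1 ∈ evenModes := evenModes.sub_mem hx.1 hy.1
    set r : C(Angles, ℝ) := E x - E y - (-a • (x.1 - y.1) + layerOp h0 h1 (x.1 - y.1) +
      (x.2.2 - y.2.2) • reMode + ContinuousMap.const _ k) with hr
    have hrn : ‖r‖ ≤ c * ‖x - y‖ :=
      (ContinuousMap.norm_le _ (mul_nonneg hc0.le (norm_nonneg _))).2 fun α => hk α
    have hEE : E x - E y = -a • (x.1 - y.1) + layerOp h0 h1 (x.1 - y.1) +
        (x.2.2 - y.2.2) • reMode + ContinuousMap.const _ k + r := by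
      rw [hr]; abel
    have hx1 : ‖x.1 - y.1‖ ≤ ‖x - y‖ := norm_fst_le (x - y)
    have hd := norm_nonneg (x - y)
    refine norm_prod_le_iff.2 ⟨?_, norm_prod_le_iff.2 ⟨?_, ?_⟩⟩
    · have e : (T x - T y).1 = a⁻¹ • (layerOp h0 h1 (x.1 - y.1) + modeProj r) := by
        have e1 : (T x - T y).1 = (x.1 - y.1) + a⁻¹ • modeProj (E x - E y) := by
          simp only [hT, Prod.fst_sub, map_sub, smul_sub]
          abel
        rw [e1, hEE, map_add, map_add, map_add, map_add, map_smul, map_smul, modeProj_const,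
          modeProj_reMode, modeProj_eq_self hw, modeProj_layerOp h0 h1 hw, smul_zero, add_zero,
          add_zero, add_assoc, smul_add, smul_smul, mul_neg, inv_mul_cancel₀ ha.ne', neg_one_smul]
        abel
      rw [e, norm_smul, Real.norm_of_nonneg (inv_nonneg.2 ha.le), inv_mul_le_iff₀ ha]
      have e2 := norm_add_le (layerOp h0 h1 (x.1 - y.1)) (modeProj r)
      have e3 := norm_layerOp_le h0 h1 hw
      have e4 := norm_modeProj_le r
      have e5 : g * ‖x.1 - y.1‖ ≤ g * ‖x - y‖ := by gcongr
      nlinarith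
    · have e : (T x - T y).2.1 = -(M x - M y - (x.2.1 - y.2.1)) := by
        simp only [hT, Prod.snd_sub, Prod.fst_sub]
        ring
      rw [e, norm_neg]
      exact (hM x hx y hy).trans (by gcongr; linarith)
    · have e : (T x - T y).2.2 = -cosMode r := by
        have e1 : (T x - T y).2.2 = (x.2.2 - y.2.2) - cosMode (E x - E y) := by
          simp only [hT, Prod.snd_sub, map_sub]
          ring
        rw [e1, hEE, map_add, map_add, map_add, map_add, map_smul, map_smul, cosMode_const,
          cosMode_reMode, hw.2.2, (layerOp_modes h0 h1 hw).2]
        simp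
      rw [e, norm_neg]
      refine (abs_cosMode_le r).trans ?_
      nlinarith
  have hT0 : ‖T 0‖ ≤ (1 - q) * ρ := by
    obtain ⟨k, hk⟩ := hE0
    have hη0 : 0 ≤ η := (abs_nonneg _).trans (hk 0)
    set r : C(Angles, ℝ) := E 0 - ContinuousMap.const _ k with hr
    have hrn : ‖r‖ ≤ η := (ContinuousMap.norm_le _ hη0).2 fun α => hk α
    have hEr : E 0 = r + ContinuousMap.const _ k := by rw [hr]; abel
    have hη' : (4 / a + 2) * η ≤ (1 - q) * ρ := by
      have : (4 / a + 2) / (1 - q) * η = ((4 / a + 2) * η) / (1 - q) := by ring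
      rw [this, div_le_iff₀ (by linarith)] at hη
      linarith
    refine le_trans ?_ hη'
    have h4 : 0 ≤ 4 / a * η := by positivity
    refine norm_prod_le_iff.2 ⟨?_, norm_prod_le_iff.2 ⟨?_, ?_⟩⟩
    · have e : (T 0).1 = a⁻¹ • modeProj r := by
        simp only [hT, hEr, map_add, modeProj_const, add_zero, Prod.fst_zero, zero_add]
      rw [e, norm_smul, Real.norm_of_nonneg (inv_nonneg.2 ha.le)]
      calc a⁻¹ * ‖modeProj r‖ ≤ a⁻¹ * (4 * η) := by
            gcongr
            exact (norm_modeProj_le r).trans (by linarith)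
        _ = 4 / a * η := by ring
        _ ≤ _ := by linarith
    · have e : (T 0).2.1 = 0 := by simp [hT, hM0]
      rw [e, norm_zero]
      linarith
    · have e : (T 0).2.2 = -cosMode r := by
        simp only [hT, hEr, map_add, cosMode_const, add_zero, Prod.snd_zero, zero_sub]
      rw [e, norm_neg]
      exact (abs_cosMode_le r).trans (by linarith)
  have hmaps : MapsTo T (reducedBall ρ) (reducedBall ρ) := fun x hx => by
    refine ⟨evenModes.add_mem hx.1 (evenModes.smul_mem _
      (modeProj_mem_evenModes (heven x hx))), ?_⟩
    have e1 := hTlip x hx 0 h0mem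
    rw [sub_zero] at e1
    have e2 : ‖T x‖ ≤ ‖T x - T 0‖ + ‖T 0‖ := by
      simpa using norm_add_le (T x - T 0) (T 0)
    have e3 := hx.2
    nlinarith
  have hcontr : ContractingWith ⟨q, by linarith⟩ (hmaps.restrict T (reducedBall ρ)
      (reducedBall ρ)) := by
    refine ⟨hq1, LipschitzWith.of_dist_le_mul fun x y => ?_⟩
    rw [Subtype.dist_eq, Subtype.dist_eq, dist_eq_norm, dist_eq_norm]
    exact hTlip x x.2 y y.2
  obtain ⟨x, hx, hfix, -⟩ := hcontr.exists_fixedPoint' (isComplete_reducedBall ρ) hmaps h0mem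
    (edist_ne_top _ _)
  have hfix : T x = x := hfix
  refine ⟨x, hx, ⟨meanMode (E x), fun α => ?_⟩, ?_⟩
  · have e1 : modeProj (E x) = 0 := by
      have := congrArg Prod.fst hfix
      simp only [hT] at this
      have h2 : a⁻¹ • modeProj (E x) = 0 := by simpa using this
      exact (smul_eq_zero.1 h2).resolve_left (inv_ne_zero ha.ne')
    have e2 : cosMode (E x) = 0 := by
      have := congrArg (fun p => p.2.2) hfix
      simp only [hT] at this
      linarith
    rw [modeProj_apply, e2, zero_smul, sub_zero, sub_eq_zero] at e1
    rw [e1]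
    simp [meanMode_const]
  · have := congrArg (fun p => p.2.1) hfix
    simp only [hT] at this
    linarith

/-! ### The field of the distant patches -/

theorem starPatch_conj {u : C(Angles, ℝ)} (hu : ∀ α, u (-α) = u α) (z : ℂ) :
    starRingEnd ℂ z ∈ starPatch u ↔ z ∈ starPatch u := by
  rcases eq_or_ne z 0 with rfl | hz
  · rw [map_zero]
  · have h : angle (starRingEnd ℂ z) = -angle z := by
      apply unitVec_injective
      have h1 := norm_mul_unitVec (starRingEnd ℂ z)
      have h2 := congrArg (starRingEnd ℂ) (norm_mul_unitVec z)
      rw [map_mul, Complex.conj_ofReal] at h2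
      rw [RCLike.norm_conj] at h1
      rw [unitVec_neg]
      exact mul_left_cancel₀ (by simpa using hz) (h1.trans h2.symm)
    simp only [starPatch, mem_ofPred_eq, h, hu, RCLike.norm_conj]

theorem patchPot_conj {u : C(Angles, ℝ)} (hu : ∀ α, u (-α) = u α) (β : ℝ) (z : ℂ) :
    patchPot β u (starRingEnd ℂ z) = patchPot β u z := by
  rw [patchPot, ← pot_conj]
  congr 1
  ext y
  by_cases hy : y ∈ starPatch u
  · rw [indicator_of_mem hy, indicator_of_mem ((starPatch_conj hu y).2 hy)]
  · rw [indicator_of_notMem hy, indicator_of_notMem (mt (starPatch_conj hu y).1 hy)]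

/-- The potential, up to a constant, of the patch seen after the rotation `o` about the point
`-L`. -/
def farTerm (β L : ℝ) (u : C(Angles, ℝ)) (o : Circle) (z : ℂ) : ℝ :=
  patchPot β u (o * z + (o - 1) * L) - patchPot β u ((o - 1) * L)

theorem dist_far {L R : ℝ} {o : Circle} (hR : 4 ≤ R) (ho : 2 * R ≤ ‖(o : ℂ) - 1‖ * |L|)
    {v y : ℂ} (hv : ‖v‖ ≤ 2) (hy : ‖y‖ ≤ 5 / 4) : R ≤ ‖v + (o - 1) * L - y‖ := by
  have h1 : ‖((o : ℂ) - 1) * L‖ = ‖(o : ℂ) - 1‖ * |L| := by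
    rw [norm_mul, Complex.norm_real, Real.norm_eq_abs]
  have h2 := norm_sub_le (v + (o - 1) * L - y) (v - y)
  rw [show v + ((o : ℂ) - 1) * L - y - (v - y) = (o - 1) * L by ring, h1] at h2
  linarith [norm_sub_le v y]

theorem volume_real_ball_le : volume.real (Metric.ball (0 : ℂ) (1 + 1 / 4)) ≤ 2 * Real.pi := by
  rw [measureReal_def, Complex.volume_ball]
  simp only [ENNReal.toReal_mul, ENNReal.toReal_pow, ENNReal.coe_toReal, NNReal.coe_real_pi]
  rw [ENNReal.toReal_ofReal (by norm_num)]
  nlinarith [Real.pi_pos]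

theorem farTerm_lipschitz {β L R : ℝ} (h0 : 0 ≤ β) (h1 : β < 1) {o : Circle} (hR : 4 ≤ R)
    (ho : 2 * R ≤ ‖(o : ℂ) - 1‖ * |L|) {u : C(Angles, ℝ)} (hu : ∀ α, |u α| ≤ 1 / 4) {z z' : ℂ}
    (hz : ‖z‖ ≤ 2) (hz' : ‖z'‖ ≤ 2) :
    |farTerm β L u o z - farTerm β L u o z'| ≤ 2 * Real.pi * (R ^ (-1 - β) * ‖z - z'‖) := by
  have hsub := starPatch_subset_ball hu
  have hB : ∀ y ∈ Metric.ball (0 : ℂ) (1 + 1 / 4), ‖y‖ ≤ 5 / 4 := fun y hy => by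
    rw [mem_ball_zero_iff] at hy; linarith
  have := pot_lipschitz_far h0 h1 (isBddDensity_starPatch u) (A := Metric.ball 0 (1 + 1 / 4))
    measurableSet_ball measure_ball_lt_top.ne (fun y => by
      rw [abs_of_nonneg (indicator_nonneg (fun _ _ => zero_le_one) _)]
      exact indicator_le_indicator_of_subset hsub (fun _ => zero_le_one) y)
    (R := R) (by linarith) (o * z + (o - 1) * L) (o * z' + (o - 1) * L)
    (fun y hy => dist_far hR ho (by rwa [norm_mul, Circle.norm_coe, one_mul]) (hB y hy))
    (fun y hy => dist_far hR ho (by rwa [norm_mul, Circle.norm_coe, one_mul]) (hB y hy))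
  rw [show (o : ℂ) * z + (o - 1) * L - (o * z' + (o - 1) * L) = o * (z - z') by ring, norm_mul,
    Circle.norm_coe, one_mul] at this
  simp only [farTerm, sub_sub_sub_cancel_right]
  refine this.trans (mul_le_mul_of_nonneg_right volume_real_ball_le ?_)
  have : (0 : ℝ) ≤ R := by linarith
  positivity

/-- The normalization at z = 0 makes this a difference of two values of one potential, whose density
lives on a set of volume at most 4πK. The decay is therefore that of the gradient of the kernel,
also when β = 0. -/
theorem farTerm_sub_le {β L R : ℝ} (h0 : 0 ≤ β) (h1 : β < 1) {o : Circle} (hR : 4 ≤ R)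
    (ho : 2 * R ≤ ‖(o : ℂ) - 1‖ * |L|) {u w : C(Angles, ℝ)} (hu : ∀ α, |u α| ≤ 1 / 4)
    (hw : ∀ α, |w α| ≤ 1 / 4) {K : ℝ} (hK : ∀ α, |u α - w α| ≤ K) {z : ℂ} (hz : ‖z‖ ≤ 2) :
    |farTerm β L u o z - farTerm β L w o z| ≤ 8 * Real.pi * (R ^ (-1 - β) * K) := by
  obtain ⟨A, hA, hAm, hAv, hle⟩ := exists_starPatch_diff le_rfl hu hw hK
  have hB : ∀ y ∈ A, ‖y‖ ≤ 5 / 4 := fun y hy => by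
    have := hA hy
    rw [mem_ball_zero_iff] at this; linarith
  have hfin : volume A ≠ ⊤ := ((measure_mono hA).trans_lt measure_ball_lt_top).ne
  have := pot_lipschitz_far h0 h1 ((isBddDensity_starPatch u).sub (isBddDensity_starPatch w))
    hAm hfin hle (R := R) (by linarith) (o * z + (o - 1) * L) (0 + (o - 1) * L)
    (fun y hy => dist_far hR ho (by rwa [norm_mul, Circle.norm_coe, one_mul]) (hB y hy))
    (fun y hy => dist_far hR ho (by simp) (hB y hy))
  rw [pot_sub h0 h1 (isBddDensity_starPatch u) (isBddDensity_starPatch w),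
    pot_sub h0 h1 (isBddDensity_starPatch u) (isBddDensity_starPatch w), zero_add,
    add_sub_cancel_right, norm_mul, Circle.norm_coe, one_mul] at this
  have e : farTerm β L u o z - farTerm β L w o z =
      patchPot β u (o * z + (o - 1) * L) - patchPot β w (o * z + (o - 1) * L) -
      (patchPot β u ((o - 1) * L) - patchPot β w ((o - 1) * L)) := by
    simp only [farTerm]; ring
  rw [e]
  refine this.trans ?_
  have hK0 : 0 ≤ K := (abs_nonneg _).trans (hK 0)
  have hR0 : 0 ≤ R ^ (-1 - β) := by
    have : (0 : ℝ) ≤ R := by linarith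
    positivity
  calc volume.real A * (R ^ (-1 - β) * ‖z‖) ≤ (4 * Real.pi * K) * (R ^ (-1 - β) * 2) := by gcongr
    _ = _ := by ring

/-- Expand in the modulus to second order, then use the exact identity Re(v p̄) = y(x − y) + ((x −
y)² − |v|²)/2 with y = |p|, x = |p + v|. The constant is 17 = 2·8 + 1, from 1 + β ≤ 2 and 2^(2+β) ≤
8. -/
theorem profile_taylor {β : ℝ} (h0 : 0 ≤ β) (h1 : β < 1) {p v : ℂ} (hp : p ≠ 0)
    (hv : ‖v‖ ≤ ‖p‖ / 2) :
    |profile β ‖p + v‖ - profile β ‖p‖ + ‖p‖ ^ (-2 - β) * (v * starRingEnd ℂ p).re| ≤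
      17 * ‖p‖ ^ (-2 - β) * ‖v‖ ^ 2 := by
  have hp0 : 0 < ‖p‖ := norm_pos_iff.2 hp
  set y := ‖p‖ with hy
  set x := ‖p + v‖ with hx
  set m := (v * starRingEnd ℂ p).re with hm
  have hxy : |x - y| ≤ ‖v‖ := by
    have := abs_norm_sub_norm_le (p + v) p
    rwa [add_sub_cancel_left] at this
  have hsq : (x - y) ^ 2 ≤ ‖v‖ ^ 2 := sq_le_sq' (by linarith [(abs_le.1 hxy).1])
    (by linarith [(abs_le.1 hxy).2])
  have h1' := abs_profile_sub_taylor_le h0 hp0 (x := x) (by linarith [(abs_le.1 hxy).1])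
  have hexp : x ^ 2 = y ^ 2 + 2 * m + ‖v‖ ^ 2 := by
    rw [hx, hy, hm, ← Complex.normSq_eq_norm_sq, ← Complex.normSq_eq_norm_sq,
      ← Complex.normSq_eq_norm_sq]
    simp only [Complex.normSq_apply, Complex.add_re, Complex.add_im, Complex.mul_re,
      Complex.conj_re, Complex.conj_im]
    ring
  have hq : y ^ (-1 - β) = y ^ (-2 - β) * y := by
    rw [← Real.rpow_add_one hp0.ne']; congr 1; ring
  have e : y ^ (-2 - β) * m = y ^ (-1 - β) * (x - y) +
      y ^ (-2 - β) * (((x - y) ^ 2 - ‖v‖ ^ 2) / 2) := by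
    rw [hq]
    have : m = y * (x - y) + ((x - y) ^ 2 - ‖v‖ ^ 2) / 2 := by nlinarith
    nth_rewrite 1 [this]
    ring
  have h2 : (y / 2) ^ (-2 - β) ≤ 8 * y ^ (-2 - β) := by
    rw [Real.div_rpow hp0.le zero_le_two, div_eq_mul_inv, ← Real.rpow_neg zero_le_two, mul_comm]
    gcongr
    calc (2 : ℝ) ^ (-(-2 - β)) ≤ 2 ^ (3 : ℝ) := by
          apply Real.rpow_le_rpow_of_exponent_le one_le_two; linarith
      _ = 8 := by norm_num
  have hP : 0 < y ^ (-2 - β) := by positivity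
  have h3 : (1 + β) * (y / 2) ^ (-2 - β) * (x - y) ^ 2 ≤ 2 * (8 * y ^ (-2 - β)) * ‖v‖ ^ 2 := by
    gcongr
    linarith
  rw [e, ← add_assoc]
  refine (abs_add_le _ _).trans ?_
  have h4 : |y ^ (-2 - β) * (((x - y) ^ 2 - ‖v‖ ^ 2) / 2)| ≤ y ^ (-2 - β) * ‖v‖ ^ 2 := by
    rw [abs_mul, abs_of_pos hP]
    gcongr
    rw [abs_le]
    constructor <;> nlinarith [sq_nonneg (x - y), sq_nonneg ‖v‖]
  linarith

/-- Expand the kernel about p = (o − 1)L with the increments oz − y and −y. The linear terms differ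
by Re(oz p̄) = L Re((1 − o)z), which does not depend on y, so integration over the disc gives the
factor π. The remainders add up to 17·2² + 17·1² = 85. -/
theorem farTerm_zero_le {β L R : ℝ} (h0 : 0 ≤ β) (h1 : β < 1) {o : Circle} (hR : 4 ≤ R)
    (ho : 2 * R ≤ ‖(o : ℂ) - 1‖ * |L|) {z : ℂ} (hz : ‖z‖ ≤ 1) :
    |farTerm β L 0 o z + Real.pi * (‖((o : ℂ) - 1) * L‖ ^ (-2 - β) * (L * ((1 - o) * z).re))| ≤
      85 * Real.pi * R ^ (-2 - β) := by
  set p : ℂ := ((o : ℂ) - 1) * L with hp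
  have hpn : 2 * R ≤ ‖p‖ := by
    rwa [hp, norm_mul, Complex.norm_real, Real.norm_eq_abs]
  have hp0 : p ≠ 0 := norm_pos_iff.1 (by linarith)
  have hre : (o * z * starRingEnd ℂ p).re = L * ((1 - o) * z).re := by
    have : (o : ℂ) * z * starRingEnd ℂ p = L * ((1 - o) * z) := by
      rw [hp, map_mul, map_sub, map_one, Complex.conj_ofReal, ← Circle.coe_inv_eq_conj]
      have h : (o : ℂ) * (o⁻¹ : Circle) = 1 := by rw [← Circle.coe_mul, mul_inv_cancel]; rfl
      linear_combination L * z * h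
    rw [this, Complex.re_ofReal_mul]
  have hmB : MeasurableSet (starPatch 0) := measurableSet_starPatch 0
  have hI : ∀ x : ℂ, IntegrableOn (fun y => profile β ‖x - y‖) (starPatch 0) := fun x => by
    have := pot_integrable h0 h1 (isBddDensity_starPatch 0) x
    rw [← integrable_indicator_iff hmB]
    refine this.congr (Eventually.of_forall fun y => ?_)
    by_cases hy : y ∈ starPatch 0 <;> simp [hy]
  have hvol : volume.real (starPatch 0) = Real.pi := by
    rw [starPatch_zero, measureReal_def, Complex.volume_ball]
    simp
  have hfin : volume (starPatch 0) < ⊤ := by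
    rw [starPatch_zero]; exact measure_ball_lt_top
  set c : ℝ := ‖p‖ ^ (-2 - β) * (L * ((1 - o) * z).re) with hc
  have e : farTerm β L 0 o z + Real.pi * c =
      ∫ y in starPatch 0, (profile β ‖o * z + p - y‖ - profile β ‖p - y‖ + c) := by
    have hconst : IntegrableOn (fun _ : ℂ => c) (starPatch 0) := integrableOn_const hfin.ne
    have hd : IntegrableOn (fun y => profile β ‖o * z + p - y‖ - profile β ‖p - y‖)
      (starPatch 0) := (hI _).sub (hI _)
    rw [integral_add hd hconst, integral_sub (hI _) (hI _), setIntegral_const, hvol, smul_eq_mul,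
      ← pot_indicator β hmB, ← pot_indicator β hmB]
    rfl
  rw [e, ← Real.norm_eq_abs]
  refine (norm_setIntegral_le_of_norm_le_const (C := 85 * ‖p‖ ^ (-2 - β)) hfin
    fun y hy => ?_).trans ?_
  · rw [starPatch_zero, mem_ball_zero_iff] at hy
    have hoz : ‖(o : ℂ) * z‖ ≤ 1 := by rwa [norm_mul, Circle.norm_coe, one_mul]
    have hv : ‖(o : ℂ) * z - y‖ ≤ 2 := by linarith [norm_sub_le ((o : ℂ) * z) y]
    have t1 := profile_taylor h0 h1 hp0 (v := o * z - y) (by linarith)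
    have t2 := profile_taylor h0 h1 hp0 (v := -y) (by rw [norm_neg]; linarith)
    rw [show p + ((o : ℂ) * z - y) = o * z + p - y by ring] at t1
    rw [← sub_eq_add_neg, norm_neg] at t2
    have hsplit : ((o * z - y) * starRingEnd ℂ p).re = L * ((1 - o) * z).re +
        (-y * starRingEnd ℂ p).re := by
      rw [← hre, ← Complex.add_re]; congr 1; ring
    rw [hsplit] at t1
    have hP : 0 ≤ ‖p‖ ^ (-2 - β) := by positivity
    have b1 : 17 * ‖p‖ ^ (-2 - β) * ‖(o : ℂ) * z - y‖ ^ 2 ≤ 17 * ‖p‖ ^ (-2 - β) * 2 ^ 2 := by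
      gcongr
    have b2 : 17 * ‖p‖ ^ (-2 - β) * ‖y‖ ^ 2 ≤ 17 * ‖p‖ ^ (-2 - β) * 1 ^ 2 := by
      gcongr
    rw [Real.norm_eq_abs, hc]
    rw [abs_le] at t1 t2 ⊢
    constructor <;> nlinarith
  · rw [hvol]
    have hR0 : 0 < R := by linarith
    have : ‖p‖ ^ (-2 - β) ≤ R ^ (-2 - β) :=
      Real.rpow_le_rpow_of_nonpos hR0 (by linarith) (by linarith)
    nlinarith [Real.pi_pos]

/-! ### The combined field of the other vertices of the polygon -/

/-- The inverses of the nontrivial powers of the root of the polygon. -/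
def polygonInv (N m : ℕ) : Circle := (polygonRoot N ^ m)⁻¹

/-- The potential, up to a constant, of all the patches of the polygon but the first. -/
def farPot (β : ℝ) (N : ℕ) (L : ℝ) (u : C(Angles, ℝ)) (z : ℂ) : ℝ :=
  ∑ m ∈ Finset.Ico 1 N, farTerm β L u (polygonInv N m) z

/-- The parameter `R` is a lower bound for the distances of the polygon of size `L`. -/
def IsFar (N : ℕ) (L R : ℝ) : Prop :=
  4 ≤ R ∧ ∀ m ∈ Finset.Ico 1 N, 2 * R ≤ ‖(polygonInv N m : ℂ) - 1‖ * |L|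

theorem farTerm_conj {u : C(Angles, ℝ)} (hu : ∀ α, u (-α) = u α) (β L : ℝ) (o : Circle) (z : ℂ) :
    farTerm β L u o (starRingEnd ℂ z) = farTerm β L u o⁻¹ z := by
  have e1 : (o : ℂ) * starRingEnd ℂ z + (o - 1) * L =
      starRingEnd ℂ ((o⁻¹ : Circle) * z + ((o⁻¹ : Circle) - 1) * L) := by
    rw [Circle.coe_inv_eq_conj]; simp
  have e2 : ((o : ℂ) - 1) * L = starRingEnd ℂ (((o⁻¹ : Circle) - 1) * L) := by
    rw [Circle.coe_inv_eq_conj]; simp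
  rw [farTerm, farTerm, e1, e2, patchPot_conj hu, patchPot_conj hu]

/-- Conjugation turns the rotation o into its inverse, and the set of nontrivial rotations of the
polygon is closed under inversion. -/
theorem farPot_conj {N : ℕ} (hN : 0 < N) {u : C(Angles, ℝ)} (hu : ∀ α, u (-α) = u α) (β L : ℝ)
    (z : ℂ) : farPot β N L u (starRingEnd ℂ z) = farPot β N L u z := by
  have h := sum_polygonRoot_inv hN.ne' fun o => farTerm β L u o z
  rw [Finset.sum_range_eq_add_Ico _ hN, Finset.sum_range_eq_add_Ico _ hN] at h
  simp only [pow_zero, inv_one, add_right_inj] at h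
  simp only [farPot, farTerm_conj hu, polygonInv, inv_inv]
  exact h.symm

theorem abs_sum_Ico_le {N : ℕ} {f : ℕ → ℝ} {c : ℝ} (hc : 0 ≤ c)
    (h : ∀ m ∈ Finset.Ico 1 N, |f m| ≤ c) : |∑ m ∈ Finset.Ico 1 N, f m| ≤ N * c := by
  refine (Finset.abs_sum_le_sum_abs _ _).trans ((Finset.sum_le_card_nsmul _ _ _ h).trans ?_)
  rw [Nat.card_Ico, nsmul_eq_mul]
  gcongr
  omega

theorem IsFar.rpow_nonneg {N : ℕ} {L R : ℝ} (h : IsFar N L R) (p : ℝ) : 0 ≤ R ^ p :=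
  Real.rpow_nonneg (by linarith [h.1]) p

theorem farPot_lipschitz {β L R : ℝ} (h0 : 0 ≤ β) (h1 : β < 1) {N : ℕ} (hR : IsFar N L R)
    {u : C(Angles, ℝ)} (hu : ∀ α, |u α| ≤ 1 / 4) {z z' : ℂ} (hz : ‖z‖ ≤ 2) (hz' : ‖z'‖ ≤ 2) :
    |farPot β N L u z - farPot β N L u z'| ≤
      N * (2 * Real.pi * (R ^ (-1 - β) * ‖z - z'‖)) := by
  rw [farPot, farPot, ← Finset.sum_sub_distrib]
  have := hR.rpow_nonneg (-1 - β)
  exact abs_sum_Ico_le (by positivity) fun m hm =>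
    farTerm_lipschitz h0 h1 hR.1 (hR.2 m hm) hu hz hz'

theorem farPot_sub_le {β L R : ℝ} (h0 : 0 ≤ β) (h1 : β < 1) {N : ℕ} (hR : IsFar N L R)
    {u w : C(Angles, ℝ)} (hu : ∀ α, |u α| ≤ 1 / 4) (hw : ∀ α, |w α| ≤ 1 / 4) {K : ℝ}
    (hK : ∀ α, |u α - w α| ≤ K) {z : ℂ} (hz : ‖z‖ ≤ 2) :
    |farPot β N L u z - farPot β N L w z| ≤ N * (8 * Real.pi * (R ^ (-1 - β) * K)) := by
  rw [farPot, farPot, ← Finset.sum_sub_distrib]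
  have := hR.rpow_nonneg (-1 - β)
  have hK0 : 0 ≤ K := (abs_nonneg _).trans (hK 0)
  exact abs_sum_Ico_le (by positivity) fun m hm =>
    farTerm_sub_le h0 h1 hR.1 (hR.2 m hm) hu hw hK hz

/-- Minus the leading order force exerted on a disc by the other patches. -/
def farDrift (β : ℝ) (N : ℕ) (L : ℝ) : ℝ := ∑ m ∈ Finset.Ico 1 N,
  Real.pi * (‖((polygonInv N m : ℂ) - 1) * L‖ ^ (-2 - β) * (L * (1 - (polygonInv N m : ℂ).re)))

theorem abs_farDrift_le {β L R : ℝ} (h0 : 0 ≤ β) {N : ℕ} (hR : IsFar N L R) :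
    |farDrift β N L| ≤ N * (Real.pi * R ^ (-1 - β)) := by
  have hR1 := hR.rpow_nonneg (-1 - β)
  refine abs_sum_Ico_le (by positivity) fun m hm => ?_
  set o := polygonInv N m
  have hR0 := hR.1
  have h2 := hR.2 m hm
  have hp : ‖((o : ℂ) - 1) * L‖ = ‖(o : ℂ) - 1‖ * |L| := by
    rw [norm_mul, Complex.norm_real, Real.norm_eq_abs]
  have hp0 : 0 < ‖(o : ℂ) - 1‖ * |L| := by linarith
  have h3 : |1 - (o : ℂ).re| ≤ ‖(o : ℂ) - 1‖ := by
    have := Complex.abs_re_le_norm (1 - (o : ℂ))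
    rwa [norm_sub_rev, Complex.sub_re, Complex.one_re] at this
  rw [abs_mul, abs_of_pos Real.pi_pos, abs_mul, abs_mul, hp, abs_of_pos (by positivity)]
  gcongr
  calc (‖(o : ℂ) - 1‖ * |L|) ^ (-2 - β) * (|L| * |1 - (o : ℂ).re|)
      ≤ (‖(o : ℂ) - 1‖ * |L|) ^ (-2 - β) * (|L| * ‖(o : ℂ) - 1‖) := by gcongr
    _ = (‖(o : ℂ) - 1‖ * |L|) ^ (-2 - β) * (‖(o : ℂ) - 1‖ * |L|) := by rw [mul_comm |L|]
    _ = (‖(o : ℂ) - 1‖ * |L|) ^ (-1 - β) := by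
      rw [← Real.rpow_add_one hp0.ne']; congr 1; ring
    _ ≤ R ^ (-1 - β) :=
      Real.rpow_le_rpow_of_nonpos (by linarith) (by linarith) (by linarith)

/-- Averaging over z and its conjugate, which `farPot_conj` permits, removes the products of
imaginary parts: of each linear term only (1 − Re o) Re z survives. The leading field is thus a pure
cosine, which the centrifugal potential can cancel. -/
theorem farPot_zero_le {β L R : ℝ} (h0 : 0 ≤ β) (h1 : β < 1) {N : ℕ} (hN : 0 < N)
    (hR : IsFar N L R) (α : Angles) :
    |farPot β N L 0 (unitVec α) + farDrift β N L * (unitVec α).re| ≤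
      N * (85 * Real.pi * R ^ (-2 - β)) := by
  have hc := farPot_conj hN (u := 0) (fun _ => rfl) β L (unitVec α)
  have e : farPot β N L 0 (unitVec α) + farDrift β N L * (unitVec α).re =
      ∑ m ∈ Finset.Ico 1 N, (
      ((farTerm β L 0 (polygonInv N m) (unitVec α) + Real.pi *
        (‖((polygonInv N m : ℂ) - 1) * L‖ ^ (-2 - β) *
          (L * ((1 - polygonInv N m) * unitVec α).re))) +
       (farTerm β L 0 (polygonInv N m) (starRingEnd ℂ (unitVec α)) + Real.pi *
        (‖((polygonInv N m : ℂ) - 1) * L‖ ^ (-2 - β) *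
          (L * ((1 - polygonInv N m) * starRingEnd ℂ (unitVec α)).re)))) / 2) := by
    have e1 : farPot β N L 0 (unitVec α) =
        (farPot β N L 0 (unitVec α) + farPot β N L 0 (starRingEnd ℂ (unitVec α))) / 2 := by
      rw [hc]; ring
    rw [e1, farPot, farPot, farDrift, ← Finset.sum_add_distrib, Finset.sum_div, Finset.sum_mul,
      ← Finset.sum_add_distrib]
    refine Finset.sum_congr rfl fun m _ => ?_
    simp only [Complex.mul_re, Complex.sub_re, Complex.one_re, Complex.sub_im, Complex.one_im,
      Complex.conj_re, Complex.conj_im]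
    ring
  rw [e]
  have := hR.rpow_nonneg (-2 - β)
  refine abs_sum_Ico_le (by positivity) fun m hm => ?_
  have b1 := farTerm_zero_le h0 h1 hR.1 (hR.2 m hm) (norm_unitVec α).le
  have b2 := farTerm_zero_le h0 h1 hR.1 (hR.2 m hm) (z := starRingEnd ℂ (unitVec α))
    (by rw [RCLike.norm_conj, norm_unitVec])
  rw [abs_le] at b1 b2 ⊢
  constructor <;> linarith

/-! ### Existence of the equilibrium -/

/-- The perturbation of the unit circle with mode `1` restored. -/
def perturbation (x : C(Angles, ℝ) × ℝ × ℝ) : C(Angles, ℝ) := x.1 + x.2.1 • reMode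

/-- The boundary point of the patch in the direction `α`. -/
def boundaryPoint (u : C(Angles, ℝ)) (α : Angles) : ℂ := (1 + u α : ℝ) * unitVec α

/-- The potential, up to a constant, of the centrifugal force. -/
def centrifugal (L : ℝ) (z : ℂ) : ℝ := z.re + ‖z‖ ^ 2 / (2 * L)

theorem continuous_boundaryPoint (u : C(Angles, ℝ)) : Continuous (boundaryPoint u) :=
  (Complex.continuous_ofReal.comp (continuous_const.add u.continuous)).mul continuous_unitVec

theorem continuous_centrifugal (L : ℝ) : Continuous (centrifugal L) :=
  Complex.continuous_re.add ((continuous_norm.pow 2).div_const _)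

theorem continuous_patchPot {β : ℝ} (h0 : 0 ≤ β) (h1 : β < 1) (u : C(Angles, ℝ)) :
    Continuous (patchPot β u) := (contDiff_patchPot h0 h1 u).continuous

theorem continuous_farPot {β : ℝ} (h0 : 0 ≤ β) (h1 : β < 1) (N : ℕ) (L : ℝ) (u : C(Angles, ℝ)) :
    Continuous (farPot β N L u) := by
  have := continuous_patchPot h0 h1 u
  unfold farPot farTerm
  fun_prop

/-- The effective potential in the rotating frame along the boundary of the patch. -/
def boundaryLevel {β : ℝ} (h0 : 0 ≤ β) (h1 : β < 1) (N : ℕ) (L : ℝ)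
    (x : C(Angles, ℝ) × ℝ × ℝ) : C(Angles, ℝ) where
  toFun α := patchPot β (perturbation x) (boundaryPoint (perturbation x) α) +
    farPot β N L (perturbation x) (boundaryPoint (perturbation x) α) +
    -- The unknown λ is measured from the value balancing the leading force of the other patches, so
    -- that the unperturbed disc has a small residual.
    (x.2.2 + farDrift β N L) * centrifugal L (boundaryPoint (perturbation x) α)
  continuous_toFun := by
    have h := continuous_boundaryPoint (perturbation x)
    exact (((continuous_patchPot h0 h1 _).comp h).add ((continuous_farPot h0 h1 N L _).comp h)).add
      (continuous_const.mul ((continuous_centrifugal L).comp h))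

theorem boundaryLevel_apply {β : ℝ} (h0 : 0 ≤ β) (h1 : β < 1) (N : ℕ) (L : ℝ)
    (x : C(Angles, ℝ) × ℝ × ℝ) (α : Angles) : boundaryLevel h0 h1 N L x α =
    patchPot β (perturbation x) (boundaryPoint (perturbation x) α) +
    farPot β N L (perturbation x) (boundaryPoint (perturbation x) α) +
    (x.2.2 + farDrift β N L) * centrifugal L (boundaryPoint (perturbation x) α) := rfl

/-- The first moment of the patch, normalized. -/
def centroidDefect (x : C(Angles, ℝ) × ℝ × ℝ) : ℝ := cosMode ((1 + perturbation x) ^ 3) / 3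

theorem abs_re_unitVec_le (α : Angles) : |(unitVec α).re| ≤ 1 :=
  (Complex.abs_re_le_norm _).trans_eq (norm_unitVec α)

theorem abs_perturbation_sub_le (x y : C(Angles, ℝ) × ℝ × ℝ) (α : Angles) :
    |perturbation x α - perturbation y α| ≤ 2 * ‖x - y‖ := by
  have e : perturbation x α - perturbation y α =
      (x.1 - y.1) α + (x.2.1 - y.2.1) * (unitVec α).re := by
    simp [perturbation, reMode_apply]; ring
  rw [e]
  have h1 : |(x.1 - y.1) α| ≤ ‖x - y‖ := ((x.1 - y.1).norm_coe_le_norm α).trans (norm_fst_le (x - y))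
  have h2 : |x.2.1 - y.2.1| ≤ ‖x - y‖ := (norm_fst_le (x - y).2).trans (norm_snd_le (x - y))
  have h3 := abs_re_unitVec_le α
  refine (abs_add_le _ _).trans ?_
  rw [abs_mul]
  nlinarith [abs_nonneg (x.2.1 - y.2.1), abs_nonneg (unitVec α).re]

theorem perturbation_zero : perturbation 0 = 0 := by simp [perturbation]

theorem abs_perturbation_le (x : C(Angles, ℝ) × ℝ × ℝ) (α : Angles) :
    |perturbation x α| ≤ 2 * ‖x‖ := by
  simpa [perturbation_zero] using abs_perturbation_sub_le x 0 α

theorem perturbation_even {x : C(Angles, ℝ) × ℝ × ℝ} (hx : x.1 ∈ evenModes) (α : Angles) :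
    perturbation x (-α) = perturbation x α := by
  simp [perturbation, reMode_apply, unitVec_neg, hx.1 α]

theorem boundaryPoint_neg {u : C(Angles, ℝ)} (hu : ∀ α, u (-α) = u α) (α : Angles) :
    boundaryPoint u (-α) = starRingEnd ℂ (boundaryPoint u α) := by
  rw [boundaryPoint, boundaryPoint, hu, unitVec_neg, map_mul, Complex.conj_ofReal]

theorem boundaryLevel_even {β : ℝ} (h0 : 0 ≤ β) (h1 : β < 1) {N : ℕ} (hN : 0 < N) (L : ℝ)
    {x : C(Angles, ℝ) × ℝ × ℝ} (hx : x.1 ∈ evenModes) (α : Angles) :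
    boundaryLevel h0 h1 N L x (-α) = boundaryLevel h0 h1 N L x α := by
  have hu := perturbation_even hx
  rw [boundaryLevel_apply, boundaryLevel_apply, boundaryPoint_neg hu, patchPot_conj hu,
    farPot_conj hN hu, centrifugal, centrifugal, Complex.conj_re, RCLike.norm_conj]

theorem norm_boundaryPoint {u : C(Angles, ℝ)} {α : Angles} (hu : |u α| ≤ 1 / 4) :
    ‖boundaryPoint u α‖ = 1 + u α := by
  rw [boundaryPoint, norm_mul, norm_unitVec, mul_one, Complex.norm_real, Real.norm_eq_abs,
    abs_of_pos (by linarith [(abs_le.1 hu).1])]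

theorem norm_boundaryPoint_sub (u w : C(Angles, ℝ)) (α : Angles) :
    ‖boundaryPoint u α - boundaryPoint w α‖ = |u α - w α| := by
  rw [boundaryPoint, boundaryPoint, ← sub_mul, norm_mul, norm_unitVec, mul_one,
    ← Complex.ofReal_sub, Complex.norm_real, Real.norm_eq_abs, add_sub_add_left_eq_sub]

theorem centrifugal_boundaryPoint {u : C(Angles, ℝ)} {α : Angles} (hu : |u α| ≤ 1 / 4) (L : ℝ) :
    centrifugal L (boundaryPoint u α) = (1 + u α) * (unitVec α).re + (1 + u α) ^ 2 / (2 * L) := by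
  rw [centrifugal, norm_boundaryPoint hu, boundaryPoint, Complex.re_ofReal_mul]

theorem abs_centrifugal_sub_le {L : ℝ} (hL : 4 ≤ |L|) {u w : C(Angles, ℝ)} {α : Angles}
    (hu : |u α| ≤ 1 / 4) (hw : |w α| ≤ 1 / 4) :
    |centrifugal L (boundaryPoint u α) - centrifugal L (boundaryPoint w α)| ≤
      2 * |u α - w α| := by
  rw [centrifugal_boundaryPoint hu, centrifugal_boundaryPoint hw]
  have e : (1 + u α) * (unitVec α).re + (1 + u α) ^ 2 / (2 * L) -
      ((1 + w α) * (unitVec α).re + (1 + w α) ^ 2 / (2 * L)) =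
      (u α - w α) * ((unitVec α).re + (2 + u α + w α) * (2 * L)⁻¹) := by
    ring
  rw [e, abs_mul, mul_comm]
  gcongr
  have h1 := abs_re_unitVec_le α
  have h2 : |(2 * L)⁻¹| ≤ 1 / 8 := by
    rw [abs_inv, abs_mul, abs_two, inv_eq_one_div]
    apply one_div_le_one_div_of_le <;> linarith
  have h3 : |2 + u α + w α| ≤ 5 / 2 := by
    rw [abs_le] at hu hw ⊢
    constructor <;> linarith
  refine (abs_add_le _ _).trans ?_
  rw [abs_mul]
  nlinarith [abs_nonneg (2 * L)⁻¹, abs_nonneg (2 + u α + w α)]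

theorem IsFar.le_abs {N : ℕ} (hN : 2 ≤ N) {L R : ℝ} (h : IsFar N L R) : R ≤ |L| := by
  have h1 := h.2 1 (Finset.mem_Ico.2 ⟨le_rfl, by omega⟩)
  have h2 : ‖(polygonInv N 1 : ℂ) - 1‖ ≤ 2 := by
    have := norm_sub_le (polygonInv N 1 : ℂ) 1
    rw [Circle.norm_coe, norm_one] at this
    linarith
  nlinarith [abs_nonneg L]

theorem layerPot_perturbation_sub {β : ℝ} (h0 : 0 ≤ β) (h1 : β < 1) (x y : C(Angles, ℝ) × ℝ × ℝ)
    (α : Angles) : layerPot β (fun η => perturbation x η - perturbation y η) α =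
      layerPot β (x.1 - y.1) α + (x.2.1 - y.2.1) * (layerEig β * (unitVec α).re) := by
  have i1 : Integrable fun η => layerKernel β (α - η) * (⇑x.1 - ⇑y.1) η :=
    integrable_layerPot h0 h1 α (x.1 - y.1).continuous
  have i2 := (integrable_layerPot h0 h1 α continuous_re_unitVec).const_mul (x.2.1 - y.2.1)
  rw [← layerPot_re h0 h1, layerPot, layerPot, layerPot, ← integral_const_mul,
    ← integral_add i1 i2]
  refine integral_congr_ae (Eventually.of_forall fun η => ?_)
  simp [perturbation, reMode_apply]
  ring

/-- The unknown b drops out of the linear part: −a b cos from the radial slope cancels the layer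
potential of b cos. The unknown λ contributes its cosine and the constant λ/(2L). Of the errors, 2c
comes from the patch itself, 8δ from products of λ with the perturbation, and the last term from the
other patches and the drift (16π + 4π + 4π). -/
theorem boundaryLevel_sub_le {β : ℝ} (h0 : 0 ≤ β) (h1 : β < 1) {N : ℕ} (hN : 2 ≤ N) {L R : ℝ}
    (hR : IsFar N L R) {x y : C(Angles, ℝ) × ℝ × ℝ} {δ c : ℝ} (hx : ‖x‖ ≤ δ) (hy : ‖y‖ ≤ δ)
    (hδ : δ ≤ 1 / 8) {α : Angles}
    (hpot : |patchPot β (perturbation x) (boundaryPoint (perturbation x) α) -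
      patchPot β (perturbation y) (boundaryPoint (perturbation y) α) +
        layerEig β * (perturbation x α - perturbation y α) -
        layerPot β (fun η => perturbation x η - perturbation y η) α| ≤ c * (2 * ‖x - y‖)) :
    |boundaryLevel h0 h1 N L x α - boundaryLevel h0 h1 N L y α -
      (-layerEig β * (x.1 - y.1) α + layerPot β (x.1 - y.1) α +
          (x.2.2 - y.2.2) * (unitVec α).re + (x.2.2 - y.2.2) * (2 * L)⁻¹)| ≤
      (2 * c + 8 * δ + 24 * Real.pi * N * R ^ (-1 - β)) * ‖x - y‖ := by
  set u := perturbation x with hu_def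
  set w := perturbation y with hw_def
  set D := ‖x - y‖ with hD
  have hD0 : 0 ≤ D := norm_nonneg _
  have hu2 : ∀ η, |u η| ≤ 2 * δ := fun η => (abs_perturbation_le x η).trans (by linarith)
  have hw2 : ∀ η, |w η| ≤ 2 * δ := fun η => (abs_perturbation_le y η).trans (by linarith)
  have hu : ∀ η, |u η| ≤ 1 / 4 := fun η => (hu2 η).trans (by linarith)
  have hw : ∀ η, |w η| ≤ 1 / 4 := fun η => (hw2 η).trans (by linarith)
  have hK : ∀ η, |u η - w η| ≤ 2 * D := abs_perturbation_sub_le x y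
  have hδ0 : 0 ≤ δ := (norm_nonneg x).trans hx
  have hL : 4 ≤ |L| := hR.1.trans (hR.le_abs hN)
  have hnu : ‖boundaryPoint u α‖ ≤ 2 := by
    rw [norm_boundaryPoint (hu α)]; linarith [(abs_le.1 (hu α)).2]
  have hnw : ‖boundaryPoint w α‖ ≤ 2 := by
    rw [norm_boundaryPoint (hw α)]; linarith [(abs_le.1 (hw α)).2]
  have hRp := hR.rpow_nonneg (-1 - β)
  set S := R ^ (-1 - β) with hS
  have hf1 := farPot_sub_le h0 h1 hR hu hw hK hnu
  have hf2 := farPot_lipschitz h0 h1 hR hw hnu hnw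
  rw [norm_boundaryPoint_sub] at hf2
  have hf2' : |farPot β N L w (boundaryPoint u α) - farPot β N L w (boundaryPoint w α)| ≤
      N * (2 * Real.pi * (S * (2 * D))) := hf2.trans (by gcongr; exact hK α)
  have hdr := abs_farDrift_le (L := L) h0 hR
  have hyl : |y.2.2 + farDrift β N L| ≤ δ + N * (Real.pi * S) := by
    refine (abs_add_le _ _).trans (add_le_add ?_ hdr)
    exact ((norm_snd_le y.2).trans (norm_snd_le y)).trans hy
  have hxl : |x.2.2 - y.2.2| ≤ D := (norm_snd_le (x - y).2).trans (norm_snd_le (x - y))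
  have hc1 := (abs_centrifugal_sub_le hL (hu α) (hw α)).trans
    (mul_le_mul_of_nonneg_left (hK α) zero_le_two)
  have hc0 := abs_centrifugal_sub_le hL (hu α) (w := 0) (α := α) (by simp)
  have hz : centrifugal L (boundaryPoint 0 α) = (unitVec α).re + (2 * L)⁻¹ := by
    rw [centrifugal_boundaryPoint (by simp)]
    simp
  rw [hz, ContinuousMap.zero_apply, sub_zero] at hc0
  have hlay := layerPot_perturbation_sub h0 h1 x y α
  rw [← hu_def, ← hw_def] at hlay
  rw [hlay] at hpot
  have hpert : u α - w α = (x.1 - y.1) α + (x.2.1 - y.2.1) * (unitVec α).re := by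
    simp [hu_def, hw_def, perturbation, reMode_apply]; ring
  set A := patchPot β u (boundaryPoint u α) - patchPot β w (boundaryPoint w α) +
    layerEig β * (u α - w α) - (layerPot β (x.1 - y.1) α +
      (x.2.1 - y.2.1) * (layerEig β * (unitVec α).re)) with hA
  have hsplit : boundaryLevel h0 h1 N L x α - boundaryLevel h0 h1 N L y α -
      (-layerEig β * (x.1 - y.1) α + layerPot β (x.1 - y.1) α +
          (x.2.2 - y.2.2) * (unitVec α).re + (x.2.2 - y.2.2) * (2 * L)⁻¹) =
      A + (farPot β N L u (boundaryPoint u α) - farPot β N L w (boundaryPoint u α)) +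
      (farPot β N L w (boundaryPoint u α) - farPot β N L w (boundaryPoint w α)) +
      (x.2.2 - y.2.2) * (centrifugal L (boundaryPoint u α) - ((unitVec α).re + (2 * L)⁻¹)) +
      (y.2.2 + farDrift β N L) * (centrifugal L (boundaryPoint u α) -
        centrifugal L (boundaryPoint w α)) := by
    rw [boundaryLevel_apply, boundaryLevel_apply, ← hu_def, ← hw_def, hA, hpert]
    ring
  rw [hsplit]
  have p1 : |(x.2.2 - y.2.2) * (centrifugal L (boundaryPoint u α) -
      ((unitVec α).re + (2 * L)⁻¹))| ≤ D * (2 * (2 * δ)) := by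
    rw [abs_mul]
    exact mul_le_mul hxl (hc0.trans (by linarith [hu2 α])) (abs_nonneg _) hD0
  have p2 : |(y.2.2 + farDrift β N L) * (centrifugal L (boundaryPoint u α) -
        centrifugal L (boundaryPoint w α))| ≤ (δ + N * (Real.pi * S)) * (2 * (2 * D)) := by
    rw [abs_mul]
    exact mul_le_mul hyl hc1 (abs_nonneg _) (by positivity)
  refine (abs_add_le _ _).trans ((add_le_add ((abs_add_le _ _).trans (add_le_add
    ((abs_add_le _ _).trans (add_le_add ((abs_add_le _ _).trans (add_le_add hpot hf1)) hf2')) p1))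
    p2).trans (le_of_eq ?_))
  ring

/-- The cosine mode of the perturbation is exactly b, and ((1 + u)³ − (1 + w)³)/3 differs from u − w
by (u − w) times a factor that is O(δ). -/
theorem centroidDefect_sub_le {x y : C(Angles, ℝ) × ℝ × ℝ} (hx1 : x.1 ∈ evenModes)
    (hy1 : y.1 ∈ evenModes) {δ : ℝ} (hx : ‖x‖ ≤ δ) (hy : ‖y‖ ≤ δ) (hδ : δ ≤ 1 / 8) :
    |centroidDefect x - centroidDefect y - (x.2.1 - y.2.1)| ≤ 24 * δ * ‖x - y‖ := by
  set u := perturbation x with hu_def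
  set w := perturbation y with hw_def
  have hu2 : ∀ η, |u η| ≤ 2 * δ := fun η => (abs_perturbation_le x η).trans (by linarith)
  have hw2 : ∀ η, |w η| ≤ 2 * δ := fun η => (abs_perturbation_le y η).trans (by linarith)
  have hK : ∀ η, |u η - w η| ≤ 2 * ‖x - y‖ := abs_perturbation_sub_le x y
  have hδ0 : 0 ≤ δ := (norm_nonneg x).trans hx
  have hcu : cosMode u = x.2.1 := by
    rw [hu_def, perturbation, map_add, map_smul, cosMode_reMode, hx1.2.2]; simp
  have hcw : cosMode w = y.2.1 := by
    rw [hw_def, perturbation, map_add, map_smul, cosMode_reMode, hy1.2.2]; simp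
  set r : C(Angles, ℝ) := (1 / 3 : ℝ) • ((1 + u) ^ 3 - (1 + w) ^ 3) - (u - w) with hr
  have e : centroidDefect x - centroidDefect y - (x.2.1 - y.2.1) = cosMode r := by
    rw [hr, map_sub, map_smul, map_sub, map_sub, hcu, hcw, centroidDefect, centroidDefect,
      smul_eq_mul]
    ring
  rw [e]
  refine (abs_cosMode_le r).trans ?_
  have hrn : ‖r‖ ≤ 12 * δ * ‖x - y‖ := by
    refine (ContinuousMap.norm_le _ (by positivity)).2 fun η => ?_
    have e2 : r η = (u η - w η) * (u η + w η + (u η ^ 2 + u η * w η + w η ^ 2) / 3) := by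
      simp [hr]; ring
    rw [e2, Real.norm_eq_abs, abs_mul]
    have h3 : |u η + w η + (u η ^ 2 + u η * w η + w η ^ 2) / 3| ≤ 6 * δ := by
      have a1 := hu2 η
      have a2 := hw2 η
      rw [abs_le] at a1 a2 ⊢
      have b1 : u η ^ 2 ≤ (2 * δ) * (2 * δ) := by nlinarith
      have b2 : w η ^ 2 ≤ (2 * δ) * (2 * δ) := by nlinarith
      have b3 : (2 * δ) * (2 * δ) ≤ δ / 2 := by nlinarith
      constructor <;> nlinarith [sq_nonneg (u η + w η), sq_nonneg (u η - w η)]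
    calc |u η - w η| * |u η + w η + (u η ^ 2 + u η * w η + w η ^ 2) / 3|
        ≤ (2 * ‖x - y‖) * (6 * δ) := mul_le_mul (hK η) h3 (abs_nonneg _) (by positivity)
      _ = _ := by ring
  linarith

theorem exists_polygonInv_gap {N : ℕ} (hN : 2 ≤ N) :
    ∃ κ > 0, ∀ m ∈ Finset.Ico 1 N, κ ≤ ‖(polygonInv N m : ℂ) - 1‖ := by
  have hne : (Finset.Ico 1 N).Nonempty := ⟨1, Finset.mem_Ico.2 ⟨le_rfl, by omega⟩⟩
  obtain ⟨m, hm, hmin⟩ := Finset.exists_min_image _ (fun m => ‖(polygonInv N m : ℂ) - 1‖) hne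
  refine ⟨_, norm_pos_iff.2 (sub_ne_zero.2 fun h => ?_), hmin⟩
  rw [Finset.mem_Ico] at hm
  have h1 : polygonRoot N ^ m = 1 := by
    rw [← inv_eq_one]
    exact Circle.ext h
  have h2 := congrArg (fun z : Circle => (z : ℂ)) h1
  simp only [polygonRoot_pow_coe, Circle.coe_one] at h2
  refine (Complex.isPrimitiveRoot_exp N (by omega)).pow_ne_one_of_pos_of_lt (by omega) hm.2 ?_
  rw [← Complex.exp_nat_mul, ← h2]
  congr 1
  ring

/-- Existence of the perturbation of the disc along whose boundary the effective potential is
constant. -/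
theorem exists_equilibrium {β : ℝ} (h0 : 0 ≤ β) (h1 : β < 1) {l : ℝ} (hl : l ≠ 0) {N : ℕ}
    (hN : 2 ≤ N) {c : ℝ} (hc : 0 < c) : ∃ ε₀ > 0, ∀ ε, 0 < ε → ε < ε₀ → 4 ≤ |l / ε| ∧
      ∃ (u : C(Angles, ℝ)) (μ k : ℝ), (∀ α, u (-α) = u α) ∧ (∀ α, |u α| ≤ ε ^ (1 + β) / 2) ∧
      (∀ α, |u α| ≤ c) ∧ |μ| ≤ c ∧ cosMode ((1 + u) ^ 3) = 0 ∧
      (∀ z z' : ℂ, ‖z‖ ≤ 2 → ‖z'‖ ≤ 2 →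
        |farPot β N (l / ε) u z - farPot β N (l / ε) u z'| ≤ c * ‖z - z'‖) ∧
      ∀ α, patchPot β u (boundaryPoint u α) + farPot β N (l / ε) u (boundaryPoint u α) +
        μ * centrifugal (l / ε) (boundaryPoint u α) = k := by
  obtain ⟨c₁, hc₁, C, hC, hsol⟩ := exists_reduced_solution h0 h1
  -- The error budget c₁ is split into thirds: 2·c₁/6 from the patch itself (the perturbations
  -- differ by at most twice the distance of the unknowns), 8δ, and the term decaying in R.
  obtain ⟨δ₁, hδ₁, hδ₁4, hpot⟩ := exists_patchPot_boundary h0 h1 (c := c₁ / 6) (by positivity)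
  obtain ⟨κ, hκ, hgap⟩ := exists_polygonInv_gap hN
  have hπ := Real.pi_pos
  have hN0 : (0 : ℝ) < N := by exact_mod_cast (by omega : 0 < N)
  set δ := min (δ₁ / 2) (min (c₁ / 24) (c / 2)) with hδ_def
  have hδ : 0 < δ := by positivity
  have hδa : δ ≤ δ₁ / 2 := min_le_left _ _
  have hδb : δ ≤ c₁ / 24 := (min_le_right _ _).trans (min_le_left _ _)
  have hδc : δ ≤ c / 2 := (min_le_right _ _).trans (min_le_right _ _)
  -- The second entry makes 24πN/R₀ at most c₁/3; the third makes 2πN/R₀ at most c, which controls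
  -- both the slope of the far field and, with δ ≤ c/2, the size of μ.
  set R₀ : ℝ := max 4 (max (72 * Real.pi * N / c₁) (2 * Real.pi * N / c)) with hR₀
  have hR₀4 : 4 ≤ R₀ := le_max_left _ _
  have hR₀a : 72 * Real.pi * N / c₁ ≤ R₀ := (le_max_left _ _).trans (le_max_right _ _)
  have hR₀b : 2 * Real.pi * N / c ≤ R₀ := (le_max_right _ _).trans (le_max_right _ _)
  set r : ℝ := κ * |l| / 2 with hr
  have hl' : 0 < |l| := abs_pos.2 hl
  have hr0 : 0 < r := by positivity
  set B : ℝ := C * (N * (85 * Real.pi * r ^ (-2 - β))) with hB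
  have hB0 : 0 < B := by positivity
  -- The first two bounds give ρ = ε^(1+β)/4 ≤ δ, the third gives R ≥ R₀, and the last gives Bε ≤
  -- 1/4: the residual is of order ε^(2+β), and this spare factor ε brings it below ρ.
  refine ⟨min (min 1 (4 * δ)) (min (r / R₀) (1 / (4 * B))), by positivity, fun ε hε hlt => ?_⟩
  have hε1 : ε ≤ 1 := hlt.le.trans ((min_le_left _ _).trans (min_le_left _ _))
  have hεδ : ε ≤ 4 * δ := hlt.le.trans ((min_le_left _ _).trans (min_le_right _ _))
  have hεR : ε ≤ r / R₀ := hlt.le.trans ((min_le_right _ _).trans (min_le_left _ _))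
  have hεB : ε ≤ 1 / (4 * B) := hlt.le.trans ((min_le_right _ _).trans (min_le_right _ _))
  set L := l / ε with hL
  set R := r / ε with hR_def
  have hRR₀ : R₀ ≤ R := by
    rw [hR_def, le_div_iff₀ hε]
    rw [le_div_iff₀ (by linarith)] at hεR
    linarith
  have hR0 : 0 < R := by positivity
  have hfar : IsFar N L R := by
    refine ⟨hR₀4.trans hRR₀, fun m hm => ?_⟩
    rw [hL, abs_div, abs_of_pos hε, hR_def, hr]
    calc 2 * (κ * |l| / 2 / ε) = κ * (|l| / ε) := by ring
      _ ≤ _ := by gcongr; exact hgap m hm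
  have hS : R ^ (-1 - β) ≤ R₀⁻¹ := by
    calc R ^ (-1 - β) ≤ R ^ (-1 : ℝ) :=
          Real.rpow_le_rpow_of_exponent_le (by linarith) (by linarith)
      _ = R⁻¹ := Real.rpow_neg_one R
      _ ≤ R₀⁻¹ := inv_anti₀ (by linarith) hRR₀
  have hS1 : 24 * Real.pi * N * R ^ (-1 - β) ≤ c₁ / 3 := by
    rw [div_le_iff₀ hc₁] at hR₀a
    calc 24 * Real.pi * N * R ^ (-1 - β) ≤ 24 * Real.pi * N * R₀⁻¹ := by gcongr
      _ ≤ c₁ / 3 := by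
        rw [← div_eq_mul_inv, div_le_iff₀ (by linarith)]; linarith
  have hS2 : 2 * Real.pi * N * R ^ (-1 - β) ≤ c := by
    rw [div_le_iff₀ hc] at hR₀b
    calc 2 * Real.pi * N * R ^ (-1 - β) ≤ 2 * Real.pi * N * R₀⁻¹ := by gcongr
      _ ≤ c := by
        rw [← div_eq_mul_inv, div_le_iff₀ (by linarith)]; linarith
  set ρ := ε ^ (1 + β) / 4 with hρ
  have hρ0 : 0 < ρ := by positivity
  have hρδ : ρ ≤ δ := by
    have : ε ^ (1 + β) ≤ ε ^ (1 : ℝ) :=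
      Real.rpow_le_rpow_of_exponent_ge hε hε1 (by linarith)
    rw [Real.rpow_one] at this
    rw [hρ]; linarith
  have hδ8 : δ ≤ 1 / 8 := by linarith
  have hη : C * (N * (85 * Real.pi * R ^ (-2 - β))) ≤ ρ := by
    have e : R ^ (-2 - β) = r ^ (-2 - β) * (ε ^ (1 + β) * ε) := by
      rw [hR_def, Real.div_rpow hr0.le hε.le, div_eq_mul_inv, ← Real.rpow_neg hε.le,
        ← Real.rpow_add_one hε.ne']
      congr 2
      ring
    have hεB' : B * ε ≤ 1 / 4 := by
      rw [le_div_iff₀ (by positivity)] at hεB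
      linarith
    calc C * (N * (85 * Real.pi * R ^ (-2 - β))) = ε ^ (1 + β) * (B * ε) := by
          rw [e, hB]; ring
      _ ≤ ε ^ (1 + β) * (1 / 4) := by gcongr
      _ = ρ := by rw [hρ]; ring
  have hnorm : ∀ x ∈ reducedBall ρ, ‖x‖ ≤ δ := fun x hx => hx.2.trans hρδ
  obtain ⟨x, hx, ⟨k, hk⟩, hM⟩ := hsol (boundaryLevel h0 h1 N L) centroidDefect ρ _ hρ0.le hη
    ⟨patchPot β 0 (1 : ℝ) + farDrift β N L * (2 * L)⁻¹, fun α => by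
      have h2 := farPot_zero_le h0 h1 (by omega) hfar α
      have h3 := patchPot_zero_radial β 1 α
      have hz : centrifugal L (boundaryPoint 0 α) = (unitVec α).re + (2 * L)⁻¹ := by
        rw [centrifugal_boundaryPoint (by simp)]
        simp
      have hb : boundaryPoint 0 α = unitVec α := by simp [boundaryPoint]
      rw [boundaryLevel_apply, perturbation_zero, hz, hb]
      rw [Complex.ofReal_one, one_mul] at h3
      rw [h3, Complex.ofReal_one]
      convert h2 using 2
      simp
      ring⟩
    (by rw [centroidDefect, perturbation_zero, add_zero, one_pow]
        have := cosMode_const 1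
        rw [show (1 : C(Angles, ℝ)) = ContinuousMap.const _ 1 from rfl, this, zero_div])
    (fun x hx α => boundaryLevel_even h0 h1 (by omega) L hx.1 α)
    (fun x hx y hy => ⟨(x.2.2 - y.2.2) * (2 * L)⁻¹, fun α => by
      have hxn := hnorm x hx
      have hyn := hnorm y hy
      refine (boundaryLevel_sub_le h0 h1 hN hfar hxn hyn hδ8 (hpot _ _ _
        (fun η => (abs_perturbation_le x η).trans (by linarith))
        (fun η => (abs_perturbation_le y η).trans (by linarith))
        (abs_perturbation_sub_le x y) α)).trans ?_
      gcongr
      linarith⟩)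
    (fun x hx y hy => (centroidDefect_sub_le hx.1 hy.1 (hnorm x hx) (hnorm y hy) hδ8).trans (by
      gcongr
      linarith))
  have hup : ∀ α, |perturbation x α| ≤ ε ^ (1 + β) / 2 := fun α =>
    (abs_perturbation_le x α).trans (by have := hx.2; rw [hρ] at this; linarith)
  have hup2 : ∀ α, |perturbation x α| ≤ 2 * δ := fun α =>
    (hup α).trans (by rw [hρ] at hρδ; linarith)
  refine ⟨(hR₀4.trans hRR₀).trans (hfar.le_abs hN), perturbation x, x.2.2 + farDrift β N L, k,
    perturbation_even hx.1, hup, fun α => (hup2 α).trans (by linarith), ?_, ?_, ?_, hk⟩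
  · have a1 := abs_farDrift_le (L := L) h0 hfar
    have a2 : |x.2.2| ≤ δ := ((norm_snd_le x.2).trans (norm_snd_le x)).trans (hnorm x hx)
    refine (abs_add_le _ _).trans ?_
    linarith
  · rw [centroidDefect] at hM
    linarith
  · intro z z' hz hz'
    refine (farPot_lipschitz h0 h1 hfar (fun α => (hup2 α).trans (by linarith)) hz hz').trans ?_
    calc (N : ℝ) * (2 * Real.pi * (R ^ (-1 - β) * ‖z - z'‖)) =
        (2 * Real.pi * N * R ^ (-1 - β)) * ‖z - z'‖ := by ring
      _ ≤ _ := by gcongr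

/-! ### Star-shaped patches as domains -/

theorem ball_subset_starPatch {u : C(Angles, ℝ)} {δ : ℝ} (hu : ∀ α, |u α| ≤ δ) :
    Metric.ball 0 (1 - δ) ⊆ starPatch u := fun z hz => by
  rw [mem_ball_zero_iff] at hz
  change ‖z‖ < 1 + u (angle z)
  linarith [(abs_le.1 (hu (angle z))).1]

theorem isOpen_starPatch {u : C(Angles, ℝ)} (hu : ∀ α, |u α| ≤ 1 / 4) : IsOpen (starPatch u) := by
  rw [isOpen_iff_mem_nhds]
  intro z hz
  rcases eq_or_ne z 0 with rfl | hz0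
  · exact mem_of_superset (Metric.ball_mem_nhds 0 (by norm_num)) (ball_subset_starPatch hu)
  · exact continuous_norm.continuousAt.eventually_lt
      (continuousAt_const.add (u.continuous.continuousAt.comp (continuousAt_angle hz0))) hz

theorem frontier_starPatch_subset {u : C(Angles, ℝ)} (hu : ∀ α, |u α| ≤ 1 / 4) :
    frontier (starPatch u) ⊆ range (boundaryPoint u) := fun z hz => by
  rw [(isOpen_starPatch hu).frontier_eq] at hz
  obtain ⟨hcl, hnot⟩ := hz
  have hz0 : z ≠ 0 := by
    rintro rfl
    exact hnot (ball_subset_starPatch hu (by simp; norm_num))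
  have hle : 1 + u (angle z) ≤ ‖z‖ := not_lt.1 hnot
  have heq : 1 + u (angle z) = ‖z‖ := by
    refine hle.eq_of_not_lt fun hlt => ?_
    have h : ∀ᶠ y in 𝓝 z, 1 + u (angle y) < ‖y‖ :=
      (continuousAt_const.add (u.continuous.continuousAt.comp
        (continuousAt_angle hz0))).eventually_lt continuous_norm.continuousAt hlt
    obtain ⟨y, hy1, hy2⟩ := mem_closure_iff_nhds.1 hcl _ h
    have hy3 : ‖y‖ < 1 + u (angle y) := hy2
    exact lt_asymm hy1 hy3
  exact ⟨angle z, by rw [boundaryPoint, heq, norm_mul_unitVec]⟩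

theorem starConvex_starPatch {u : C(Angles, ℝ)} (hu : ∀ α, |u α| ≤ 1 / 4) :
    StarConvex ℝ 0 (starPatch u) := by
  rw [starConvex_zero_iff]
  intro z hz t ht0 ht1
  have hz : ‖z‖ < 1 + u (angle z) := hz
  have hle : ‖t • z‖ ≤ ‖z‖ := by
    rw [norm_smul, Real.norm_of_nonneg ht0]
    exact mul_le_of_le_one_left (norm_nonneg z) ht1
  rcases eq_or_ne (t • z) 0 with h | h
  · rw [h]
    exact ball_subset_starPatch hu (by simp; norm_num)
  · have ht : 0 < t := lt_of_le_of_ne ht0 fun h' => h (by rw [← h', zero_smul])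
    have hz0 : z ≠ 0 := fun h' => h (by rw [h', smul_zero])
    have ha : angle (t • z) = angle z := by
      have h1 : t • z = ((t * ‖z‖ : ℝ) : ℂ) * unitVec (angle z) := by
        rw [Complex.ofReal_mul, mul_assoc, norm_mul_unitVec, Complex.real_smul]
      rw [h1, angle_mul_unitVec (mul_pos ht (norm_pos_iff.2 hz0))]
    change ‖t • z‖ < 1 + u (angle (t • z))
    rw [ha]
    exact hle.trans_lt hz

theorem isSimplyConnected_starPatch {u : C(Angles, ℝ)} (hu : ∀ α, |u α| ≤ 1 / 4) :
    IsSimplyConnected (starPatch u) := by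
  have := (starConvex_starPatch hu).contractibleSpace
    ⟨0, ball_subset_starPatch hu (by simp; norm_num)⟩
  change SimplyConnectedSpace (starPatch u)
  infer_instance

/-- In polar coordinates the moment is ∫ (1 + u)³/3 · e^(iα). Its real part is the prescribed cosine
mode and its imaginary part vanishes by evenness. -/
theorem integral_starPatch_id {u : C(Angles, ℝ)} (hu : ∀ α, |u α| ≤ 1 / 4)
    (heven : ∀ α, u (-α) = u α) (hcos : cosMode ((1 + u) ^ 3) = 0) : ∫ z in starPatch u, z = 0 := by
  have hu1 : ∀ α, -1 < u α := fun α => by linarith [(abs_le.1 (hu α)).1]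
  have hi : IntegrableOn (fun z : ℂ => z) (starPatch u) :=
    (continuous_id.continuousOn.integrableOn_compact (isCompact_closedBall 0 2)).mono_set
      ((starPatch_subset_ball hu).trans (Metric.ball_subset_closedBall.trans
        (Metric.closedBall_subset_closedBall (by norm_num))))
  rw [(integral_starPatch hu1 hi).2]
  have e : ∀ α, ∫ r in (0 : ℝ)..1 + u α, r • ((r : ℂ) * unitVec α) =
      (((1 + u α) ^ 3 / 3 : ℝ) : ℂ) * unitVec α := fun α => by
    have : ∀ r : ℝ, r • ((r : ℂ) * unitVec α) = ((r ^ 2 : ℝ) : ℂ) * unitVec α := fun r => by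
      rw [Complex.real_smul]; push_cast; ring
    simp only [this]
    rw [intervalIntegral.integral_mul_const, intervalIntegral.integral_ofReal, integral_pow]
    norm_num
  simp only [e]
  have hcont : Continuous fun α => (((1 + u α) ^ 3 / 3 : ℝ) : ℂ) * unitVec α :=
    (Complex.continuous_ofReal.comp (by fun_prop)).mul continuous_unitVec
  have hint : Integrable fun α => (((1 + u α) ^ 3 / 3 : ℝ) : ℂ) * unitVec α :=
    hcont.integrable_of_hasCompactSupport (HasCompactSupport.of_compactSpace _)
  apply Complex.ext
  · have h1 := Complex.reCLM.integral_comp_comm hint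
    simp only [Complex.reCLM_apply, Complex.re_ofReal_mul] at h1
    rw [← h1]
    rw [cosMode_apply] at hcos
    have h2 : ∫ η, (1 + u η) ^ 3 * (unitVec η).re = 0 := by
      simpa [Real.pi_ne_zero] using hcos
    simp only [div_mul_eq_mul_div, integral_div, h2, zero_div, Complex.zero_re]
  · have h1 := Complex.imCLM.integral_comp_comm hint
    simp only [Complex.imCLM_apply, Complex.im_ofReal_mul] at h1
    rw [← h1]
    exact integral_mul_im_of_even fun α => by rw [heven]

/-! ### Affine images -/

/-- The homothety `z ↦ p + ε z`. -/
def homothety (p : ℂ) {ε : ℝ} (hε : 0 < ε) : ℂ ≃ₜ ℂ :=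
  (Homeomorph.mulLeft₀ (ε : ℂ) (by exact_mod_cast hε.ne')).trans (Homeomorph.addLeft p)

theorem homothety_apply (p : ℂ) {ε : ℝ} (hε : 0 < ε) (z : ℂ) :
    homothety p hε z = p + ε * z := rfl

theorem homothety_symm_apply (p : ℂ) {ε : ℝ} (hε : 0 < ε) (x : ℂ) :
    (homothety p hε).symm x = (x - p) / ε := by
  have hε' : (ε : ℂ) ≠ 0 := by exact_mod_cast hε.ne'
  rw [Homeomorph.symm_apply_eq, homothety_apply]
  field_simp
  ring

theorem mem_homothety_image (p : ℂ) {ε : ℝ} (hε : 0 < ε) (S : Set ℂ) (x : ℂ) :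
    x ∈ homothety p hε '' S ↔ (x - p) / ε ∈ S := by
  rw [Homeomorph.image_eq_preimage_symm, mem_preimage, homothety_symm_apply]

theorem norm_homothety_symm (p : ℂ) {ε : ℝ} (hε : 0 < ε) (x : ℂ) :
    ‖(x - p) / ε‖ = ‖x - p‖ / ε := by
  rw [norm_div, Complex.norm_real, Real.norm_of_nonneg hε.le]

theorem HasC1Boundary.homothety_image {S : Set ℂ} (hS : HasC1Boundary S) (p : ℂ) {ε : ℝ}
    (hε : 0 < ε) : HasC1Boundary (homothety p hε '' S) := by
  intro q hq
  rw [← Homeomorph.image_frontier] at hq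
  obtain ⟨z, hz, rfl⟩ := hq
  obtain ⟨U, ρ, hU, hzU, hρ, hd, hD⟩ := hS z hz
  have hUo : IsOpen (homothety p hε '' U) := (Homeomorph.isOpen_image _).2 hU
  have hψ : ContDiff ℝ 1 fun x : ℂ => (x - p) / (ε : ℂ) :=
    (contDiff_id.sub contDiff_const).div_const _
  have hρψ : ContDiffOn ℝ 1 (fun x => ρ ((x - p) / ε)) (homothety p hε '' U) :=
    hρ.comp hψ.contDiffOn fun x hx => (mem_homothety_image p hε U x).1 hx
  refine ⟨homothety p hε '' U, fun x => ρ ((x - p) / ε), hUo, mem_image_of_mem _ hzU, hρψ, ?_, ?_⟩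
  · rintro _ ⟨y, hy, rfl⟩ h0
    refine hd y hy ?_
    have h1 : DifferentiableAt ℝ (fun x => ρ ((x - p) / ε)) (homothety p hε y) :=
      (hρψ.contDiffAt (hUo.mem_nhds (mem_image_of_mem _ hy))).differentiableAt one_ne_zero
    have h2 : DifferentiableAt ℝ (homothety p hε) y := by
      have : (homothety p hε : ℂ → ℂ) = fun z => p + ε * z := rfl
      rw [this]
      fun_prop
    have h3 : ρ = (fun x => ρ ((x - p) / ε)) ∘ homothety p hε := by
      ext z
      rw [Function.comp_apply, ← homothety_symm_apply p hε, Homeomorph.symm_apply_apply]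
    rw [h3, fderiv_comp _ h1 h2, h0, ContinuousLinearMap.zero_comp]
  · ext x
    have hx := Set.ext_iff.1 hD ((x - p) / ε)
    simp only [mem_inter_iff, mem_ofPred_eq] at hx ⊢
    rw [mem_homothety_image, mem_homothety_image]
    exact hx

theorem setIntegral_homothety {E : Type*} [NormedAddCommGroup E] [NormedSpace ℝ E] {S : Set ℂ}
    (hS : MeasurableSet S) (p : ℂ) {ε : ℝ} (hε : 0 < ε) (f : ℂ → E) :
    ∫ x in homothety p hε '' S, f x = ε ^ 2 • ∫ z in S, f (p + ε * z) := by
  have hm : MeasurableSet (homothety p hε '' S) :=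
    (homothety p hε).toMeasurableEquiv.measurableEmbedding.measurableSet_image.2 hS
  rw [← integral_indicator hm, ← integral_indicator hS]
  have e1 := Measure.integral_comp_smul (volume : Measure ℂ)
    (fun z => (homothety p hε '' S).indicator f (p + z)) ε
  rw [integral_add_left_eq_self, Complex.finrank_real_complex, abs_of_pos (by positivity)] at e1
  have e2 : ∀ z : ℂ, (homothety p hε '' S).indicator f (p + ε • z) =
      S.indicator (fun z => f (p + ε * z)) z := fun z => by
    rw [Complex.real_smul, ← homothety_apply p hε]
    by_cases hz : z ∈ S
    · rw [indicator_of_mem hz, indicator_of_mem (mem_image_of_mem (homothety p hε) hz), homothety_apply]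
    · rw [indicator_of_notMem hz, indicator_of_notMem]
      rintro ⟨y, hy, hyz⟩
      exact hz ((homothety p hε).injective hyz ▸ hy)
  simp only [e2] at e1
  rw [e1, smul_smul, mul_inv_cancel₀ (by positivity), one_smul]

theorem average_homothety {S : Set ℂ} (hS : IsOpen S) (hb : Bornology.IsBounded S)
    (hne : S.Nonempty) (hz : ∫ z in S, z = 0) (p : ℂ) {ε : ℝ} (hε : 0 < ε) :
    (⨍ z in homothety p hε '' S, z) = p := by
  have hfin : volume S ≠ ⊤ := hb.measure_lt_top.ne
  have hpos : 0 < volume.real S := ENNReal.toReal_pos (hS.measure_pos volume hne).ne' hfin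
  have hm := hS.measurableSet
  have hi : IntegrableOn (fun z : ℂ => z) S :=
    (continuous_id.continuousOn.integrableOn_compact hb.isCompact_closure).mono_set subset_closure
  have e1 : volume.real (homothety p hε '' S) = ε ^ 2 * volume.real S := by
    have := setIntegral_homothety hm p hε fun _ => (1 : ℝ)
    simpa using this
  have e2 : ∫ z in homothety p hε '' S, z = ε ^ 2 • (volume.real S • p) := by
    have hi1 : IntegrableOn (fun _ : ℂ => p) S := integrableOn_const hfin
    have hi2 : IntegrableOn (fun z : ℂ => (ε : ℂ) * z) S := hi.const_mul _
    rw [setIntegral_homothety hm p hε, integral_add hi1 hi2, setIntegral_const,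
      integral_const_mul, hz, mul_zero, add_zero]
  rw [setAverage_eq, e1, e2, smul_smul, smul_smul]
  have : (ε ^ 2 * volume.real S)⁻¹ * (ε ^ 2 * volume.real S) = 1 :=
    inv_mul_cancel₀ (by positivity)
  rw [mul_assoc, this, one_smul]

/-! ### The effective potential -/

/-- The effective potential in the rotating frame, in the coordinates of the first patch. -/
def effPot (β : ℝ) (N : ℕ) (L μ : ℝ) (u : C(Angles, ℝ)) (z : ℂ) : ℝ :=
  patchPot β u z + farPot β N L u z + μ * centrifugal L z

theorem contDiff_effPot {β : ℝ} (h0 : 0 ≤ β) (h1 : β < 1) (N : ℕ) (L μ : ℝ) (u : C(Angles, ℝ)) :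
    ContDiff ℝ 1 (effPot β N L μ u) := by
  have hp := contDiff_patchPot h0 h1 u
  have hc : ContDiff ℝ 1 (centrifugal L) :=
    Complex.reCLM.contDiff.add ((contDiff_norm_sq ℝ).div_const _)
  have hf : ContDiff ℝ 1 (farPot β N L u) := by
    refine ContDiff.sum fun m _ => ?_
    exact (hp.comp ((contDiff_const.mul contDiff_id).add contDiff_const)).sub contDiff_const
  exact (hp.add hf).add (contDiff_const.mul hc)

theorem abs_centrifugal_radial_sub_le {L : ℝ} (hL : 4 ≤ |L|) {ρ ρ' : ℝ} (hρ : |ρ - 1| ≤ 1 / 4)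
    (hρ' : |ρ' - 1| ≤ 1 / 4) (α : Angles) :
    |centrifugal L (ρ * unitVec α) - centrifugal L (ρ' * unitVec α)| ≤ 2 * |ρ - ρ'| := by
  have h := abs_centrifugal_sub_le hL (u := ContinuousMap.const _ (ρ - 1))
    (w := ContinuousMap.const _ (ρ' - 1)) (α := α) hρ hρ'
  simpa [boundaryPoint] using h

/-- The errors are c from the patch itself, c from the other patches and 2c from the centrifugal
term, together 4c ≤ a/2. So along each ray the effective potential decreases with slope at least
a/2. -/
theorem effPot_radial {β : ℝ} {N : ℕ} {L μ a c δ : ℝ} {u : C(Angles, ℝ)} (hL : 4 ≤ |L|)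
    (hδ : δ ≤ 1 / 4) (hc : 4 * c ≤ a / 2) (hμ : |μ| ≤ c)
    (hfar : ∀ z z' : ℂ, ‖z‖ ≤ 2 → ‖z'‖ ≤ 2 →
      |farPot β N L u z - farPot β N L u z'| ≤ c * ‖z - z'‖)
    (hpot : ∀ ρ ρ' : ℝ, |ρ - 1| ≤ δ → |ρ' - 1| ≤ δ → ∀ α,
      |patchPot β u (ρ * unitVec α) - patchPot β u (ρ' * unitVec α) + a * (ρ - ρ')| ≤
        c * |ρ - ρ'|) {ρ ρ' : ℝ} (hρ : |ρ - 1| ≤ δ) (hρ' : |ρ' - 1| ≤ δ) (α : Angles) :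
    |effPot β N L μ u (ρ * unitVec α) - effPot β N L μ u (ρ' * unitVec α) + a * (ρ - ρ')| ≤
      a / 2 * |ρ - ρ'| := by
  have hn : ∀ ρ : ℝ, |ρ - 1| ≤ δ → ‖(ρ : ℂ) * unitVec α‖ ≤ 2 := fun ρ hρ => by
    rw [norm_mul, norm_unitVec, mul_one, Complex.norm_real, Real.norm_eq_abs]
    have := abs_add_le (ρ - 1) 1
    rw [sub_add_cancel, abs_one] at this
    linarith
  have b1 := hfar _ _ (hn ρ hρ) (hn ρ' hρ')
  rw [← sub_mul, norm_mul, norm_unitVec, mul_one, ← Complex.ofReal_sub, Complex.norm_real,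
    Real.norm_eq_abs] at b1
  have b2 := hpot ρ ρ' hρ hρ' α
  have b3 := abs_centrifugal_radial_sub_le hL (hρ.trans hδ) (hρ'.trans hδ) α
  have b4 : |μ * (centrifugal L (ρ * unitVec α) - centrifugal L (ρ' * unitVec α))| ≤
      c * (2 * |ρ - ρ'|) := by
    rw [abs_mul]
    exact mul_le_mul hμ b3 (abs_nonneg _) ((abs_nonneg _).trans hμ)
  have e : effPot β N L μ u (ρ * unitVec α) - effPot β N L μ u (ρ' * unitVec α) + a * (ρ - ρ') =
      (patchPot β u (ρ * unitVec α) - patchPot β u (ρ' * unitVec α) + a * (ρ - ρ')) +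
      (farPot β N L u (ρ * unitVec α) - farPot β N L u (ρ' * unitVec α)) +
      μ * (centrifugal L (ρ * unitVec α) - centrifugal L (ρ' * unitVec α)) := by
    simp only [effPot]; ring
  rw [e]
  refine (abs_add_le _ _).trans ((add_le_add ((abs_add_le _ _).trans (add_le_add b2 b1)) b4).trans
    ?_)
  nlinarith [abs_nonneg (ρ - ρ')]

/-- A radial step of length s lowers f by at least (a/2)s, whereas with zero derivative the change
would be below (a/4)s for small s. -/
theorem fderiv_ne_zero_of_radial {f : ℂ → ℝ} (hf : Differentiable ℝ f) {a δ : ℝ} (ha : 0 < a)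
    (hrad : ∀ ρ ρ' : ℝ, |ρ - 1| ≤ δ → |ρ' - 1| ≤ δ → ∀ α,
      |f (ρ * unitVec α) - f (ρ' * unitVec α) + a * (ρ - ρ')| ≤ a / 2 * |ρ - ρ'|)
    {z : ℂ} (hz : |‖z‖ - 1| < δ) : fderiv ℝ f z ≠ 0 := by
  intro h0
  set α := angle z
  set g : ℝ → ℝ := fun ρ => f (ρ * unitVec α) with hg
  have hline : HasDerivAt (fun ρ : ℝ => (ρ : ℂ) * unitVec α) (unitVec α) ‖z‖ := by
    simpa using (Complex.ofRealCLM.hasDerivAt (x := ‖z‖)).mul_const (unitVec α)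
  have hd : HasDerivAt g 0 ‖z‖ := by
    have hfz : HasFDerivAt f (0 : ℂ →L[ℝ] ℝ) ((‖z‖ : ℂ) * unitVec α) := by
      rw [norm_mul_unitVec, ← h0]
      exact (hf z).hasFDerivAt
    exact hfz.comp_hasDerivAt ‖z‖ hline
  have hlim := (hasDerivAt_iff_isLittleO.1 hd)
  rw [Asymptotics.isLittleO_iff] at hlim
  have hev := hlim (show 0 < a / 4 by positivity)
  obtain ⟨η, hη, hball⟩ := Metric.eventually_nhds_iff.1 hev
  set s := min (η / 2) ((δ - |‖z‖ - 1|) / 2) with hs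
  have hs0 : 0 < s := lt_min (by linarith) (by linarith)
  have hs1 : s ≤ η / 2 := min_le_left _ _
  have hs2 : s ≤ (δ - |‖z‖ - 1|) / 2 := min_le_right _ _
  have hclose := hball (y := ‖z‖ + s) (by
    rw [Real.dist_eq, add_sub_cancel_left, abs_of_pos hs0]; linarith)
  have hr := hrad (‖z‖ + s) ‖z‖ (by
    have := abs_add_le (‖z‖ - 1) s
    rw [abs_of_pos hs0] at this
    rw [add_sub_right_comm]
    linarith) hz.le α
  simp only [hg, smul_zero, sub_zero, add_sub_cancel_left, Real.norm_eq_abs, abs_of_pos hs0]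
    at hclose hr
  rw [abs_le] at hclose hr
  nlinarith [hclose.1, hr.2]

/-- On the annulus | |z| − 1 | < δ the function f is strictly decreasing along rays and equals k at
radius 1 + u, so there the patch is {f > k}. This gives C¹ regularity although u is only known to be
continuous. -/
theorem hasC1Boundary_of_radial {f : ℂ → ℝ} (hf : ContDiff ℝ 1 f) {a δ k : ℝ} (ha : 0 < a)
    (hδ : δ ≤ 1 / 4) (hrad : ∀ ρ ρ' : ℝ, |ρ - 1| ≤ δ → |ρ' - 1| ≤ δ → ∀ α,
      |f (ρ * unitVec α) - f (ρ' * unitVec α) + a * (ρ - ρ')| ≤ a / 2 * |ρ - ρ'|)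
    {u : C(Angles, ℝ)} (hu : ∀ α, |u α| < δ) (hk : ∀ α, f (boundaryPoint u α) = k) :
    HasC1Boundary (starPatch u) := by
  have hu4 : ∀ α, |u α| ≤ 1 / 4 := fun α => (hu α).le.trans hδ
  intro p hp
  refine ⟨{z | |‖z‖ - 1| < δ}, fun z => k - f z, isOpen_lt (by fun_prop) continuous_const, ?_,
    (contDiff_const.sub hf).contDiffOn, ?_, ?_⟩
  · obtain ⟨α, rfl⟩ := frontier_starPatch_subset hu4 hp
    change |‖boundaryPoint u α‖ - 1| < δ
    rw [norm_boundaryPoint (hu4 α), add_sub_cancel_left]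
    exact hu α
  · intro z hz h
    rw [fderiv_const_sub, neg_eq_zero] at h
    exact fderiv_ne_zero_of_radial (hf.differentiable one_ne_zero) ha hrad hz h
  · ext z
    simp only [mem_inter_iff, mem_ofPred_eq, and_comm (a := z ∈ starPatch u), sub_neg]
    refine and_congr_right fun hz => ?_
    change ‖z‖ < 1 + u (angle z) ↔ _
    have h := hrad ‖z‖ (1 + u (angle z)) hz.le
      (by rw [add_sub_cancel_left]; exact (hu _).le) (angle z)
    have hb := hk (angle z)
    rw [boundaryPoint] at hb
    rw [norm_mul_unitVec, hb] at h
    constructor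
    · intro hlt
      rw [abs_of_neg (a := ‖z‖ - (1 + u (angle z))) (by linarith), abs_le] at h
      nlinarith [h.1]
    · intro hlt
      by_contra hge
      rw [not_lt] at hge
      rw [abs_of_nonneg (a := ‖z‖ - (1 + u (angle z))) (by linarith), abs_le] at h
      nlinarith [h.2]

/-- The potential of the polygon of patches in the coordinates of the first patch. -/
theorem exists_pot_polygonPatch {β : ℝ} (h0 : 0 ≤ β) (h1 : β < 1) {N : ℕ} (hN : 0 < N) (l : ℝ)
    {ε : ℝ} (hε : 0 < ε) (u : C(Angles, ℝ)) : ∃ C, ∀ z,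
    pot β (polygonPatch N ε (homothety l hε '' starPatch u)) (homothety l hε z) =
      1 / (Real.pi * ε ^ 2) * (ε ^ (2 - β) * (patchPot β u z + farPot β N (l / ε) u z) + C) := by
  set D := homothety (l : ℂ) hε '' starPatch u with hD
  have hε' : (ε : ℂ) ≠ 0 := by exact_mod_cast hε.ne'
  have hind : ∀ y, D.indicator (fun _ => (1 : ℝ)) y =
      (starPatch u).indicator (fun _ => 1) ((y - l) / ε) := fun y => by
    by_cases hy : y ∈ D
    · rw [indicator_of_mem hy, indicator_of_mem ((mem_homothety_image _ hε _ y).1 hy)]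
    · rw [indicator_of_notMem hy, indicator_of_notMem (mt (mem_homothety_image _ hε _ y).2 hy)]
  have hDb : IsBddDensity (D.indicator fun _ => (1 : ℝ)) := by
    refine isBddDensity_indicator ?_ ?_
    · exact (homothety (l : ℂ) hε).toMeasurableEquiv.measurableEmbedding.measurableSet_image.2
        (measurableSet_starPatch u)
    · obtain ⟨r, hr⟩ := (isBounded_starPatch u).subset_closedBall 0
      refine (Metric.isBounded_closedBall (x := (l : ℂ)) (r := ε * r)).subset ?_
      rintro _ ⟨z, hz, rfl⟩
      have := hr hz
      rw [mem_closedBall_zero_iff] at this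
      rw [mem_closedBall_iff_norm, homothety_apply, add_sub_cancel_left, norm_mul,
        Complex.norm_real, Real.norm_of_nonneg hε.le]
      gcongr
  obtain ⟨c, hc⟩ := pot_affine h0 h1 (isBddDensity_starPatch u) l hε
  simp only [← hind] at hc
  change ∀ z, pot β (D.indicator fun _ => 1) _ = ε ^ (2 - β) * patchPot β u z + c at hc
  refine ⟨∑ m ∈ Finset.Ico 1 N, (ε ^ (2 - β) * patchPot β u (((polygonInv N m : ℂ) - 1) *
    ((l / ε : ℝ) : ℂ)) + c) + c, fun z => ?_⟩
  rw [show polygonPatch N ε D = _ from funext (polygonPatch_eq N ε D), pot_const_mul,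
    pot_sum h0 h1 _ fun m _ => hDb.comp_rotation _]
  congr 1
  -- Rotating l + εz by o gives l + ε(oz + (o − 1)l/ε), so every vertex is evaluated in the
  -- coordinates of the first patch.
  have hterm : ∀ m, pot β (fun x => D.indicator (fun _ => (1 : ℝ))
      (((polygonRoot N ^ m)⁻¹ : Circle) * x)) (homothety l hε z) =
      ε ^ (2 - β) * patchPot β u (polygonInv N m * z + ((polygonInv N m : ℂ) - 1) *
        ((l / ε : ℝ) : ℂ)) + c := fun m => by
    rw [pot_rotation, ← hc, homothety_apply, polygonInv]
    congr 1
    push_cast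
    field_simp
    ring
  simp only [hterm]
  rw [Finset.sum_range_eq_add_Ico _ hN]
  have hz : polygonInv N 0 * z + ((polygonInv N 0 : ℂ) - 1) * ((l / ε : ℝ) : ℂ) = z := by
    simp [polygonInv]
  rw [hz, farPot]
  simp only [farTerm, Finset.sum_add_distrib, Finset.sum_sub_distrib, ← Finset.mul_sum]
  ring

theorem norm_sq_homothety (l : ℝ) (hl : l ≠ 0) {ε : ℝ} (hε : 0 < ε) (z : ℂ) :
    ‖homothety l hε z‖ ^ 2 = l ^ 2 + 2 * l * ε * centrifugal (l / ε) z := by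
  rw [homothety_apply, centrifugal, ← Complex.normSq_eq_norm_sq, ← Complex.normSq_eq_norm_sq,
    Complex.normSq_apply, Complex.normSq_apply]
  have := hε.ne'
  simp
  field_simp
  ring

theorem exists_isRotatingSolution {β : ℝ} (h0 : 0 ≤ β) (h1 : β < 1) {N : ℕ} (hN : 0 < N) {l : ℝ}
    (hl : l ≠ 0) {ε : ℝ} (hε : 0 < ε) {u : C(Angles, ℝ)} (hu : ∀ α, |u α| ≤ 1 / 4) {μ k : ℝ}
    (hk : ∀ α, effPot β N (l / ε) μ u (boundaryPoint u α) = k) :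
    ∃ Ω, IsRotatingSolution β (polygonPatch N ε (homothety l hε '' starPatch u)) Ω := by
  obtain ⟨C, hC⟩ := exists_pot_polygonPatch h0 h1 hN l hε u
  set B := kernelFactor β * (1 / (Real.pi * ε ^ 2)) with hB
  -- By `norm_sq_homothety`, Ω|x|²/2 equals Ωlε times the centrifugal potential plus a constant, so
  -- Ωlε must be the factor Bε^(2-β)μ.
  refine ⟨B * ε ^ (2 - β) * μ / (l * ε), ?_⟩
  refine isRotatingSolution_polygonPatch h0 h1 hN.ne'
    (c := B * ε ^ (2 - β) * k + B * C + B * ε ^ (2 - β) * μ / (l * ε) / 2 * l ^ 2)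
    ((Homeomorph.isOpen_image _).2 (isOpen_starPatch hu)) ?_ ?_
  · refine ((isBounded_starPatch u).isCompact_closure.image
      (homothety l hε).continuous).isBounded.subset (image_mono subset_closure)
  · intro x hx
    rw [← Homeomorph.image_frontier] at hx
    obtain ⟨z, hz, rfl⟩ := hx
    obtain ⟨α, rfl⟩ := frontier_starPatch_subset hu hz
    have h := hk α
    rw [potential_eq, hC, norm_sq_homothety l hl hε, ← h, effPot, hB]
    have := hε.ne'
    have := Real.pi_ne_zero
    field_simp
    ring

end VortexPolygon
end

theorem theorem1p1 (β : ℝ) (hβ₀ : 0 ≤ β) (hβ₁ : β < 1) (l : ℝ) (hl : l ≠ 0)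
    (N : ℕ) (hN : 2 ≤ N) :
    ∃ ε₀ : ℝ, 0 < ε₀ ∧ ∀ ε : ℝ, 0 < ε → ε < ε₀ →
      ∃ (D : Set ℂ) (Ω : ℝ),
        VortexPolygon.IsSimplyConnectedC1Domain D ∧
        (⨍ z in D, z) = (l : ℂ) ∧
        Metric.ball (l : ℂ) (ε * (1 - ε ^ (1 + β))) ⊆ D ∧
        D ⊆ Metric.ball (l : ℂ) (ε * (1 + ε ^ (1 + β))) ∧
        VortexPolygon.IsRotatingSolution β (VortexPolygon.polygonPatch N ε D) Ω := by
  open VortexPolygon in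
  have ha := layerEig_pos hβ₀ hβ₁
  obtain ⟨δ, hδ, hδ4, hrad⟩ := exists_patchPot_radial hβ₀ hβ₁ (c := layerEig β / 8) (by positivity)
  -- The bound a/8, with a = `layerEig β`, is what `effPot_radial` needs (4c ≤ a/2); δ/2 keeps the
  -- boundary strictly inside the annulus where the radial slope is controlled.
  obtain ⟨ε₀, hε₀, hsol⟩ := exists_equilibrium hβ₀ hβ₁ hl hN
    (c := min (layerEig β / 8) (δ / 2)) (by positivity)
  refine ⟨ε₀, hε₀, fun ε hε hlt => ?_⟩
  obtain ⟨hL, u, μ, k, heven, hu, hu', hμ, hcos, hfar, hk⟩ := hsol ε hε hlt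
  have hca : min (layerEig β / 8) (δ / 2) ≤ layerEig β / 8 := min_le_left _ _
  have huδ : ∀ α, |u α| ≤ δ / 2 := fun α => (hu' α).trans (min_le_right _ _)
  have hu4 : ∀ α, |u α| ≤ 1 / 4 := fun α => (huδ α).trans (by linarith)
  have hεp : 0 < ε ^ (1 + β) := by positivity
  have huε : ∀ α, |u α| ≤ ε ^ (1 + β) := fun α => (hu α).trans (by linarith)
  have hc1 : HasC1Boundary (starPatch u) := by
    refine hasC1Boundary_of_radial (contDiff_effPot hβ₀ hβ₁ N (l / ε) μ u) ha hδ4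
      (fun ρ ρ' hρ hρ' α => ?_) (fun α => (huδ α).trans_lt (by linarith)) hk
    exact effPot_radial hL hδ4 (c := layerEig β / 8) (by linarith) (hμ.trans hca)
      (fun z z' hz hz' => (hfar z z' hz hz').trans (by gcongr))
      (hrad u fun α => (huδ α).trans (by linarith)) hρ hρ' α
  have hopen := isOpen_starPatch hu4
  have hbdd := isBounded_starPatch u
  obtain ⟨Ω, hΩ⟩ := exists_isRotatingSolution hβ₀ hβ₁ (by omega) hl hε hu4 hk
  refine ⟨homothety l hε '' starPatch u, Ω, ⟨(Homeomorph.isOpen_image _).2 hopen,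
    (Homeomorph.isSimplyConnected_image _).2 (isSimplyConnected_starPatch hu4),
    (hbdd.isCompact_closure.image (homothety l hε).continuous).isBounded.subset
      (image_mono subset_closure), hc1.homothety_image l hε⟩,
    average_homothety hopen hbdd ⟨0, ball_subset_starPatch hu4 (by simp; norm_num)⟩
      (integral_starPatch_id hu4 heven hcos) l hε, fun x hx => ?_, ?_, hΩ⟩
  · rw [mem_homothety_image]
    refine ball_subset_starPatch huε ?_
    rw [mem_ball_iff_norm] at hx
    rw [mem_ball_zero_iff, norm_homothety_symm _ hε, div_lt_iff₀ hε]
    linarith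
  · intro x hx
    rw [mem_homothety_image] at hx
    have := starPatch_subset_ball huε hx
    rw [mem_ball_zero_iff, norm_homothety_symm _ hε, div_lt_iff₀ hε] at this
    rw [mem_ball_iff_norm]
    linarith
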